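/- **Setting.** Let $J:\mathbb R\to[0,\infty)$ be a symmetric probability density with continuous derivative, support in $[-1,1]$ and $J(0)>0$. For $\gamma>0$ let $J_\gamma(x,y)=c_\gamma\gamma J(\gamma(x-y))$, $x,y\in\mathbb Z$, with $c_\gamma$ such that $\sum_{y\ne x}J_\gamma(x,y)=1$. Let $\alpha,a>0$, $\ell_\pm=\gamma^{-(1\pm\alpha)}$, $\zeta=\gamma^a$; we consider only $\gamma\in\{2^{-n}:n\in\mathbb N\}$ such that $\gamma^{-1/2},\gamma^{-\alpha},\ell_-,\ell_+$ all belong to $\{2^n:n\ge1\}$. For spins $\sigma\in\{-1,1\}^{\mathbb Z^2}$ the chessboard Hamiltonian is $$H_{\gamma,\epsilon}=-\tfrac12\sum_{x\ne y,\,i}J_\gamma(x,y)\sigma(x,i)\sigma(y,i)-\epsilon\sum_{x,i}\chi_{x,i}\,\sigma(x,i)\sigma(x,i+1),$$ where $\chi_{x,i}=1$ if $\lfloor x/\ell_+\rfloor+i$ is even and $\chi_{x,i}=0$ otherwise. For a finite $\Lambda\subset\mathbb Z^2$, a configuration $\bar\sigma$ on $\Lambda^c$ and a set $\mathcal A$ of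 configurations, $Z_{\Lambda;\bar\sigma}(\mathcal A)=\sum_{\sigma_\Lambda:(\sigma_\Lambda,\bar\sigma)\in\mathcal A}e^{-H_{\gamma,\epsilon}(\sigma_\Lambda|\bar\sigma)}$, where $H_{\gamma,\epsilon}(\sigma_\Lambda|\bar\sigma)$ collects the interactions involving at least one site of $\Lambda$. *Spontaneous magnetization.* Let $\hat\pi_\epsilon(h_1,h_2)=\log\sum_{s_1,s_2=\pm1}e^{h_1s_1+h_2s_2+\epsilon s_1s_2}$, $\hat\phi_\epsilon(m_1,m_2)=\sup_{h}(h_1m_1+h_2m_2-\hat\pi_\epsilon(h))$ and $\hat f_\epsilon=-\frac12(m_1^2+m_2^2)+\hat\phi_\epsilon$ on $[-1,1]^2$. $m_\epsilon$ is the largest $m\in[0,1]$ such that $(m,m)$ minimizes $\hat f_\epsilon$ on $[-1,1]^2$ (for small $\epsilon>0$ the minimizers are $\pm(m_\epsilon,m_\epsilon)$ and $m_\epsilon>0$). *Rectangles and phases.* For $(k,j)\in\mathbb Z^2$ let $Q(k,j)=([k\ell_+,(k+1)\ell_+)\times I_{k,j})\cap\mathbb Z^2$, with $I_{k,j}=[j\gamma^{-\alpha},(j+1)\gamma^{-\alpha})$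 for $k$ even and $I_{k,j}=(j\gamma^{-\alpha},(j+1)\gamma^{-\alpha}]$ for $k$ odd. Let $\sigma^{(\ell_-)}(x,i)$ be the average of the spins $\sigma(y,i)$ with $\lfloor y/\ell_-\rfloor=\lfloor x/\ell_-\rfloor$; $\eta(x,i)=\pm1$ if $|\sigma^{(\ell_-)}(x,i)\mp m_\epsilon|\le\zeta$ and $\eta(x,i)=0$ otherwise; $\Theta=\pm1$ on $Q(k,j)$ if $\eta=\pm1$ on all of $\bigcup_{u,v\in\{-1,0,1\}}Q(k+u,j+v)$, and $\Theta=0$ (undetermined) otherwise. Rectangles $Q(k,j)$, $Q(k',j')$ are connected if $|k-k'|\vee|j-j'|\le1$, and connected components of unions of rectangles are meant in this sense. *Contours.* Given $\sigma$ such that $\Theta$ is identically $1$, or identically $-1$, outside a bounded region, a contour is a pair $\Gamma=(\mathrm{sp}(\Gamma),\eta_\Gamma)$, where $\mathrm{sp}(\Gamma)$ is a maximal connected component of $\{\Theta=0\}$ and $\eta_\Gamma$ is the restriction of $\eta$ to it. Let $\mathrm{ext}(\Gamma)$ be the unbounded and $\mathrm{int}_k(\Gamma)$ the bounded connected components of $\mathrm{sp}(\Gamma)^c$,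 $\partial_{\rm out}(\Gamma)$ and $\partial_{{\rm out},k}(\Gamma)$ the unions of the rectangles of $\mathrm{ext}(\Gamma)$, respectively $\mathrm{int}_k(\Gamma)$, that are connected to $\mathrm{sp}(\Gamma)$, and $c(\Gamma)=\mathrm{sp}(\Gamma)\cup\bigcup_k\mathrm{int}_k(\Gamma)$. $\Theta$ is constant and non-zero on each of these boundaries, with a value determined by $\Gamma$; we write $\partial^\pm_{{\rm out},k}(\Gamma)$ if it is $\pm1$ on $\partial_{{\rm out},k}(\Gamma)$, and call $\Gamma$ a plus (minus) contour if $\Theta=1$ ($-1$) on $\partial_{\rm out}(\Gamma)$. For a plus contour $\Gamma$ and boundary spins $\bar\sigma$ on $c(\Gamma)^c$ with $\eta=1$ on $\partial_{\rm out}(\Gamma)$, $$W_\Gamma(\bar\sigma)=\frac{Z_{c(\Gamma);\bar\sigma}\big(\eta=\eta_\Gamma\text{ on }\mathrm{sp}(\Gamma);\ \Theta=\pm1\text{ on each }\partial^\pm_{{\rm out},k}(\Gamma)\big)}{Z_{c(\Gamma);\bar\sigma}\big(\Theta=1\text{ on }\mathrm{sp}(\Gamma)\text{ and on each }\partial^\pm_{{\rm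 out},k}(\Gamma)\big)};$$ for a minus contour the boundary spins satisfy $\eta=-1$ on $\partial_{\rm out}(\Gamma)$ and $\Theta=1$ is replaced by $\Theta=-1$ in the denominator (spin flip). **Theorem (The Peierls bounds).** Let $1\gg\alpha\gg a>0$, that is: there is $\alpha_0>0$ such that for every $\alpha\in(0,\alpha_0)$ there is $a_0>0$ such that for every $a\in(0,a_0)$ the following holds. There are $c>0$, $\epsilon_0>0$ and a function $\epsilon\mapsto\gamma_\epsilon$ from $(0,\infty)$ to $(0,\infty)$ such that for all $0<\epsilon\le\epsilon_0$, all $0<\gamma\le\gamma_\epsilon$ (subject to the above dyadic restriction), every plus or minus contour $\Gamma$ and all boundary spins $\bar\sigma$ as above, the denominator of $W_\Gamma(\bar\sigma)$ is positive and $$W_\Gamma(\bar\sigma)\le e^{-c\,|\mathrm{sp}(\Gamma)|\,\gamma^{2a+4\alpha}},$$ where $|\mathrm{sp}(\Gamma)|$ is the number of sites of $\mathrm{sp}(\Gamma)$. -/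

import Mathlib

/-! ### Lattice, spins, rectangles' indices -/

/-- A site `(x, i)` of `ℤ × ℤ`: `x` is the horizontal coordinate, `i` the layer. -/
abbrev Site := ℤ × ℤ

/-- The index `(k, j)` of a rectangle `Q (k, j)`. -/
abbrev RectIdx := ℤ × ℤ

/-- Spin configurations, with values in `{-1, +1}`. -/
abbrev Config := Site → ℤˣ

/-- The real value `±1` of a spin. -/
def spinVal (σ : Config) (p : Site) : ℝ := ((σ p : ℤ) : ℝ)

/-- The configuration equal to `τ` in `Λ` and to `σbar` outside. -/
def glue (Λ : Finset Site) (τ : Λ → ℤˣ) (σbar : Config) : Config :=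
  fun p => if h : p ∈ Λ then τ ⟨p, h⟩ else σbar p

/-! ### The Kac density -/

/-- `J` is a symmetric probability density on `ℝ` with continuous derivative, support in
`[-1, 1]`, and `J 0 > 0`. -/
structure IsKacDensity (J : ℝ → ℝ) : Prop where
  contDiff : ContDiff ℝ 1 J
  nonneg : ∀ r, 0 ≤ J r
  symm : ∀ r, J (-r) = J r
  support_subset : Function.support J ⊆ Set.Icc (-1) 1
  integral_eq_one : ∫ r, J r = 1
  pos_zero : 0 < J 0

/-! ### The two-layer mean field free energy and the spontaneous magnetization -/

/-- The pressure of a pair of spins with vertical coupling `ε` in the field `h`. -/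
noncomputable def pressure (ε : ℝ) (h : ℝ × ℝ) : ℝ :=
  Real.log (∑ s₁ : ℤˣ, ∑ s₂ : ℤˣ,
    Real.exp (h.1 * ((s₁ : ℤ) : ℝ) + h.2 * ((s₂ : ℤ) : ℝ)
      + ε * ((s₁ : ℤ) : ℝ) * ((s₂ : ℤ) : ℝ)))

/-- The free energy of two layers at magnetizations `m = (m₁, m₂) ∈ [-1, 1]²`, the Legendre
transform of the pressure (the supremum is over a set bounded above when `m ∈ [-1, 1]²`). -/
noncomputable def freeEnergyPhi (ε : ℝ) (m : ℝ × ℝ) : ℝ :=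
  ⨆ h : ℝ × ℝ, (h.1 * m.1 + h.2 * m.2 - pressure ε h)

/-- The two-layer mean field free energy at inverse temperature `1`. -/
noncomputable def freeEnergyF (ε : ℝ) (m : ℝ × ℝ) : ℝ :=
  -(1 / 2) * (m.1 ^ 2 + m.2 ^ 2) + freeEnergyPhi ε m

/-- The spontaneous magnetization `m_ε`. For small `ε > 0` the minimizers of the two-layer free
energy on `[-1, 1]²` are `(m_ε, m_ε)` and `(-m_ε, -m_ε)` with `m_ε > 0`, so that the set below is
the singleton `{m_ε}`. -/
noncomputable def spontMag (ε : ℝ) : ℝ :=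
  sSup {m : ℝ | 0 ≤ m ∧ m ≤ 1 ∧
    IsMinOn (freeEnergyF ε) (Set.Icc (-1) 1 ×ˢ Set.Icc (-1) 1) (m, m)}

/-! ### Connectedness of sets of rectangles -/

/-- `*`-adjacency of rectangle indices: distinct, and both coordinates differ by at most one. -/
def starGraph : SimpleGraph RectIdx where
  Adj q q' := q ≠ q' ∧ |q.1 - q'.1| ≤ 1 ∧ |q.2 - q'.2| ≤ 1
  symm := ⟨fun q q' h => ⟨h.1.symm, by rw [abs_sub_comm]; exact h.2.1,
    by rw [abs_sub_comm]; exact h.2.2⟩⟩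
  loopless := ⟨fun _ h => h.1 rfl⟩

/-- `A` is a maximal `*`-connected (non-empty) subset of `S`. -/
def IsStarComponent (S A : Set RectIdx) : Prop :=
  Maximal (fun B : Set RectIdx => B ⊆ S ∧ (starGraph.induce B).Connected) A

/-- The union of the unbounded connected components of the complement of `A` (there is exactly
one of them when `A` is finite). -/
def extRects (A : Set RectIdx) : Set RectIdx :=
  {q | ∃ B, IsStarComponent Aᶜ B ∧ B.Infinite ∧ q ∈ B}

/-- `B` is one of the bounded connected components of the complement of `A`. -/
def IsInterior (A B : Set RectIdx) : Prop := IsStarComponent Aᶜ B ∧ B.Finite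

/-- `A` together with the bounded connected components of its complement. -/
def filledRects (A : Set RectIdx) : Set RectIdx :=
  A ∪ {q | ∃ B, IsInterior A B ∧ q ∈ B}

/-- The rectangles of `B` which are connected to `A`. -/
def outBoundary (A B : Set RectIdx) : Set RectIdx :=
  {q | q ∈ B ∧ ∃ q' ∈ A, starGraph.Adj q q'}

/-- A `*`-path inside `S` starting in a component of `S` stays in it. -/
theorem IsStarComponent.path_mem {S B : Set RectIdx} (hB : IsStarComponent S B)
    (f : ℕ → RectIdx) (h0 : f 0 ∈ B) (hS : ∀ t, f t ∈ S)
    (hadj : ∀ t, starGraph.Adj (f t) (f (t + 1))) (t : ℕ) : f t ∈ B := by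
  induction t with
  | zero => exact h0
  | succ t ih =>
    have hpair : (starGraph.induce {f t, f (t + 1)}).Connected :=
      SimpleGraph.induce_pair_connected_of_adj (hadj t)
    have hun : (starGraph.induce (B ∪ {f t, f (t + 1)})).Connected :=
      SimpleGraph.induce_union_connected hB.prop.2.preconnected hpair.preconnected ⟨f t, ih, by simp⟩
    have hsub : B ∪ {f t, f (t + 1)} ⊆ S := by
      rintro q (hq | rfl | rfl)
      · exact hB.prop.1 hq
      · exact hS t
      · exact hS (t + 1)
    exact hB.le_of_ge ⟨hsub, hun⟩ Set.subset_union_left (by simp)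

theorem filledRects_finite (A : Finset RectIdx) : (filledRects (A : Set RectIdx)).Finite := by
  obtain ⟨R, hR⟩ : ∃ R : ℤ, ∀ q ∈ A, |q.1| ≤ R ∧ |q.2| ≤ R := by
    refine ⟨∑ q ∈ A, (|q.1| + |q.2|), fun q hq => ?_⟩
    have h := Finset.single_le_sum (f := fun q : RectIdx => |q.1| + |q.2|)
      (fun q _ => by positivity) hq
    have h1 := abs_nonneg q.1
    have h2 := abs_nonneg q.2
    constructor <;> linarith
  have key : ∀ B, IsInterior (A : Set RectIdx) B →
      B ⊆ Set.Icc (-R) R ×ˢ Set.Icc (-R) R := by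
    rintro B ⟨hB, hfin⟩ q hq
    by_contra hout
    obtain ⟨d, hd, hray⟩ : ∃ d : ℤ × ℤ, (d ≠ 0 ∧ |d.1| ≤ 1 ∧ |d.2| ≤ 1) ∧
        ∀ t : ℕ, q + t • d ∉ A := by
      have hq' : R < q.1 ∨ q.1 < -R ∨ R < q.2 ∨ q.2 < -R := by
        by_contra hcon
        push Not at hcon
        exact hout ⟨⟨hcon.2.1, hcon.1⟩, ⟨hcon.2.2.2, hcon.2.2.1⟩⟩
      rcases hq' with h | h | h | h
      · refine ⟨(1, 0), by simp, fun t ht => ?_⟩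
        have := abs_le.1 (hR _ ht).1
        simp at this
        omega
      · refine ⟨(-1, 0), by simp, fun t ht => ?_⟩
        have := abs_le.1 (hR _ ht).1
        simp at this
        omega
      · refine ⟨(0, 1), by simp, fun t ht => ?_⟩
        have := abs_le.1 (hR _ ht).2
        simp at this
        omega
      · refine ⟨(0, -1), by simp, fun t ht => ?_⟩
        have := abs_le.1 (hR _ ht).2
        simp at this
        omega
    have hmem : ∀ t : ℕ, q + t • d ∈ B :=
      hB.path_mem (fun t => q + t • d) (by simpa using hq) (fun t => by simpa using hray t)
        (fun t => by
          have e1 : q + t • d - (q + (t + 1) • d) = -d := by rw [succ_nsmul]; abel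
          refine ⟨fun h => hd.1 ?_, ?_, ?_⟩
          · have h' := sub_eq_zero.2 h
            rw [e1] at h'
            exact neg_eq_zero.1 h'
          · rw [← Prod.fst_sub, e1]
            simpa using hd.2.1
          · rw [← Prod.snd_sub, e1]
            simpa using hd.2.2)
    refine Set.infinite_of_injective_forall_mem (f := fun t : ℕ => q + t • d) ?_ hmem hfin
    intro s t hst
    have hst' : s • d = t • d := add_left_cancel hst
    have h1 := congrArg Prod.fst hst'
    have h2 := congrArg Prod.snd hst'
    rw [Prod.smul_fst, Prod.smul_fst, nsmul_eq_mul, nsmul_eq_mul] at h1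
    rw [Prod.smul_snd, Prod.smul_snd, nsmul_eq_mul, nsmul_eq_mul] at h2
    by_contra hne
    have hne' : (s : ℤ) ≠ t := by exact_mod_cast hne
    apply hd.1
    have d1 : d.1 = 0 := by
      have : ((s : ℤ) - t) * d.1 = 0 := by linarith
      rcases mul_eq_zero.1 this with h | h
      · omega
      · exact h
    have d2 : d.2 = 0 := by
      have : ((s : ℤ) - t) * d.2 = 0 := by linarith
      rcases mul_eq_zero.1 this with h | h
      · omega
      · exact h
    exact Prod.ext d1 d2
  refine A.finite_toSet.union (Set.Finite.subset
    ((Set.finite_Icc (-R) R).prod (Set.finite_Icc (-R) R)) ?_)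
  rintro q ⟨B, hB, hq⟩
  exact key B hB hq

/-! ### Scales and the model -/

/-- The dyadic restrictions on the scales: `γ = 2 ^ (-n)`, and `γ ^ (-α)` and the lengths
`γ ^ (-1/2)`, `ℓ₋ = γ ^ (-(1 - α))`, `ℓ₊ = γ ^ (-(1 + α))` belong to `{2 ^ n, n ≥ 1}`.
The data are uniquely determined by `α` and `γ`. -/
structure DyadicScales (α γ : ℝ) where
  n : ℕ
  gamma_eq : γ = ((2 : ℝ) ^ n)⁻¹
  half : ℕ
  half_pos : 0 < half
  half_eq : γ ^ (-(1 / 2) : ℝ) = 2 ^ half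
  vert : ℕ
  vert_pos : 0 < vert
  vert_eq : γ ^ (-α) = 2 ^ vert
  minus : ℕ
  minus_pos : 0 < minus
  minus_eq : γ ^ (-(1 - α)) = 2 ^ minus
  plus : ℕ
  plus_pos : 0 < plus
  plus_eq : γ ^ (-(1 + α)) = 2 ^ plus

/-- The parameters of the model: Kac density `J`, vertical coupling `ε`, Kac parameter `γ`,
the exponents `α` and `a` of the scales and of the accuracy. -/
structure KacModel where
  J : ℝ → ℝ
  ε : ℝ
  γ : ℝ
  α : ℝ
  a : ℝ
  scales : DyadicScales α γ

/-- A pair `(sp, η_Γ)`: the set of (indices of) the rectangles of the spatial support, and the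
specification, of which only the values on the support matter. -/
structure Contour where
  sp : Finset RectIdx
  spec : Site → SignType

namespace KacModel

variable (M : KacModel)

/-- `ℓ₊ = γ ^ (-(1 + α))`. -/
def ellPlus : ℕ := 2 ^ M.scales.plus

/-- `ℓ₋ = γ ^ (-(1 - α))`. -/
def ellMinus : ℕ := 2 ^ M.scales.minus

/-- `γ ^ (-α)`, the number of layers in a rectangle. -/
def height : ℕ := 2 ^ M.scales.vert

/-- The accuracy `ζ = γ ^ a`. -/
noncomputable def zeta : ℝ := M.γ ^ M.a

/-- The normalization constant `c_γ`. -/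
noncomputable def kacNorm : ℝ := (∑' z : ℤ, if z = 0 then 0 else M.γ * M.J (M.γ * z))⁻¹

/-- `J_γ(x, y) = c_γ γ J(γ (x - y))`, used only for `x ≠ y`. -/
noncomputable def kac (x y : ℤ) : ℝ := M.kacNorm * M.γ * M.J (M.γ * ((x : ℝ) - y))

/-- `χ (x, i) = 1` if `⌊x / ℓ₊⌋ + i` is even, and `0` otherwise. -/
noncomputable def chi (p : Site) : ℝ := if Even (p.1 / (M.ellPlus : ℤ) + p.2) then 1 else 0

/-- The chessboard Hamiltonian in the finite region `Λ`, interacting with the outside, at the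
configuration `σ` (which is `σ_Λ` in `Λ` and the boundary condition outside). The horizontal sum
over `y` has finitely many non-zero terms; the last sum is over the vertical bonds
`{(x, i), (x, i + 1)}` with at least one end in `Λ`. -/
noncomputable def energy (Λ : Finset Site) (σ : Config) : ℝ :=
  - (1 / 2) * (∑ p ∈ Λ, ∑ q ∈ Λ, if p.2 = q.2 ∧ p.1 ≠ q.1 then
        M.kac p.1 q.1 * spinVal σ p * spinVal σ q else 0)
  - (∑ p ∈ Λ, ∑' y : ℤ, if (y, p.2) ∈ Λ then 0 else
        M.kac p.1 y * spinVal σ p * spinVal σ (y, p.2))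
  - M.ε * ∑ p ∈ Λ ∪ Λ.image (fun p => (p.1, p.2 - 1)),
        M.chi p * spinVal σ p * spinVal σ (p.1, p.2 + 1)

open Classical in
/-- The partition function in `Λ` with boundary condition `σbar` and constraint `𝒜`. -/
noncomputable def partitionFn (Λ : Finset Site) (σbar : Config) (𝒜 : Set Config) : ℝ :=
  ∑ τ : Λ → ℤˣ, if glue Λ τ σbar ∈ 𝒜 then Real.exp (-M.energy Λ (glue Λ τ σbar)) else 0

/-! ### Coarse graining -/

/-- The rectangle `Q (k, j)`. -/
noncomputable def Q (q : RectIdx) : Finset Site :=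
  Finset.Ico (q.1 * M.ellPlus) ((q.1 + 1) * M.ellPlus) ×ˢ
    (if Even q.1 then Finset.Ico (q.2 * M.height) ((q.2 + 1) * M.height)
      else Finset.Ioc (q.2 * M.height) ((q.2 + 1) * M.height))

/-- The union of the rectangles with index in `A`. -/
noncomputable def region (A : Finset RectIdx) : Finset Site := A.biUnion M.Q

/-- The empirical magnetization on the interval of length `ℓ₋` of the layer containing the
site. -/
noncomputable def empMag (σ : Config) (p : Site) : ℝ :=
  (1 / (M.ellMinus : ℝ)) *
    ∑ y ∈ Finset.Ico (p.1 / (M.ellMinus : ℤ) * M.ellMinus)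
      ((p.1 / (M.ellMinus : ℤ) + 1) * M.ellMinus), spinVal σ (y, p.2)

open Classical in
/-- The phase indicator on the scale `ℓ₋`. -/
noncomputable def eta (σ : Config) (p : Site) : SignType :=
  if |M.empMag σ p - spontMag M.ε| ≤ M.zeta then 1
  else if |M.empMag σ p + spontMag M.ε| ≤ M.zeta then -1
  else 0

/-- `η = s` on the `3 × 3` block of rectangles around `q`. -/
def EtaOnBlock (σ : Config) (q : RectIdx) (s : SignType) : Prop :=
  ∀ u ∈ Finset.Icc (-1 : ℤ) 1, ∀ v ∈ Finset.Icc (-1 : ℤ) 1,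
    ∀ p ∈ M.Q (q.1 + u, q.2 + v), M.eta σ p = s

open Classical in
/-- The (constant) value of `Θ` on the rectangle `Q q`. -/
noncomputable def Theta (σ : Config) (q : RectIdx) : SignType :=
  if M.EtaOnBlock σ q 1 then 1
  else if M.EtaOnBlock σ q (-1) then -1
  else 0

/-! ### Contours and their weights -/

/-- `Γ` is a contour of the configuration `σ`, where `Θ` is identically `1` (or identically `-1`)
outside a bounded region: its support is a maximal connected component of the undetermined
region and its specification is the restriction of `η` to it. -/
def IsContourOf (σ : Config) (Γ : Contour) : Prop :=
  ({q | M.Theta σ q ≠ 1}.Finite ∨ {q | M.Theta σ q ≠ -1}.Finite) ∧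
  IsStarComponent {q | M.Theta σ q = 0} (Γ.sp : Set RectIdx) ∧
  ∀ p ∈ M.region Γ.sp, Γ.spec p = M.eta σ p

/-- `Θ = s` on the rectangles of `B` connected to `sp(Γ)`, for `B` a connected component of the
complement of `sp(Γ)` and `Γ` a contour. This does not depend on the configuration `σ` of which
`Γ` is a contour, see `theta_eq_of_isContourOf`. -/
def HasSign (Γ : Contour) (B : Set RectIdx) (s : SignType) : Prop :=
  ∃ σ, M.IsContourOf σ Γ ∧ ∀ q ∈ outBoundary Γ.sp B, M.Theta σ q = s

/-- `Γ` is a plus contour (`s = 1`) or a minus contour (`s = -1`). -/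
def IsContour (s : SignType) (Γ : Contour) : Prop :=
  (s = 1 ∨ s = -1) ∧ M.HasSign Γ (extRects Γ.sp) s

/-- `c(Γ)`, the support of the contour together with its interiors. -/
noncomputable def filled (Γ : Contour) : Finset Site :=
  M.region (filledRects_finite Γ.sp).toFinset

/-- Boundary spins for a contour of sign `s`: `η = s` on `∂_out(Γ)`. As `∂_out(Γ)` is a union of
rectangles in the complement of `c(Γ)`, this involves only the spins outside `c(Γ)`. -/
def IsBoundarySpins (s : SignType) (Γ : Contour) (σbar : Config) : Prop :=
  ∀ q ∈ outBoundary Γ.sp (extRects Γ.sp), ∀ p ∈ M.Q q, M.eta σbar p = s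

/-- The constraint in the numerator of the weight: `η = η_Γ` on `sp(Γ)`, and `Θ = ±1` on each
`∂^±_{out,k}(Γ)`. -/
def numConstraint (Γ : Contour) : Set Config :=
  {σ | (∀ p ∈ M.region Γ.sp, M.eta σ p = Γ.spec p) ∧
    ∀ B, IsInterior (Γ.sp : Set RectIdx) B → ∀ t, M.HasSign Γ B t →
      ∀ q ∈ outBoundary Γ.sp B, M.Theta σ q = t}

/-- The constraint in the denominator of the weight of a contour of sign `s`: `Θ = s` on `sp(Γ)`
and on each `∂_{out,k}(Γ)`. -/
def denConstraint (s : SignType) (Γ : Contour) : Set Config :=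
  {σ | (∀ q ∈ Γ.sp, M.Theta σ q = s) ∧
    ∀ B, IsInterior (Γ.sp : Set RectIdx) B → ∀ q ∈ outBoundary Γ.sp B, M.Theta σ q = s}

/-- The numerator of the weight. -/
noncomputable def weightNum (Γ : Contour) (σbar : Config) : ℝ :=
  M.partitionFn (M.filled Γ) σbar (M.numConstraint Γ)

/-- The denominator of the weight of a contour of sign `s`. -/
noncomputable def weightDen (s : SignType) (Γ : Contour) (σbar : Config) : ℝ :=
  M.partitionFn (M.filled Γ) σbar (M.denConstraint s Γ)

/-- The weight `W_Γ(σbar)` of a contour of sign `s`; the case `s = -1` is the spin flip of the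
case `s = 1`. -/
noncomputable def weight (s : SignType) (Γ : Contour) (σbar : Config) : ℝ :=
  M.weightNum Γ σbar / M.weightDen s Γ σbar

/-! ### The signs of a contour are well defined -/

theorem Q_nonempty (q : RectIdx) : (M.Q q).Nonempty := by
  have h1 : (0 : ℤ) < M.ellPlus := by unfold ellPlus; positivity
  have h2 : (0 : ℤ) < M.height := by unfold height; positivity
  unfold Q
  refine Finset.Nonempty.product ?_ ?_
  · exact Finset.nonempty_Ico.2 (by nlinarith)
  · split_ifs
    · exact Finset.nonempty_Ico.2 (by nlinarith)
    · exact Finset.nonempty_Ioc.2 (by nlinarith)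

theorem eta_eq_of_theta {σ : Config} {q q' : RectIdx} (h0 : M.Theta σ q ≠ 0)
    (hadj : starGraph.Adj q q') {p : Site} (hp : p ∈ M.Q q') : M.eta σ p = M.Theta σ q := by
  have hblock : M.EtaOnBlock σ q (M.Theta σ q) := by
    unfold Theta at h0 ⊢
    split_ifs with h1 h2
    · exact h1
    · exact h2
    · simp [h1, h2] at h0
  have hu := abs_le.1 hadj.2.1
  have hv := abs_le.1 hadj.2.2
  refine hblock (q'.1 - q.1) (Finset.mem_Icc.2 ⟨by linarith, by linarith⟩) (q'.2 - q.2)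
    (Finset.mem_Icc.2 ⟨by linarith, by linarith⟩) p ?_
  simpa using hp

/-- A rectangle outside `sp(Γ)` and connected to it has the same `Θ = ±1` in all the
configurations of which `Γ` is a contour. -/
theorem theta_eq_of_isContourOf {σ σ' : Config} {Γ : Contour} (h : M.IsContourOf σ Γ)
    (h' : M.IsContourOf σ' Γ) {q : RectIdx} (hq : q ∉ Γ.sp) {q' : RectIdx} (hq' : q' ∈ Γ.sp)
    (hadj : starGraph.Adj q q') : M.Theta σ q ≠ 0 ∧ M.Theta σ q = M.Theta σ' q := by
  have key : ∀ ω, M.IsContourOf ω Γ → M.Theta ω q ≠ 0 := by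
    intro ω hω h0
    have hun : (starGraph.induce ((Γ.sp : Set RectIdx) ∪ {q', q})).Connected :=
      SimpleGraph.induce_union_connected hω.2.1.prop.2.preconnected
        (SimpleGraph.induce_pair_connected_of_adj hadj.symm).preconnected ⟨q', hq', by simp⟩
    have hsub : (Γ.sp : Set RectIdx) ∪ {q', q} ⊆ {r | M.Theta ω r = 0} := by
      rintro r (hr | rfl | rfl)
      · exact hω.2.1.prop.1 hr
      · exact hω.2.1.prop.1 hq'
      · exact h0
    exact hq (hω.2.1.le_of_ge ⟨hsub, hun⟩ Set.subset_union_left (by simp))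
  obtain ⟨p, hp⟩ := M.Q_nonempty q'
  have hpr : p ∈ M.region Γ.sp := Finset.mem_biUnion.2 ⟨q', hq', hp⟩
  refine ⟨key σ h, ?_⟩
  rw [← M.eta_eq_of_theta (key σ h) hadj hp, ← M.eta_eq_of_theta (key σ' h') hadj hp,
    ← h.2.2 p hpr, ← h'.2.2 p hpr]

end KacModel

/-! The spins are coarse-grained on blocks of length `γ^(-1/2)`. Completing the squares in the Kac
interaction turns the energy of a profile `u` of block averages into the sum of `dualEnergy` over
the coupled vertical pairs plus a Dirichlet form, up to an error of order `γ^(1/4)` per site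
(`energy_lower`, `energy_upper`). The minimizers of `dualEnergy` on the square are `±(m, m)`, with
quadratic growth (`spontMag_spec`). What is left after subtracting the minimum is the nonnegative
`excess`.

A contour has large excess. The horizontal bonds and the chessboard bonds connect every block of 3 ×
3 rectangles (`eq_on_rectBlock`), so around an undetermined rectangle either `η` vanishes somewhere
or it changes across such a bond. Each of these defects costs `c γ ℓ₋² ζ² / 8`
(`mul_card_le_excess`). Divided by the volume `γ^(-(1+2α))` of a rectangle, this is of order
`γ^(2a+4α)` per site, which dominates `γ^(1/4)` when `α` and `a` are small.

To compare numerator and denominator, cut `sp(Γ)` at some depth and let `M` be the inner part.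
Outside `M` the phase is `±1` and constant within the range of the interaction. It extends to the
interiors, because its sign is constant along the boundary of each component of the complement
(`eq_on_outBoundary`, a vanishing first cohomology argument). Multiplying the spins outside `M` by
`s` times this phase leaves their energy unchanged and turns all phases into `s`. Inside `M` the
spins are replaced by spins whose block averages are close to `s m`, which releases the excess of
`M`.

The replacement creates an interaction across the cut. Next to the cut the coarse averages are close
to a well, so this interaction is at most a constant times the excess of the adjacent layer. Of the
roughly `γ^(-α)` possible layers at least one has excess so small that the cut costs at most half of
the gain (`exists_layer`): otherwise the excess would grow geometrically from layer to layer,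
against an a priori bound that is polynomial in `1/γ`. Summing over the depth gives a factor that is
absorbed in the exponential (`weightNum_le`). -/

/-! ### The mean field free energy -/

/-- The functional dual to `freeEnergyF`; both have the same minimizers. -/
noncomputable def dualEnergy (ε x y : ℝ) : ℝ := (x ^ 2 + y ^ 2) / 2 - pressure ε (x, y)

/-- In the coordinates `x + y` and `x - y` the two directions interact only through the sum inside
the logarithm, so that the antisymmetric one can be split off. -/
theorem pressure_eq (ε x y : ℝ) : pressure ε (x, y) =
    Real.log (2 * Real.exp ε * Real.cosh (x + y) + 2 * Real.exp (-ε) * Real.cosh (x - y)) := by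
  unfold pressure
  congr 1
  simp only [UnitsInt.univ, Finset.sum_pair (show (1 : ℤˣ) ≠ -1 by decide)]
  rw [Real.cosh_eq, Real.cosh_eq]
  have e : ∀ a b c : ℝ, Real.exp (a + b + c) = Real.exp c * Real.exp (a + b) := fun a b c => by
    rw [← Real.exp_add]; ring_nf
  simp only [Units.val_one, Int.cast_one, Units.val_neg, Int.cast_neg, mul_one, mul_neg, e]
  rw [show x + -y = x - y by ring, show -x + y = -(x - y) by ring, show -x + -y = -(x + y) by ring,
    show - -ε = ε by ring]
  ring

theorem half_sq_le_cosh_sub_one (b : ℝ) : b ^ 2 / 2 ≤ Real.cosh b - 1 := by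
  have h : ∀ x : ℝ, 0 ≤ x → x ^ 2 / 2 ≤ Real.cosh x - 1 := by
    intro x hx
    have h1 : Real.cosh x = 2 * Real.sinh (x / 2) ^ 2 + 1 := by
      have := Real.cosh_two_mul (x / 2)
      rw [show 2 * (x / 2) = x by ring] at this
      rw [this, Real.cosh_sq]; ring
    have h2 : x / 2 ≤ Real.sinh (x / 2) := Real.self_le_sinh_iff.2 (by linarith)
    nlinarith
  have := h |b| (abs_nonneg b)
  rwa [sq_abs, Real.cosh_abs] at this

/-- Splitting off the antisymmetric direction. -/
theorem log_cosh_antisymm {q A b : ℝ} (hq : 0 < q) (hq1 : q < 1) (hA : 1 ≤ A) (hb : |b| ≤ 2) :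
    Real.log (A + q * Real.cosh b) ≤
      Real.log (A + q) + b ^ 2 / 4 - (1 - q) / (40 * (1 + q)) * b ^ 2 := by
  -- The increment of the logarithm decreases in `A`, so `A = 1` is the worst case. There `q = 1`
  -- would give `log (cosh (b / 2) ^ 2) ≤ b ^ 2 / 4`, and `q < 1` leaves a strictly negative
  -- quadratic term.
  have hc := half_sq_le_cosh_sub_one b
  set c := Real.cosh b - 1 with hcdef
  have hb2 : b ^ 2 ≤ 4 := by nlinarith [abs_le.1 hb]
  have hc0 : 0 ≤ c := le_trans (by positivity) hc
  have hcm : c ≤ 8 := by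
    have h1 := Real.cosh_le_exp_half_sq b
    have h2 : Real.exp (b ^ 2 / 2) ≤ Real.exp 2 := Real.exp_le_exp.2 (by linarith)
    have h3 : Real.exp 2 = Real.exp 1 * Real.exp 1 := by rw [← Real.exp_add]; norm_num
    have h4 := Real.exp_one_lt_d9
    have h5 := Real.exp_pos 1
    nlinarith
  have hAq : 0 < A + q := by linarith
  have e1 : A + q * Real.cosh b = (A + q) * (1 + q * c / (A + q)) := by
    field_simp; rw [hcdef]; ring
  have hpos : 0 < 1 + q * c / (A + q) := by positivity
  rw [e1, Real.log_mul hAq.ne' hpos.ne']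
  have h1 : Real.log (1 + q * c / (A + q)) ≤ Real.log (1 + q * c / (1 + q)) :=
    Real.log_le_log hpos (by gcongr)
  have hp2 : 0 < 1 + q * c / (1 + q) := by positivity
  have h2 : Real.log (1 + c / 2) ≤ b ^ 2 / 4 := by
    have : 1 + c / 2 = Real.cosh (b / 2) ^ 2 := by
      have := Real.cosh_two_mul (b / 2)
      rw [show 2 * (b / 2) = b by ring] at this
      have h' := Real.cosh_sq (b / 2)
      rw [hcdef, this]; linarith
    rw [this, Real.log_pow]
    have := Real.log_le_log (Real.cosh_pos _) (Real.cosh_le_exp_half_sq (b / 2))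
    rw [Real.log_exp] at this
    push_cast
    nlinarith
  have h3 : Real.log (1 + q * c / (1 + q)) - Real.log (1 + c / 2) ≤
      -((1 - q) / (40 * (1 + q)) * b ^ 2) := by
    rw [← Real.log_div hp2.ne' (by positivity)]
    refine (Real.log_le_sub_one_of_pos (by positivity)).trans ?_
    have e : (1 + q * c / (1 + q)) / (1 + c / 2) - 1 = -((1 - q) * c / ((1 + q) * (2 + c))) := by
      field_simp; ring
    rw [e, neg_le_neg_iff, div_mul_eq_mul_div, div_le_div_iff₀ (by positivity) (by positivity)]
    -- Already `20` would do, since `b ^ 2 ≤ 2 * c` and `c ≤ 8`.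
    have h4 : b ^ 2 * (2 + c) ≤ 40 * c := by nlinarith
    have h5 : 0 ≤ (1 - q) * (1 + q) := by nlinarith
    nlinarith
  linarith

/-- Half the derivative of the free energy along the diagonal. -/
noncomputable def diagSlope (q a : ℝ) : ℝ := a / 2 - Real.sinh a / (Real.cosh a + q)

/-- The free energy along the diagonal. -/
noncomputable def diagEnergy (q a : ℝ) : ℝ := a ^ 2 / 4 - Real.log (Real.cosh a + q)

section diag

variable {q : ℝ}

theorem cosh_add_pos (hq : 0 < q) (a : ℝ) : 0 < Real.cosh a + q :=
  add_pos (Real.cosh_pos a) hq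

theorem hasDerivAt_diagEnergy (hq : 0 < q) (a : ℝ) :
    HasDerivAt (diagEnergy q) (diagSlope q a) a := by
  have h1 : HasDerivAt (fun a : ℝ => a ^ 2 / 4) (a / 2) a := by
    have := ((hasDerivAt_id a).pow 2).div_const 4
    refine this.congr_deriv ?_
    simp; ring
  exact h1.sub (((Real.hasDerivAt_cosh a).add_const q).log (cosh_add_pos hq a).ne')

theorem hasDerivAt_diagSlope (hq : 0 < q) (a : ℝ) :
    HasDerivAt (diagSlope q) (1 / 2 - (1 + q * Real.cosh a) / (Real.cosh a + q) ^ 2) a := by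
  have h1 : HasDerivAt (fun a : ℝ => a / 2) (1 / 2) a := (hasDerivAt_id a).div_const 2
  have h2 := (Real.hasDerivAt_sinh a).div ((Real.hasDerivAt_cosh a).add_const q)
    (cosh_add_pos hq a).ne'
  refine (h1.sub h2).congr_deriv ?_
  have := Real.cosh_sq a
  congr 2
  nlinarith

/-- The derivative is a function of `cosh a` alone, and an increasing one because `q ^ 3 ≤ q`.
Convexity of the slope, which vanishes at `0`, forces its sign to change only once on the positive
half-line. -/
theorem convexOn_diagSlope (hq : 0 < q) (hq1 : q < 1) :
    ConvexOn ℝ (Set.Ici 0) (diagSlope q) := by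
  refine MonotoneOn.convexOn_of_deriv (convex_Ici 0)
    (fun a _ => (hasDerivAt_diagSlope hq a).continuousAt.continuousWithinAt)
    (fun a _ => (hasDerivAt_diagSlope hq a).differentiableAt.differentiableWithinAt) ?_
  intro a ha b hb hab
  rw [(hasDerivAt_diagSlope hq a).deriv, (hasDerivAt_diagSlope hq b).deriv]
  rw [interior_Ici] at ha hb
  have hc : Real.cosh a ≤ Real.cosh b := Real.cosh_le_cosh.2 (by
    rw [abs_of_pos ha, abs_of_pos hb]; exact hab)
  have h1 := Real.one_le_cosh a
  have hpa := cosh_add_pos hq a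
  have hpb := cosh_add_pos hq b
  have : (1 + q * Real.cosh b) / (Real.cosh b + q) ^ 2 ≤
      (1 + q * Real.cosh a) / (Real.cosh a + q) ^ 2 := by
    rw [div_le_div_iff₀ (by positivity) (by positivity)]
    set x := Real.cosh a
    set y := Real.cosh b
    have e : (1 + q * x) * (y + q) ^ 2 - (1 + q * y) * (x + q) ^ 2 =
        (y - x) * ((x + y) + q * (x * y) + 2 * q - q ^ 3) := by ring
    have h3 : 0 ≤ (x + y) + q * (x * y) + 2 * q - q ^ 3 := by
      have : q ^ 3 ≤ q := by nlinarith [mul_pos hq hq]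
      have : 0 ≤ q * (x * y) := by positivity
      nlinarith
    nlinarith [mul_nonneg (sub_nonneg.2 hc) h3]
  linarith

/-- The free energy along the diagonal has a unique non-degenerate positive minimizer. -/
theorem exists_diag_minimizer (hq : 0 < q) (hq1 : q < 1) :
    ∃ a₀ : ℝ, 0 < a₀ ∧ a₀ < 2 ∧ diagSlope q a₀ = 0 ∧ ∃ κ : ℝ, 0 < κ ∧
      ∀ a, 0 ≤ a → κ * (a - a₀) ^ 2 ≤ diagEnergy q a - diagEnergy q a₀ := by
  have hconv := convexOn_diagSlope hq hq1
  have hcont : Continuous (diagSlope q) :=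
    continuous_iff_continuousAt.2 fun a => (hasDerivAt_diagSlope hq a).continuousAt
  have h0 : diagSlope q 0 = 0 := by simp [diagSlope]
  obtain ⟨a₁, ha₁, hk₁⟩ : ∃ a₁, 0 < a₁ ∧ diagSlope q a₁ < 0 := by
    have hl : 0 < Real.log (2 - q) := Real.log_pos (by linarith)
    -- Since `a ≤ sinh a`, the slope is negative as soon as `cosh a + q < 2`; the bound `cosh a ≤
    -- exp (a ^ 2 / 2)` suggests this point.
    refine ⟨Real.sqrt (Real.log (2 - q)), Real.sqrt_pos.2 hl, ?_⟩
    set x := Real.sqrt (Real.log (2 - q)) with hx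
    have hx0 : 0 < x := Real.sqrt_pos.2 hl
    have hcx : Real.cosh x < 2 - q := by
      refine (Real.cosh_le_exp_half_sq x).trans_lt ?_
      rw [hx, Real.sq_sqrt hl.le]
      calc Real.exp (Real.log (2 - q) / 2) < Real.exp (Real.log (2 - q)) :=
            Real.exp_lt_exp.2 (by linarith)
        _ = 2 - q := Real.exp_log (by linarith)
    have hs : x ≤ Real.sinh x := Real.self_le_sinh_iff.2 hx0.le
    have hp := cosh_add_pos hq x
    unfold diagSlope
    rw [sub_neg, div_lt_div_iff₀ two_pos hp]
    nlinarith
  have hbig : ∀ a, 2 ≤ a → 0 < diagSlope q a := by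
    intro a ha
    have : Real.sinh a / (Real.cosh a + q) < 1 := by
      rw [div_lt_one (cosh_add_pos hq a)]
      linarith [Real.sinh_lt_cosh a]
    unfold diagSlope
    linarith
  have ha₁2 : a₁ < 2 := by
    by_contra h
    linarith [hbig a₁ (not_lt.1 h)]
  obtain ⟨a₀, ⟨ha₀1, ha₀2⟩, hz⟩ := intermediate_value_Icc ha₁2.le hcont.continuousOn
    (show (0 : ℝ) ∈ Set.Icc (diagSlope q a₁) (diagSlope q 2) from ⟨hk₁.le, (hbig 2 le_rfl).le⟩)
  have hlt1 : a₁ < a₀ := lt_of_le_of_ne ha₀1 (by rintro rfl; linarith)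
  have hlt2 : a₀ < 2 := lt_of_le_of_ne ha₀2 (by rintro rfl; linarith [hbig 2 le_rfl])
  have ha₀ : 0 < a₀ := ha₁.trans hlt1
  -- The slope of the chord of `diagSlope` from `a₁` to its zero `a₀`. By convexity the graph lies
  -- below the chord on `[a₁, a₀]` and above its prolongation beyond `a₀`; integration gives
  -- quadratic growth on `[a₁, ∞)`.
  set κ := -diagSlope q a₁ / (a₀ - a₁) with hκ
  have hd : 0 < a₀ - a₁ := sub_pos.2 hlt1
  have hκ0 : 0 < κ := div_pos (by linarith) hd
  have hκe : κ * (a₀ - a₁) = -diagSlope q a₁ := by rw [hκ]; field_simp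
  have hA : ∀ a, 0 ≤ a → a ≤ a₀ → diagSlope q a ≤ 0 := by
    intro a h1 h2
    rcases eq_or_lt_of_le h1 with rfl | h1
    · exact h0.le
    rcases eq_or_lt_of_le h2 with rfl | h2
    · exact hz.le
    have := hconv.secant_mono_aux1 (Set.mem_Ici.2 le_rfl) (Set.mem_Ici.2 ha₀.le) h1 h2
    rw [h0, hz] at this
    nlinarith
  have hB : ∀ a, a₁ ≤ a → a ≤ a₀ → diagSlope q a ≤ κ * (a - a₀) := by
    intro a h1 h2
    rcases eq_or_lt_of_le h1 with rfl | h1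
    · linarith
    rcases eq_or_lt_of_le h2 with rfl | h2
    · simp [hz]
    have := hconv.secant_mono_aux1 (Set.mem_Ici.2 ha₁.le) (Set.mem_Ici.2 ha₀.le) h1 h2
    rw [hz] at this
    have h3 : (a₀ - a₁) * diagSlope q a ≤ (a₀ - a₁) * (κ * (a - a₀)) := by nlinarith
    exact le_of_mul_le_mul_left h3 hd
  have hC : ∀ a, a₀ ≤ a → κ * (a - a₀) ≤ diagSlope q a := by
    intro a h1
    rcases eq_or_lt_of_le h1 with rfl | h1
    · simp [hz]
    have := hconv.secant_mono_aux1 (Set.mem_Ici.2 ha₁.le)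
      (Set.mem_Ici.2 (ha₀.trans h1).le) hlt1 h1
    rw [hz] at this
    have h3 : (a₀ - a₁) * (κ * (a - a₀)) ≤ (a₀ - a₁) * diagSlope q a := by nlinarith
    exact le_of_mul_le_mul_left h3 hd
  have hder : ∀ a, HasDerivAt (fun a => diagEnergy q a - κ / 2 * (a - a₀) ^ 2)
      (diagSlope q a - κ * (a - a₀)) a := by
    intro a
    have h1 : HasDerivAt (fun a : ℝ => κ / 2 * (a - a₀) ^ 2) (κ * (a - a₀)) a := by
      have := (((hasDerivAt_id a).sub_const a₀).pow 2).const_mul (κ / 2)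
      refine this.congr_deriv ?_
      simp; ring
    exact (hasDerivAt_diagEnergy hq a).sub h1
  have hquad : ∀ a, a₁ ≤ a → κ / 2 * (a - a₀) ^ 2 ≤ diagEnergy q a - diagEnergy q a₀ := by
    intro a ha
    rcases le_total a a₀ with h | h
    · have hanti : AntitoneOn (fun a => diagEnergy q a - κ / 2 * (a - a₀) ^ 2) (Set.Icc a₁ a₀) := by
        refine antitoneOn_of_deriv_nonpos (convex_Icc _ _)
          (fun x _ => (hder x).continuousAt.continuousWithinAt)
          (fun x _ => (hder x).differentiableAt.differentiableWithinAt) fun x hx => ?_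
        rw [interior_Icc] at hx
        rw [(hder x).deriv]
        linarith [hB x hx.1.le hx.2.le]
      have := hanti ⟨ha, h⟩ ⟨hlt1.le, le_rfl⟩ h
      simp only [sub_self] at this
      norm_num at this
      linarith
    · have hmono : MonotoneOn (fun a => diagEnergy q a - κ / 2 * (a - a₀) ^ 2) (Set.Ici a₀) := by
        refine monotoneOn_of_deriv_nonneg (convex_Ici _)
          (fun x _ => (hder x).continuousAt.continuousWithinAt)
          (fun x _ => (hder x).differentiableAt.differentiableWithinAt) fun x hx => ?_
        rw [interior_Ici] at hx
        rw [(hder x).deriv]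
        linarith [hC x (le_of_lt hx)]
      have := hmono (Set.mem_Ici.2 le_rfl) (Set.mem_Ici.2 h) h
      simp only [sub_self] at this
      norm_num at this
      linarith
  have hanti0 : AntitoneOn (diagEnergy q) (Set.Icc 0 a₀) := by
    refine antitoneOn_of_deriv_nonpos (convex_Icc _ _)
      (fun x _ => (hasDerivAt_diagEnergy hq x).continuousAt.continuousWithinAt)
      (fun x _ => (hasDerivAt_diagEnergy hq x).differentiableAt.differentiableWithinAt)
      fun x hx => ?_
    rw [interior_Icc] at hx
    rw [(hasDerivAt_diagEnergy hq x).deriv]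
    exact hA x hx.1.le hx.2.le
  have hratio : (a₀ - a₁) / a₀ ≤ 1 := by rw [div_le_one ha₀]; linarith
  have hratio0 : 0 < (a₀ - a₁) / a₀ := div_pos hd ha₀
  -- On `[0, a₁]` the energy is at least its value at `a₁`, while `|a - a₀| ≤ a₀`; the last factor
  -- of the constant compares the two distances.
  refine ⟨a₀, ha₀, hlt2, hz, κ / 2 * ((a₀ - a₁) / a₀) ^ 2, by positivity, fun a ha => ?_⟩
  rcases le_total a₁ a with h | h
  · refine le_trans ?_ (hquad a h)
    have : ((a₀ - a₁) / a₀) ^ 2 ≤ 1 := by nlinarith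
    have h2 : 0 ≤ κ / 2 * (a - a₀) ^ 2 := by positivity
    nlinarith
  · have h1 := hquad a₁ le_rfl
    have h2 := hanti0 ⟨ha, h.trans hlt1.le⟩ ⟨ha₁.le, hlt1.le⟩ h
    have h3 : (a - a₀) ^ 2 ≤ a₀ ^ 2 := by nlinarith
    have h4 : ((a₀ - a₁) / a₀) ^ 2 * (a - a₀) ^ 2 ≤ (a₁ - a₀) ^ 2 := by
      calc ((a₀ - a₁) / a₀) ^ 2 * (a - a₀) ^ 2 ≤ ((a₀ - a₁) / a₀) ^ 2 * a₀ ^ 2 := by gcongr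
        _ = (a₁ - a₀) ^ 2 := by field_simp; ring
    nlinarith

end diag

/-- The squared distance from `±(m, m)`. -/
noncomputable def wellDist (m x y : ℝ) : ℝ :=
  min ((x - m) ^ 2 + (y - m) ^ 2) ((x + m) ^ 2 + (y + m) ^ 2)

/-- With `q = exp (-2 ε)`, growth across the diagonal comes from `log_cosh_antisymm` and growth
along it from `exists_diag_minimizer` at `|x + y|`, by evenness. The minimizer satisfies `x + y = 2
m = a₀`. -/
theorem exists_dualEnergy_minimizer {ε : ℝ} (hε : 0 < ε) :
    ∃ m : ℝ, 0 < m ∧ m < 1 ∧ diagSlope (Real.exp (-2 * ε)) (2 * m) = 0 ∧ ∃ κ : ℝ, 0 < κ ∧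
      ∀ x y : ℝ, |x| ≤ 1 → |y| ≤ 1 →
        κ * wellDist m x y ≤ dualEnergy ε x y - dualEnergy ε m m := by
  set q := Real.exp (-2 * ε) with hqdef
  have hq : 0 < q := Real.exp_pos _
  have hq1 : q < 1 := by rw [hqdef, Real.exp_lt_one_iff]; linarith
  obtain ⟨a₀, ha₀, ha₂, hz, κ, hκ, hmin⟩ := exists_diag_minimizer hq hq1
  have hG : ∀ x y, dualEnergy ε x y = (x + y) ^ 2 / 4 + (x - y) ^ 2 / 4
      - (Real.log (2 * Real.exp ε) + Real.log (Real.cosh (x + y) + q * Real.cosh (x - y))) := by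
    intro x y
    have e : 2 * Real.exp ε * Real.cosh (x + y) + 2 * Real.exp (-ε) * Real.cosh (x - y) =
        2 * Real.exp ε * (Real.cosh (x + y) + q * Real.cosh (x - y)) := by
      have : Real.exp (-ε) = Real.exp ε * q := by rw [hqdef, ← Real.exp_add]; ring_nf
      rw [this]; ring
    have hp : 0 < Real.cosh (x + y) + q * Real.cosh (x - y) := by
      have := Real.cosh_pos (x + y); have := Real.cosh_pos (x - y); positivity
    rw [dualEnergy, pressure_eq, e, Real.log_mul (by positivity) hp.ne']
    ring
  set κ₁ := (1 - q) / (40 * (1 + q)) with hκ₁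
  have hκ₁0 : 0 < κ₁ := div_pos (by linarith) (by linarith)
  refine ⟨a₀ / 2, by linarith, by linarith, by rw [show 2 * (a₀ / 2) = a₀ by ring]; exact hz,
    min κ κ₁, lt_min hκ hκ₁0, fun x y hx hy => ?_⟩
  have hx' := abs_le.1 hx
  have hy' := abs_le.1 hy
  have h1 := log_cosh_antisymm hq hq1 (Real.one_le_cosh (x + y)) (b := x - y)
    (abs_le.2 ⟨by linarith, by linarith⟩)
  have h2 := hmin |x + y| (abs_nonneg _)
  have e2 : diagEnergy q |x + y| = diagEnergy q (x + y) := by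
    simp [diagEnergy, sq_abs, Real.cosh_abs]
  rw [e2] at h2
  have h3 : wellDist (a₀ / 2) x y ≤ (|x + y| - a₀) ^ 2 + (x - y) ^ 2 := by
    unfold wellDist
    rcases le_total 0 (x + y) with h | h
    · rw [abs_of_nonneg h]
      refine (min_le_left _ _).trans ?_
      nlinarith [sq_nonneg (x + y - a₀), sq_nonneg (x - y)]
    · rw [abs_of_nonpos h]
      refine (min_le_right _ _).trans ?_
      nlinarith [sq_nonneg (x + y + a₀), sq_nonneg (x - y)]
  have hmw : min κ κ₁ * wellDist (a₀ / 2) x y ≤ κ * (|x + y| - a₀) ^ 2 + κ₁ * (x - y) ^ 2 := by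
    have hm0 : 0 < min κ κ₁ := lt_min hκ hκ₁0
    calc min κ κ₁ * wellDist (a₀ / 2) x y
        ≤ min κ κ₁ * ((|x + y| - a₀) ^ 2 + (x - y) ^ 2) := by gcongr
      _ = min κ κ₁ * (|x + y| - a₀) ^ 2 + min κ κ₁ * (x - y) ^ 2 := by ring
      _ ≤ _ := by
        gcongr
        · exact min_le_left _ _
        · exact min_le_right _ _
  rw [hG, hG]
  simp only [diagEnergy] at h2
  rw [show a₀ / 2 + a₀ / 2 = a₀ by ring, sub_self, Real.cosh_zero, mul_one]
  linarith

/-- The Gibbs weight of a coupled pair of spins in the field `(x, y)`. -/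
noncomputable def pairWeight (ε x y : ℝ) (s t : ℤˣ) : ℝ :=
  Real.exp (x * ((s : ℤ) : ℝ) + y * ((t : ℤ) : ℝ) + ε * ((s : ℤ) : ℝ) * ((t : ℤ) : ℝ)
    - pressure ε (x, y))

theorem pairWeight_pos (ε x y : ℝ) (s t : ℤˣ) : 0 < pairWeight ε x y s t := Real.exp_pos _

theorem sum_pairWeight (ε x y : ℝ) : ∑ s : ℤˣ, ∑ t : ℤˣ, pairWeight ε x y s t = 1 := by
  simp only [pairWeight, Real.exp_sub, ← Finset.sum_div]
  have hpos : 0 < ∑ s : ℤˣ, ∑ t : ℤˣ, Real.exp (x * ((s : ℤ) : ℝ) + y * ((t : ℤ) : ℝ)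
      + ε * ((s : ℤ) : ℝ) * ((t : ℤ) : ℝ)) := by positivity
  rw [pressure, Real.exp_log hpos, div_self hpos.ne']

theorem pairWeight_swap (ε m : ℝ) (s t : ℤˣ) : pairWeight ε m m s t = pairWeight ε m m t s := by
  unfold pairWeight; congr 1; ring

/-- In the field `(m, m)` the mean of a spin is `sinh (2 m) / (cosh (2 m) + exp (-2 ε))`, so the
vanishing of the slope is the mean field equation. -/
theorem sum_pairWeight_fst {ε m : ℝ} (hz : diagSlope (Real.exp (-2 * ε)) (2 * m) = 0) :
    ∑ s : ℤˣ, ∑ t : ℤˣ, pairWeight ε m m s t * ((s : ℤ) : ℝ) = m := by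
  have hp : 0 < 2 * Real.exp ε * Real.cosh (m + m) + 2 * Real.exp (-ε) * Real.cosh (m - m) := by
    have := Real.cosh_pos (m + m); have := Real.cosh_pos (m - m); positivity
  have hp' := hp
  rw [sub_self, Real.cosh_zero, mul_one] at hp'
  have hz0 : Real.exp (pressure ε (m, m)) =
      2 * Real.exp ε * Real.cosh (m + m) + 2 * Real.exp (-ε) := by
    rw [pressure_eq, sub_self, Real.cosh_zero, mul_one, Real.exp_log hp']
  simp only [pairWeight, Real.exp_sub, hz0, UnitsInt.univ,
    Finset.sum_pair (show (1 : ℤˣ) ≠ -1 by decide), Units.val_one, Units.val_neg, Int.cast_neg,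
    Int.cast_one]
  have e : ∀ a b c : ℝ, Real.exp (a + b + c) = Real.exp c * Real.exp (a + b) := fun a b c => by
    rw [← Real.exp_add]; ring_nf
  have hs := Real.sinh_eq (2 * m)
  have hc : 0 < Real.cosh (2 * m) + Real.exp (-2 * ε) := add_pos (Real.cosh_pos _) (Real.exp_pos _)
  have hz' : Real.sinh (2 * m) = m * (Real.cosh (2 * m) + Real.exp (-2 * ε)) := by
    unfold diagSlope at hz
    have h1 := (sub_eq_zero.1 hz).symm
    rw [div_eq_iff hc.ne'] at h1
    linarith
  have hq : Real.exp (-ε) = Real.exp ε * Real.exp (-2 * ε) := by rw [← Real.exp_add]; ring_nf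
  simp only [mul_one, e, mul_neg, neg_neg, add_neg_cancel, neg_add_cancel]
  rw [show m + m = 2 * m by ring] at *
  rw [show -m + -m = -(2 * m) by ring]
  field_simp
  rw [hq]
  have h2 : Real.exp (2 * m) - Real.exp (-(2 * m)) = 2 * (m * (Real.cosh (2 * m) +
      Real.exp (-2 * ε))) := by rw [← hz', hs]; ring
  linear_combination Real.exp ε * h2

/-- Only the term in which both spins follow the signs of the fields is kept. -/
theorem pressure_ge (ε : ℝ) (x y : ℝ) : |x| + |y| - |ε| ≤ pressure ε (x, y) := by
  have hsgn : ∀ z : ℝ, ∃ s : ℤˣ, z * ((s : ℤ) : ℝ) = |z| := fun z => by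
    rcases le_total 0 z with h | h
    · exact ⟨1, by simp [abs_of_nonneg h]⟩
    · exact ⟨-1, by simp [abs_of_nonpos h]⟩
  obtain ⟨s, hs⟩ := hsgn x
  obtain ⟨t, ht⟩ := hsgn y
  unfold pressure
  rw [Real.le_log_iff_exp_le (by positivity)]
  have habs : ∀ u : ℤˣ, |((u : ℤ) : ℝ)| = 1 := fun u => by
    rcases Int.units_eq_one_or u with rfl | rfl <;> simp
  have hle : -|ε| ≤ ε * ((s : ℤ) : ℝ) * ((t : ℤ) : ℝ) := by
    have : |ε * ((s : ℤ) : ℝ) * ((t : ℤ) : ℝ)| = |ε| := by simp [abs_mul, habs]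
    rw [← this]
    exact neg_abs_le _
  calc Real.exp (|x| + |y| - |ε|)
      ≤ Real.exp (x * ((s : ℤ) : ℝ) + y * ((t : ℤ) : ℝ) + ε * ((s : ℤ) : ℝ) * ((t : ℤ) : ℝ)) :=
        Real.exp_le_exp.2 (by rw [hs, ht]; linarith)
    _ ≤ ∑ t : ℤˣ, Real.exp (x * ((s : ℤ) : ℝ) + y * ((t : ℤ) : ℝ)
          + ε * ((s : ℤ) : ℝ) * ((t : ℤ) : ℝ)) :=
        Finset.single_le_sum (f := fun t : ℤˣ => Real.exp (x * ((s : ℤ) : ℝ) + y * ((t : ℤ) : ℝ)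
          + ε * ((s : ℤ) : ℝ) * ((t : ℤ) : ℝ))) (fun _ _ => (Real.exp_pos _).le)
          (Finset.mem_univ t)
    _ ≤ _ := Finset.single_le_sum (f := fun s : ℤˣ => ∑ t : ℤˣ, Real.exp (x * ((s : ℤ) : ℝ)
          + y * ((t : ℤ) : ℝ) + ε * ((s : ℤ) : ℝ) * ((t : ℤ) : ℝ)))
          (fun _ _ => by positivity) (Finset.mem_univ s)

theorem bddAbove_legendre (ε : ℝ) {x y : ℝ} (hx : |x| ≤ 1) (hy : |y| ≤ 1) :
    BddAbove (Set.range fun h : ℝ × ℝ => h.1 * x + h.2 * y - pressure ε h) := by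
  refine ⟨|ε|, ?_⟩
  rintro _ ⟨⟨u, v⟩, rfl⟩
  have h1 := pressure_ge ε u v
  have h2 : u * x ≤ |u| := by
    calc u * x ≤ |u * x| := le_abs_self _
      _ = |u| * |x| := abs_mul _ _
      _ ≤ |u| := by nlinarith [abs_nonneg u]
  have h3 : v * y ≤ |v| := by
    calc v * y ≤ |v * y| := le_abs_self _
      _ = |v| * |y| := abs_mul _ _
      _ ≤ |v| := by nlinarith [abs_nonneg v]
  dsimp only
  linarith

/-- The field equal to the magnetization is a trial field in the Legendre transform. At a solution
of the mean field equation it is optimal (`freeEnergyF_eq_dualEnergy`), which is how minimality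
passes from one functional to the other. -/
theorem dualEnergy_le_freeEnergyF (ε : ℝ) {x y : ℝ} (hx : |x| ≤ 1) (hy : |y| ≤ 1) :
    dualEnergy ε x y ≤ freeEnergyF ε (x, y) := by
  have := le_ciSup (bddAbove_legendre ε hx hy) (x, y)
  unfold dualEnergy freeEnergyF freeEnergyPhi
  dsimp only at this ⊢
  linarith

/-- The tangent inequality for the pressure at a self-consistent field. -/
theorem pressure_tangent {ε m : ℝ} (hz : diagSlope (Real.exp (-2 * ε)) (2 * m) = 0) (x y : ℝ) :
    pressure ε (m, m) + (x - m) * m + (y - m) * m ≤ pressure ε (x, y) := by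
  have h1 := sum_pairWeight_fst hz
  have h2 : ∑ s : ℤˣ, ∑ t : ℤˣ, pairWeight ε m m s t * ((t : ℤ) : ℝ) = m := by
    rw [Finset.sum_comm, ← h1]
    simp only [h1]
    conv_rhs => rw [← h1]
    exact Finset.sum_congr rfl fun s _ => Finset.sum_congr rfl fun t _ => by
      rw [pairWeight_swap]
  have h0 := sum_pairWeight ε m m
  set c := (x - m) * m + (y - m) * m with hc
  -- Jensen's inequality in the form `1 + z ≤ exp z`, under the pair measure, whose means are both
  -- `m`.
  have key : (1 : ℝ) ≤ ∑ s : ℤˣ, ∑ t : ℤˣ, pairWeight ε m m s t *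
      Real.exp ((x - m) * ((s : ℤ) : ℝ) + (y - m) * ((t : ℤ) : ℝ) - c) := by
    calc (1 : ℝ) = (1 - c) * (∑ s : ℤˣ, ∑ t : ℤˣ, pairWeight ε m m s t)
          + (x - m) * (∑ s : ℤˣ, ∑ t : ℤˣ, pairWeight ε m m s t * ((s : ℤ) : ℝ))
          + (y - m) * (∑ s : ℤˣ, ∑ t : ℤˣ, pairWeight ε m m s t * ((t : ℤ) : ℝ)) := by
          rw [h0, h1, h2, hc]; ring
      _ = ∑ s : ℤˣ, ∑ t : ℤˣ, pairWeight ε m m s t *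
          ((x - m) * ((s : ℤ) : ℝ) + (y - m) * ((t : ℤ) : ℝ) - c + 1) := by
          simp only [Finset.mul_sum, ← Finset.sum_add_distrib]
          exact Finset.sum_congr rfl fun s _ => Finset.sum_congr rfl fun t _ => by ring
      _ ≤ _ := by
          refine Finset.sum_le_sum fun s _ => Finset.sum_le_sum fun t _ => ?_
          exact mul_le_mul_of_nonneg_left (Real.add_one_le_exp _) (pairWeight_pos _ _ _ _ _).le
  have e : ∑ s : ℤˣ, ∑ t : ℤˣ, pairWeight ε m m s t *
      Real.exp ((x - m) * ((s : ℤ) : ℝ) + (y - m) * ((t : ℤ) : ℝ) - c) =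
      Real.exp (-c - pressure ε (m, m) + pressure ε (x, y)) := by
    have hpos : 0 < ∑ s : ℤˣ, ∑ t : ℤˣ, Real.exp (x * ((s : ℤ) : ℝ) + y * ((t : ℤ) : ℝ)
      + ε * ((s : ℤ) : ℝ) * ((t : ℤ) : ℝ)) := by positivity
    rw [Real.exp_add, show Real.exp (pressure ε (x, y)) = _ from Real.exp_log hpos, Finset.mul_sum]
    refine Finset.sum_congr rfl fun s _ => ?_
    rw [Finset.mul_sum]
    refine Finset.sum_congr rfl fun t _ => ?_
    rw [pairWeight, ← Real.exp_add, ← Real.exp_add]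
    congr 1
    ring
  rw [e, Real.one_le_exp_iff] at key
  linarith

theorem freeEnergyF_eq_dualEnergy {ε m : ℝ} (hm : |m| ≤ 1)
    (hz : diagSlope (Real.exp (-2 * ε)) (2 * m) = 0) :
    freeEnergyF ε (m, m) = dualEnergy ε m m := by
  refine le_antisymm ?_ (dualEnergy_le_freeEnergyF ε hm hm)
  have : freeEnergyPhi ε (m, m) ≤ m * m + m * m - pressure ε (m, m) := by
    refine ciSup_le fun h => ?_
    have := pressure_tangent hz h.1 h.2
    dsimp only
    change h.1 * m + h.2 * m - pressure ε (h.1, h.2) ≤ _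
    linarith
  unfold freeEnergyF dualEnergy
  dsimp only
  linarith

theorem wellDist_nonneg (m x y : ℝ) : 0 ≤ wellDist m x y := le_min (by positivity) (by positivity)

/-- The spontaneous magnetization: it is positive, solves the mean field equation, and
`±(m, m)` are non-degenerate minimizers. -/
theorem spontMag_spec {ε : ℝ} (hε : 0 < ε) :
    0 < spontMag ε ∧ spontMag ε < 1 ∧
    diagSlope (Real.exp (-2 * ε)) (2 * spontMag ε) = 0 ∧ ∃ κ : ℝ, 0 < κ ∧
      ∀ x y : ℝ, |x| ≤ 1 → |y| ≤ 1 → κ * wellDist (spontMag ε) x y ≤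
        dualEnergy ε x y - dualEnergy ε (spontMag ε) (spontMag ε) := by
  obtain ⟨m, hm0, hm1, hz, κ, hκ, hmin⟩ := exists_dualEnergy_minimizer hε
  have hmabs : |m| ≤ 1 := by rw [abs_of_pos hm0]; exact hm1.le
  -- At a diagonal minimizer `x` of `freeEnergyF`, `dualEnergy` is at most its value at `(m, m)`;
  -- quadratic growth then puts `(x, x)` on a well, and `0 ≤ x` excludes `-m`.
  have hset : {x : ℝ | 0 ≤ x ∧ x ≤ 1 ∧
      IsMinOn (freeEnergyF ε) (Set.Icc (-1) 1 ×ˢ Set.Icc (-1) 1) (x, x)} = {m} := by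
    ext x
    simp only [Set.mem_ofPred_eq, Set.mem_singleton_iff]
    constructor
    · rintro ⟨hx0, hx1, hx⟩
      have hxabs : |x| ≤ 1 := by rw [abs_of_nonneg hx0]; exact hx1
      have h1 : freeEnergyF ε (x, x) ≤ freeEnergyF ε (m, m) :=
        hx (show (m, m) ∈ _ from ⟨⟨by linarith, hm1.le⟩, ⟨by linarith, hm1.le⟩⟩)
      rw [freeEnergyF_eq_dualEnergy hmabs hz] at h1
      have h2 := dualEnergy_le_freeEnergyF ε hxabs hxabs
      have h3 := hmin x x hxabs hxabs
      have h4 : wellDist m x x ≤ 0 := by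
        by_contra hcon
        have := mul_pos hκ (not_le.1 hcon)
        linarith
      unfold wellDist at h4
      rcases min_le_iff.1 h4 with h | h
      · nlinarith [sq_nonneg (x - m)]
      · nlinarith [sq_nonneg (x + m)]
    · intro hxm
      rw [hxm]
      refine ⟨hm0.le, hm1.le, ?_⟩
      rintro ⟨x, y⟩ ⟨hx, hy⟩
      have hx' : |x| ≤ 1 := abs_le.2 hx
      have hy' : |y| ≤ 1 := abs_le.2 hy
      have h1 := dualEnergy_le_freeEnergyF ε hx' hy'
      have h2 := hmin x y hx' hy'
      have h3 := mul_nonneg hκ.le (wellDist_nonneg m x y)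
      change freeEnergyF ε (_, _) ≤ freeEnergyF ε (x, y)
      rw [freeEnergyF_eq_dualEnergy hmabs hz]
      linarith
  have hs : spontMag ε = m := by
    unfold spontMag
    rw [hset, csSup_singleton]
  rw [hs]
  exact ⟨hm0, hm1, hz, κ, hκ, hmin⟩


/-! ### The Kac kernel -/

namespace KacModel

/-- Uniform estimates for the Kac kernel. -/
structure KernelBounds (K : KacModel) (C c : ℝ) (k₀ : ℕ) : Prop where
  nonneg : ∀ x y : ℤ, 0 ≤ K.kac x y
  symm : ∀ x y : ℤ, K.kac x y = K.kac y x
  upper : ∀ x y : ℤ, K.kac x y ≤ C * K.γ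
  lip : ∀ x y x' y' : ℤ, |K.kac x y - K.kac x' y'| ≤
    C * K.γ ^ 2 * (|(x : ℝ) - x'| + |(y : ℝ) - y'|)
  range : ∀ x y : ℤ, (2 : ℤ) ^ K.scales.n < |x - y| → K.kac x y = 0
  lower : ∀ x y : ℤ, |x - y| * 2 ^ k₀ ≤ (2 : ℤ) ^ K.scales.n → c * K.γ ≤ K.kac x y
  -- The sum runs over `y = x` too, which the normalization leaves out; this is the origin of `K.kac
  -- 0 0` in what follows.
  row_sum : ∀ (x : ℤ) (T : Finset ℤ), Finset.Icc (x - 2 ^ K.scales.n) (x + 2 ^ K.scales.n) ⊆ T →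
    ∑ y ∈ T, K.kac x y = 1 + K.kac 0 0

theorem gamma_pos (K : KacModel) : 0 < K.γ := by
  rw [K.scales.gamma_eq]; positivity

theorem gamma_mul_pow (K : KacModel) : K.γ * 2 ^ K.scales.n = 1 := by
  have h := K.scales.gamma_eq
  generalize K.scales.n = n at h
  rw [h]; field_simp

/-- `J` is bounded and Lipschitz, and `J ≥ J 0 / 2` on `|r| ≤ 2 ^ (-k₀)`. Hence the normalizing sum
lies between two positive constants for all `γ ≤ 2 ^ (-k₀)`; its convergence as `γ → 0` is not
needed. -/
theorem exists_kernelBounds {J : ℝ → ℝ} (hJ : IsKacDensity J) :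
    ∃ C c γ₁ : ℝ, ∃ k₀ : ℕ, 0 < C ∧ 0 < c ∧ 0 < γ₁ ∧
      ∀ K : KacModel, K.J = J → K.γ ≤ γ₁ → K.KernelBounds C c k₀ := by
  have hJ0 := hJ.pos_zero
  have hcs : HasCompactSupport J :=
    HasCompactSupport.of_support_subset_isCompact isCompact_Icc hJ.support_subset
  have hcont : Continuous J := hJ.contDiff.continuous
  obtain ⟨D, hD⟩ := hJ.contDiff.lipschitzWith_of_hasCompactSupport hcs one_ne_zero
  obtain ⟨B, hB⟩ := hcont.bounded_above_of_compact_support hcs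
  have hB' : ∀ r, J r ≤ B := fun r => (le_abs_self _).trans (hB r)
  have hB0 : 0 < B := hJ0.trans_le (hB' 0)
  obtain ⟨δ, hδ, hclose⟩ : ∃ δ > 0, ∀ r : ℝ, |r| < δ → J 0 / 2 ≤ J r := by
    obtain ⟨δ, hδ, h⟩ := Metric.continuousAt_iff.1 (hcont.continuousAt (x := 0)) (J 0 / 2) (by linarith)
    refine ⟨δ, hδ, fun r hr => ?_⟩
    have := h (x := r) (by simpa [Real.dist_eq] using hr)
    rw [Real.dist_eq] at this
    linarith [(abs_lt.1 this).1]
  obtain ⟨k₀, hk₀⟩ := exists_pow_lt_of_lt_one hδ (show (1 / 2 : ℝ) < 1 by norm_num)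
  have hlow : ∀ r : ℝ, |r| ≤ (1 / 2) ^ k₀ → J 0 / 2 ≤ J r := fun r hr =>
    hclose r (hr.trans_lt hk₀)
  have hzero : ∀ r : ℝ, 1 < |r| → J r = 0 := by
    intro r hr
    by_contra hne
    have := hJ.support_subset (Function.mem_support.2 hne)
    have := abs_le.2 this
    linarith
  set A := 2 * 2 ^ k₀ / J 0 with hA
  have hA0 : 0 < A := by positivity
  refine ⟨A * (B + D), 1 / (3 * B) * (J 0 / 2), (1 / 2) ^ k₀, k₀, by positivity, by positivity,
    by positivity, ?_⟩
  rintro K rfl hγ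
  have hγ0 := K.gamma_pos
  set N : ℤ := 2 ^ K.scales.n with hN
  have hNR : (N : ℝ) = 2 ^ K.scales.n := by rw [hN]; push_cast; rfl
  have hγN : K.γ * N = 1 := by rw [hNR]; exact K.gamma_mul_pow
  have hN1 : 1 ≤ N := by rw [hN]; exact_mod_cast Nat.one_le_two_pow
  have hk₀n : k₀ ≤ K.scales.n := by
    rw [K.scales.gamma_eq, one_div, inv_pow] at hγ
    have := (inv_le_inv₀ (by positivity) (by positivity)).1 hγ
    exact (pow_le_pow_iff_right₀ (by norm_num : (1 : ℝ) < 2)).1 this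
  have hout : ∀ z : ℤ, N < |z| → K.J (K.γ * z) = 0 := by
    intro z hz
    refine hzero _ ?_
    rw [abs_mul, abs_of_pos hγ0, ← hγN]
    have : (N : ℝ) < |(z : ℝ)| := by exact_mod_cast hz
    gcongr
  set Z := ∑' z : ℤ, if z = 0 then 0 else K.γ * K.J (K.γ * z) with hZ
  have hZfin : Z = ∑ z ∈ Finset.Icc (-N) N, if z = 0 then 0 else K.γ * K.J (K.γ * z) := by
    rw [hZ]
    refine tsum_eq_sum fun z hz => ?_
    have : N < |z| := by
      by_contra hcon
      exact hz (Finset.mem_Icc.2 (abs_le.1 (not_lt.1 hcon)))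
    rw [hout z this]
    simp
  have hterm : ∀ z : ℤ, 0 ≤ if z = 0 then 0 else K.γ * K.J (K.γ * z) := fun z => by
    split_ifs
    · exact le_rfl
    · exact mul_nonneg hγ0.le (hJ.nonneg _)
  have hZup : Z ≤ 3 * B := by
    rw [hZfin]
    calc _ ≤ ∑ z ∈ Finset.Icc (-N) N, K.γ * B := by
          refine Finset.sum_le_sum fun z _ => ?_
          split_ifs
          · positivity
          · exact mul_le_mul_of_nonneg_left (hB' _) hγ0.le
      _ = (2 * N + 1) * (K.γ * B) := by
          rw [Finset.sum_const, Int.card_Icc, nsmul_eq_mul]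
          congr 1
          have : ((N + 1 - -N).toNat : ℤ) = 2 * N + 1 := by omega
          exact_mod_cast this
      _ ≤ 3 * B := by
          have h1 : (1 : ℝ) ≤ N := by exact_mod_cast hN1
          have h2 : K.γ ≤ 1 := by nlinarith
          nlinarith
  have hlowz : ∀ z : ℤ, |z| * 2 ^ k₀ ≤ N → K.J 0 / 2 ≤ K.J (K.γ * z) := by
    intro z hz
    refine hlow _ ?_
    rw [abs_mul, abs_of_pos hγ0, one_div, inv_pow, ← one_div, le_div_iff₀ (by positivity), ← hγN,
      mul_assoc]
    have : |(z : ℝ)| * 2 ^ k₀ ≤ (N : ℝ) := by exact_mod_cast hz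
    gcongr
  have hZlow : A⁻¹ ≤ Z := by
    set w : ℤ := 2 ^ (K.scales.n - k₀) with hw
    have hwN : w * 2 ^ k₀ = N := by rw [hw, ← pow_add, Nat.sub_add_cancel hk₀n]
    have hw1 : 1 ≤ w := by rw [hw]; exact_mod_cast Nat.one_le_two_pow
    have h2k : (1 : ℤ) ≤ 2 ^ k₀ := by exact_mod_cast Nat.one_le_two_pow
    have hwle : w ≤ N := by nlinarith
    rw [hZfin]
    calc A⁻¹ = (w : ℝ) * (K.γ * (K.J 0 / 2)) := by
          have : (w : ℝ) * 2 ^ k₀ = N := by exact_mod_cast hwN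
          have h3 : K.γ * (w : ℝ) = 1 / 2 ^ k₀ := by
            rw [eq_div_iff (by positivity), mul_assoc, this, hγN]
          rw [hA, inv_div, show (w : ℝ) * (K.γ * (K.J 0 / 2)) = (K.γ * w) * (K.J 0 / 2) by ring, h3]
          field_simp
      _ = ∑ z ∈ Finset.Icc (1 : ℤ) w, K.γ * (K.J 0 / 2) := by
          rw [Finset.sum_const, Int.card_Icc, nsmul_eq_mul]
          congr 1
          have : ((w + 1 - 1).toNat : ℤ) = w := by omega
          exact_mod_cast this.symm
      _ ≤ ∑ z ∈ Finset.Icc (1 : ℤ) w, if z = 0 then 0 else K.γ * K.J (K.γ * z) := by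
          refine Finset.sum_le_sum fun z hz => ?_
          obtain ⟨h1, h2⟩ := Finset.mem_Icc.1 hz
          rw [if_neg (by omega)]
          refine mul_le_mul_of_nonneg_left (hlowz z ?_) hγ0.le
          rw [abs_of_pos (by omega), ← hwN]
          gcongr
      _ ≤ _ := Finset.sum_le_sum_of_subset_of_nonneg (fun z hz => by
          obtain ⟨h1, h2⟩ := Finset.mem_Icc.1 hz
          exact Finset.mem_Icc.2 ⟨by omega, by omega⟩) fun z _ _ => hterm z
  have hZ0 : 0 < Z := (inv_pos.2 hA0).trans_le hZlow
  have hnorm : K.kacNorm = Z⁻¹ := rfl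
  have hnA : K.kacNorm ≤ A := by
    rw [hnorm]; exact inv_le_of_inv_le₀ hA0 hZlow
  have hnB : 1 / (3 * B) ≤ K.kacNorm := by
    rw [hnorm, one_div]; exact inv_anti₀ hZ0 hZup
  have hn0 : 0 < K.kacNorm := by rw [hnorm]; exact inv_pos.2 hZ0
  have hcast : ∀ x y : ℤ, ((x : ℝ) - y) = ((x - y : ℤ) : ℝ) := fun x y => by push_cast; rfl
  have hrange : ∀ x y : ℤ, N < |x - y| → K.kac x y = 0 := fun x y h => by
    rw [kac, hcast, hout _ h, mul_zero]
  refine ⟨fun x y => ?_, fun x y => ?_, fun x y => ?_, fun x y x' y' => ?_, hrange,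
    fun x y h => ?_, fun x T hT => ?_⟩
  · exact mul_nonneg (mul_nonneg hn0.le hγ0.le) (hJ.nonneg _)
  · rw [kac, kac, ← hJ.symm, ← mul_neg, neg_sub]
  · have h1 : K.J (K.γ * ((x : ℝ) - y)) ≤ B + D := (hB' _).trans (by simp)
    calc K.kac x y ≤ K.kacNorm * K.γ * (B + D) := by unfold kac; gcongr
      _ ≤ A * K.γ * (B + D) := by gcongr
      _ = _ := by ring
  · have h1 : |K.J (K.γ * ((x : ℝ) - y)) - K.J (K.γ * ((x' : ℝ) - y'))| ≤
        D * (K.γ * (|(x : ℝ) - x'| + |(y : ℝ) - y'|)) := by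
      have := hD.dist_le_mul (K.γ * ((x : ℝ) - y)) (K.γ * ((x' : ℝ) - y'))
      rw [Real.dist_eq, Real.dist_eq] at this
      refine this.trans ?_
      rw [← mul_sub, abs_mul, abs_of_pos hγ0]
      gcongr
      rw [show (x : ℝ) - y - (x' - y') = (x - x') - (y - y') by ring]
      exact abs_sub _ _
    rw [kac, kac, ← mul_sub, abs_mul, abs_of_pos (mul_pos hn0 hγ0)]
    calc K.kacNorm * K.γ * |K.J (K.γ * ((x : ℝ) - y)) - K.J (K.γ * ((x' : ℝ) - y'))|
        ≤ A * K.γ * (D * (K.γ * (|(x : ℝ) - x'| + |(y : ℝ) - y'|))) := by gcongr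
      _ = A * D * K.γ ^ 2 * (|(x : ℝ) - x'| + |(y : ℝ) - y'|) := by ring
      _ ≤ _ := by gcongr; linarith
  · have := hlowz _ h
    rw [kac, hcast]
    calc 1 / (3 * B) * (K.J 0 / 2) * K.γ = 1 / (3 * B) * K.γ * (K.J 0 / 2) := by ring
      _ ≤ _ := by gcongr
  · have hx : x ∈ T := hT (Finset.mem_Icc.2 ⟨by omega, by omega⟩)
    have hd : K.kac 0 0 = K.kac x x := by simp [kac]
    rw [hd]
    rw [← Finset.sum_erase_add _ _ hx]
    congr 1
    have h1 : ∑ y ∈ T.erase x, K.kac x y =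
        ∑ y ∈ Finset.Icc (x - N) (x + N), if y = x then 0 else K.kac x y := by
      rw [Finset.sum_subset hT]
      · rw [← Finset.sum_erase_add _ _ hx, if_pos rfl, add_zero]
        exact Finset.sum_congr rfl fun y hy => by rw [if_neg (Finset.ne_of_mem_erase hy)]
      · intro y _ hy
        split_ifs
        · rfl
        · refine hrange x y ?_
          by_contra hcon
          have := abs_le.1 (not_lt.1 hcon)
          exact hy (Finset.mem_Icc.2 ⟨by omega, by omega⟩)
    rw [h1]
    have h2 : ∑ y ∈ Finset.Icc (x - N) (x + N), (if y = x then 0 else K.kac x y) =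
        ∑ z ∈ Finset.Icc (-N) N, K.kacNorm * if z = 0 then 0 else K.γ * K.J (K.γ * z) := by
      refine Finset.sum_bij' (fun y _ => x - y) (fun z _ => x - z) ?_ ?_ ?_ ?_ ?_
      · intro y hy
        rw [Finset.mem_Icc] at hy ⊢
        omega
      · intro y hy
        rw [Finset.mem_Icc] at hy ⊢
        omega
      · intro y _; ring
      · intro y _; ring
      · intro y _
        by_cases h : y = x
        · simp [h]
        · rw [if_neg h, if_neg (by omega), kac, hcast]; ring
    rw [h2, ← Finset.mul_sum, ← hZfin, hnorm, inv_mul_cancel₀ hZ0.ne']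

end KacModel


/-! ### Sums over spins in a finite region -/

/-- The sum of `F` over the configurations which agree with `σ` outside `Λ`. -/
noncomputable def spinSum (Λ : Finset Site) (σ : Config) (F : Config → ℝ) : ℝ :=
  ∑ τ : Λ → ℤˣ, F (glue Λ τ σ)

theorem glue_of_mem {Λ : Finset Site} (τ : Λ → ℤˣ) (σ : Config) {p : Site} (h : p ∈ Λ) :
    glue Λ τ σ p = τ ⟨p, h⟩ := dif_pos h

theorem glue_of_notMem {Λ : Finset Site} (τ : Λ → ℤˣ) (σ : Config) {p : Site} (h : p ∉ Λ) :
    glue Λ τ σ p = σ p := dif_neg h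

theorem spinSum_congr {Λ : Finset Site} {σ : Config} {F F' : Config → ℝ}
    (h : ∀ σ', (∀ p ∉ Λ, σ' p = σ p) → F σ' = F' σ') : spinSum Λ σ F = spinSum Λ σ F' :=
  Finset.sum_congr rfl fun τ _ => h _ fun _ hp => glue_of_notMem τ σ hp

theorem spinSum_le {Λ : Finset Site} {σ : Config} {F F' : Config → ℝ}
    (h : ∀ σ', (∀ p ∉ Λ, σ' p = σ p) → F σ' ≤ F' σ') : spinSum Λ σ F ≤ spinSum Λ σ F' :=
  Finset.sum_le_sum fun τ _ => h _ fun _ hp => glue_of_notMem τ σ hp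

theorem spinSum_nonneg {Λ : Finset Site} {σ : Config} {F : Config → ℝ}
    (h : ∀ σ', (∀ p ∉ Λ, σ' p = σ p) → 0 ≤ F σ') : 0 ≤ spinSum Λ σ F :=
  Finset.sum_nonneg fun τ _ => h _ fun _ hp => glue_of_notMem τ σ hp

theorem spinSum_const_mul (Λ : Finset Site) (σ : Config) (F : Config → ℝ) (c : ℝ) :
    spinSum Λ σ (fun σ' => c * F σ') = c * spinSum Λ σ F := by
  simp only [spinSum, Finset.mul_sum]

theorem spinSum_sum {ι : Type*} (s : Finset ι) (Λ : Finset Site) (σ : Config)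
    (F : ι → Config → ℝ) :
    spinSum Λ σ (fun σ' => ∑ i ∈ s, F i σ') = ∑ i ∈ s, spinSum Λ σ (F i) := by
  simp only [spinSum]
  exact Finset.sum_comm

theorem glue_glue {Λ M : Finset Site} (hM : M ⊆ Λ) (τ : Λ → ℤˣ) (σ : Config) :
    glue M (fun p => τ ⟨p.1, hM p.2⟩)
      (glue (Λ \ M) (fun p => τ ⟨p.1, (Finset.mem_sdiff.1 p.2).1⟩) σ) = glue Λ τ σ := by
  funext p
  by_cases h : p ∈ M
  · rw [glue_of_mem _ _ h, glue_of_mem _ _ (hM h)]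
  · rw [glue_of_notMem _ _ h]
    by_cases h' : p ∈ Λ
    · rw [glue_of_mem _ _ (Finset.mem_sdiff.2 ⟨h', h⟩), glue_of_mem _ _ h']
    · rw [glue_of_notMem _ _ h', glue_of_notMem _ _ fun hc => h' (Finset.mem_sdiff.1 hc).1]

/-- Summing first over the spins in `M`, then over those in `Λ \ M`. -/
theorem spinSum_split {Λ M : Finset Site} (hM : M ⊆ Λ) (σ : Config) (F : Config → ℝ) :
    spinSum Λ σ F = spinSum (Λ \ M) σ fun ρ => spinSum M ρ F := by
  simp only [spinSum]
  rw [← Fintype.sum_prod_type' (f := fun (ρ : ↥(Λ \ M) → ℤˣ) (μ : M → ℤˣ) =>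
    F (glue M μ (glue (Λ \ M) ρ σ)))]
  refine Fintype.sum_bijective (fun τ : Λ → ℤˣ =>
    ((fun p : ↥(Λ \ M) => τ ⟨p.1, (Finset.mem_sdiff.1 p.2).1⟩), fun p : M => τ ⟨p.1, hM p.2⟩))
    ⟨?_, ?_⟩ _ _ fun τ => ?_
  · intro τ τ' h
    rw [Prod.mk.injEq] at h
    funext ⟨p, hp⟩
    by_cases hm : p ∈ M
    · exact congrFun h.2 ⟨p, hm⟩
    · exact congrFun h.1 ⟨p, Finset.mem_sdiff.2 ⟨hp, hm⟩⟩
  · rintro ⟨ρ, μ⟩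
    refine ⟨fun p => if h : p.1 ∈ M then μ ⟨p.1, h⟩ else ρ ⟨p.1, Finset.mem_sdiff.2 ⟨p.2, h⟩⟩, ?_⟩
    refine Prod.ext (funext fun p => ?_) (funext fun p => ?_)
    · exact dif_neg (Finset.mem_sdiff.1 p.2).2
    · exact dif_pos p.2
  · rw [← glue_glue hM]

/-- The effect of a sitewise change of sign. -/
theorem spinSum_flip (Λ : Finset Site) (θ σ : Config) (F : Config → ℝ) :
    spinSum Λ σ F = spinSum Λ (θ * σ) fun σ' => F (θ * σ') := by
  simp only [spinSum]
  have hsq : ∀ u : ℤˣ, u * u = 1 := Int.units_mul_self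
  refine Fintype.sum_bijective (fun τ : Λ → ℤˣ => fun p => θ p.1 * τ p)
    (Function.Involutive.bijective fun τ => ?_) _ _ fun τ => ?_
  · funext p
    change θ p.1 * (θ p.1 * τ p) = τ p
    rw [← mul_assoc, hsq, one_mul]
  · congr 1
    funext p
    rw [Pi.mul_apply]
    by_cases h : p ∈ Λ
    · rw [glue_of_mem _ _ h, glue_of_mem _ _ h, ← mul_assoc, hsq, one_mul]
    · rw [glue_of_notMem _ _ h, glue_of_notMem _ _ h, Pi.mul_apply, ← mul_assoc, hsq, one_mul]

/-- `F` depends only on the spins in `Λ`. -/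
def LocalOn (Λ : Finset Site) (F : Config → ℝ) : Prop :=
  ∀ σ σ' : Config, (∀ p ∈ Λ, σ p = σ' p) → F σ = F σ'

theorem LocalOn.spinSum_eq {Λ : Finset Site} {F : Config → ℝ} (h : LocalOn Λ F) (σ σ' : Config) :
    spinSum Λ σ F = spinSum Λ σ' F :=
  Finset.sum_congr rfl fun τ _ => h _ _ fun p hp => by rw [glue_of_mem _ _ hp, glue_of_mem _ _ hp]

/-- Independence of disjoint regions. -/
theorem spinSum_biUnion {ι : Type*} [DecidableEq ι] (I : Finset ι) (P : ι → Finset Site)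
    (hdisj : ∀ i ∈ I, ∀ j ∈ I, i ≠ j → Disjoint (P i) (P j)) (F : ι → Config → ℝ)
    (hF : ∀ i ∈ I, LocalOn (P i) (F i)) (σ : Config) :
    spinSum (I.biUnion P) σ (fun σ' => ∏ i ∈ I, F i σ') = ∏ i ∈ I, spinSum (P i) σ (F i) := by
  induction I using Finset.induction_on generalizing σ with
  | empty =>
    rw [Finset.biUnion_empty]
    simp only [spinSum, Finset.prod_empty, Finset.sum_const, nsmul_eq_mul, mul_one]
    exact_mod_cast Fintype.card_unique (α := ((∅ : Finset Site) → ℤˣ))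
  | insert i I hi ih =>
    have hd : ∀ j ∈ I, Disjoint (P i) (P j) := fun j hj =>
      hdisj i (by simp) j (by simp [hj]) (by rintro rfl; exact hi hj)
    have hsub : P i ⊆ (insert i I).biUnion P :=
      Finset.subset_biUnion_of_mem P (Finset.mem_insert_self i I)
    have hsd : (insert i I).biUnion P \ P i = I.biUnion P := by
      rw [Finset.biUnion_insert, Finset.union_sdiff_left, Finset.sdiff_eq_self_iff_disjoint]
      exact Finset.disjoint_biUnion_left _ _ _ |>.2 fun j hj => (hd j hj).symm
    rw [spinSum_split hsub, hsd, Finset.prod_insert hi, ← ih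
      (fun j hj k hk => hdisj j (by simp [hj]) k (by simp [hk]))
      (fun j hj => hF j (by simp [hj])), ← spinSum_const_mul]
    refine spinSum_congr fun ρ _ => ?_
    rw [(hF i (by simp)).spinSum_eq σ ρ, mul_comm, ← spinSum_const_mul]
    refine spinSum_congr fun σ' hσ' => ?_
    rw [Finset.prod_insert hi, mul_comm]
    congr 1
    refine Finset.prod_congr rfl fun j hj => hF j (by simp [hj]) _ _ fun p hp => hσ' p fun hpi => ?_
    exact Finset.disjoint_left.1 (hd j hj) hpi hp

theorem spinSum_singleton (p : Site) (σ : Config) (F : Config → ℝ) :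
    spinSum {p} σ F = ∑ s : ℤˣ, F (Function.update σ p s) := by
  simp only [spinSum]
  refine Fintype.sum_bijective (fun τ : ({p} : Finset Site) → ℤˣ => τ ⟨p, by simp⟩) ⟨?_, ?_⟩ _ _
    fun τ => ?_
  · intro τ τ' h
    funext ⟨q, hq⟩
    obtain rfl := Finset.mem_singleton.1 hq
    exact h
  · exact fun s => ⟨fun _ => s, rfl⟩
  · congr 1
    funext q
    by_cases h : q = p
    · subst h
      rw [glue_of_mem _ _ (by simp), Function.update_self]
    · rw [glue_of_notMem _ _ (by simpa using h), Function.update_of_ne h]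

theorem spinSum_pair {p q : Site} (hpq : p ≠ q) (σ : Config) (f : ℤˣ → ℤˣ → ℝ) :
    spinSum {p, q} σ (fun σ' => f (σ' p) (σ' q)) = ∑ s : ℤˣ, ∑ t : ℤˣ, f s t := by
  have hsub : ({q} : Finset Site) ⊆ {p, q} := by simp
  have hsd : ({p, q} : Finset Site) \ {q} = {p} := by
    ext r
    simp only [Finset.mem_sdiff, Finset.mem_insert, Finset.mem_singleton]
    constructor
    · tauto
    · rintro rfl; exact ⟨Or.inl rfl, hpq⟩
  rw [spinSum_split hsub, hsd, spinSum_singleton]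
  simp only [spinSum_singleton]
  refine Finset.sum_congr rfl fun s _ => Finset.sum_congr rfl fun t _ => ?_
  rw [Function.update_of_ne hpq, Function.update_self, Function.update_self]


/-! ### Block averages -/

/-- The horizontal block of length `ℓ` containing `p`. -/
noncomputable def blockOf (ℓ : ℕ) (p : Site) : Finset Site :=
  Finset.Ico (p.1 / (ℓ : ℤ) * ℓ) ((p.1 / (ℓ : ℤ) + 1) * ℓ) ×ˢ {p.2}

/-- The average of `f` over the block of length `ℓ`. -/
noncomputable def blockAvg (ℓ : ℕ) (f : Site → ℝ) (p : Site) : ℝ :=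
  (1 / (ℓ : ℝ)) * ∑ q ∈ blockOf ℓ p, f q

/-- `M` is a union of blocks of length `ℓ`. -/
def BlockClosed (ℓ : ℕ) (M : Finset Site) : Prop :=
  ∀ p q : Site, q.2 = p.2 → q.1 / (ℓ : ℤ) = p.1 / (ℓ : ℤ) → p ∈ M → q ∈ M

section blocks

variable {ℓ : ℕ}

theorem mem_blockOf (hℓ : 0 < ℓ) {p q : Site} :
    q ∈ blockOf ℓ p ↔ q.2 = p.2 ∧ q.1 / (ℓ : ℤ) = p.1 / (ℓ : ℤ) := by
  have h : (0 : ℤ) < ℓ := by exact_mod_cast hℓ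
  unfold blockOf
  rw [Finset.mem_product, Finset.mem_Ico, Finset.mem_singleton, and_comm,
    Int.ediv_eq_iff_of_pos h, add_mul, one_mul]

theorem self_mem_blockOf (hℓ : 0 < ℓ) (p : Site) : p ∈ blockOf ℓ p :=
  (mem_blockOf hℓ).2 ⟨rfl, rfl⟩

theorem mem_blockOf_comm (hℓ : 0 < ℓ) {p q : Site} : q ∈ blockOf ℓ p ↔ p ∈ blockOf ℓ q := by
  rw [mem_blockOf hℓ, mem_blockOf hℓ]
  constructor <;> exact fun h => ⟨h.1.symm, h.2.symm⟩

theorem blockOf_eq (hℓ : 0 < ℓ) {p q : Site} (h : q ∈ blockOf ℓ p) : blockOf ℓ q = blockOf ℓ p := by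
  rw [mem_blockOf hℓ] at h
  unfold blockOf
  rw [h.1, h.2]

theorem card_blockOf (ℓ : ℕ) (p : Site) : (blockOf ℓ p).card = ℓ := by
  unfold blockOf
  rw [Finset.card_product, Int.card_Ico, Finset.card_singleton, mul_one, add_mul, one_mul,
    add_sub_cancel_left, Int.toNat_natCast]

theorem blockAvg_eq (hℓ : 0 < ℓ) (f : Site → ℝ) {p q : Site} (h : q ∈ blockOf ℓ p) :
    blockAvg ℓ f q = blockAvg ℓ f p := by
  unfold blockAvg
  rw [blockOf_eq hℓ h]

theorem BlockClosed.blockOf_subset {M : Finset Site} (hM : BlockClosed ℓ M) (hℓ : 0 < ℓ)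
    {p : Site} (hp : p ∈ M) : blockOf ℓ p ⊆ M := fun q hq => by
  rw [mem_blockOf hℓ] at hq
  exact hM p q hq.1 hq.2 hp

theorem BlockClosed.sdiff {M N : Finset Site} (hM : BlockClosed ℓ M) (hN : BlockClosed ℓ N) :
    BlockClosed ℓ (M \ N) := fun p q h1 h2 hp => by
  rw [Finset.mem_sdiff] at hp ⊢
  exact ⟨hM p q h1 h2 hp.1, fun h => hp.2 (hN q p h1.symm h2.symm h)⟩

theorem blockClosed_blockOf (hℓ : 0 < ℓ) {ℓ' : ℕ} (hℓ' : 0 < ℓ') (hd : ℓ ∣ ℓ') (p : Site) :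
    BlockClosed ℓ (blockOf ℓ' p) := by
  intro q r h1 h2 hq
  rw [mem_blockOf hℓ'] at hq ⊢
  obtain ⟨k, rfl⟩ := hd
  refine ⟨h1.trans hq.1, ?_⟩
  rw [← hq.2]
  push_cast
  rw [← Int.ediv_ediv_of_nonneg (by positivity), ← Int.ediv_ediv_of_nonneg (by positivity), h2]

theorem sum_sum_blockOf (hℓ : 0 < ℓ) {M : Finset Site} (hM : BlockClosed ℓ M)
    (F : Site → Site → ℝ) :
    ∑ p ∈ M, ∑ q ∈ blockOf ℓ p, F p q = ∑ q ∈ M, ∑ p ∈ blockOf ℓ q, F p q := by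
  refine Finset.sum_comm' fun p q => ⟨fun ⟨h1, h2⟩ => ⟨(mem_blockOf_comm hℓ).1 h2,
    hM.blockOf_subset hℓ h1 h2⟩, fun ⟨h1, h2⟩ => ⟨hM.blockOf_subset hℓ h2 h1,
    (mem_blockOf_comm hℓ).1 h1⟩⟩

theorem sum_blockAvg_mul (hℓ : 0 < ℓ) {M : Finset Site} (hM : BlockClosed ℓ M) (f g : Site → ℝ) :
    ∑ p ∈ M, blockAvg ℓ f p * g p = ∑ p ∈ M, f p * blockAvg ℓ g p := by
  simp only [blockAvg, Finset.mul_sum, Finset.sum_mul]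
  rw [sum_sum_blockOf hℓ hM]
  exact Finset.sum_congr rfl fun p _ => Finset.sum_congr rfl fun q _ => by ring

theorem blockAvg_const (hℓ : 0 < ℓ) (c : ℝ) (p : Site) : blockAvg ℓ (fun _ => c) p = c := by
  have : (ℓ : ℝ) ≠ 0 := by exact_mod_cast hℓ.ne'
  rw [blockAvg, Finset.sum_const, card_blockOf, nsmul_eq_mul]
  field_simp

theorem sum_blockAvg (hℓ : 0 < ℓ) {M : Finset Site} (hM : BlockClosed ℓ M) (f : Site → ℝ) :
    ∑ p ∈ M, blockAvg ℓ f p = ∑ p ∈ M, f p := by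
  have := sum_blockAvg_mul hℓ hM f fun _ => 1
  simpa [blockAvg_const hℓ] using this

/-- Block averaging is symmetric and idempotent, an orthogonal projection. Applied to the spins,
this lets their own profile play the role of the external field in `energy_lower`. -/
theorem sum_blockAvg_sq (hℓ : 0 < ℓ) {M : Finset Site} (hM : BlockClosed ℓ M) (f : Site → ℝ) :
    ∑ p ∈ M, blockAvg ℓ f p ^ 2 = ∑ p ∈ M, f p * blockAvg ℓ f p := by
  have h := sum_blockAvg_mul hℓ hM f (blockAvg ℓ f)
  have h2 : ∀ p, blockAvg ℓ (blockAvg ℓ f) p = blockAvg ℓ f p := fun p => by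
    rw [blockAvg, Finset.sum_congr rfl fun q hq => blockAvg_eq hℓ f hq, Finset.sum_const,
      card_blockOf, nsmul_eq_mul]
    have : (ℓ : ℝ) ≠ 0 := by exact_mod_cast hℓ.ne'
    field_simp
  simp only [h2] at h
  rw [← h]
  exact Finset.sum_congr rfl fun p _ => by ring

theorem blockAvg_blockAvg (hℓ : 0 < ℓ) {ℓ' : ℕ} (hℓ' : 0 < ℓ') (hd : ℓ ∣ ℓ') (f : Site → ℝ)
    (p : Site) : blockAvg ℓ' (blockAvg ℓ f) p = blockAvg ℓ' f p := by
  rw [blockAvg, sum_blockAvg hℓ (blockClosed_blockOf hℓ hℓ' hd p), blockAvg]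

theorem abs_sub_blockAvg_le (hℓ : 0 < ℓ) {f : Site → ℝ} {p : Site} {x b : ℝ}
    (h : ∀ q ∈ blockOf ℓ p, |x - f q| ≤ b) : |x - blockAvg ℓ f p| ≤ b := by
  have hl : (0 : ℝ) < ℓ := by exact_mod_cast hℓ
  have e : x - blockAvg ℓ f p = (1 / (ℓ : ℝ)) * ∑ q ∈ blockOf ℓ p, (x - f q) := by
    rw [Finset.sum_sub_distrib, Finset.sum_const, card_blockOf, nsmul_eq_mul, blockAvg]
    field_simp
  rw [e, abs_mul, abs_of_pos (by positivity)]
  calc 1 / (ℓ : ℝ) * |∑ q ∈ blockOf ℓ p, (x - f q)|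
      ≤ 1 / (ℓ : ℝ) * ∑ q ∈ blockOf ℓ p, b := by
        gcongr
        exact (Finset.abs_sum_le_sum_abs _ _).trans (Finset.sum_le_sum h)
    _ = b := by
        rw [Finset.sum_const, card_blockOf, nsmul_eq_mul]
        field_simp

theorem abs_blockAvg_le (hℓ : 0 < ℓ) {f : Site → ℝ} {p : Site} {b : ℝ}
    (h : ∀ q ∈ blockOf ℓ p, |f q| ≤ b) : |blockAvg ℓ f p| ≤ b := by
  have := abs_sub_blockAvg_le (x := 0) hℓ (f := f) (p := p) (b := b) fun q hq => by simpa using h q hq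
  simpa using this

theorem blockAvg_congr {f g : Site → ℝ} {p : Site} (h : ∀ q ∈ blockOf ℓ p, f q = g q) :
    blockAvg ℓ f p = blockAvg ℓ g p := by
  rw [blockAvg, blockAvg, Finset.sum_congr rfl h]

end blocks

theorem abs_spinVal (σ : Config) (p : Site) : |spinVal σ p| = 1 := by
  unfold spinVal
  rcases Int.units_eq_one_or (σ p) with h | h <;> simp [h]

theorem spinVal_mul_self (σ : Config) (p : Site) : spinVal σ p * spinVal σ p = 1 := by
  unfold spinVal
  rcases Int.units_eq_one_or (σ p) with h | h <;> simp [h]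

theorem spinVal_mul (θ σ : Config) (p : Site) :
    spinVal (θ * σ) p = spinVal θ p * spinVal σ p := by
  simp [spinVal]

/-! ### The energy in terms of the block averages -/

namespace KacModel

variable (K : KacModel)

theorem empMag_eq (σ : Config) (p : Site) :
    K.empMag σ p = blockAvg K.ellMinus (spinVal σ) p := by
  unfold empMag blockAvg blockOf
  rw [Finset.sum_product]
  simp

/-- The horizontal interaction of two sites, including the self-interaction. -/
noncomputable def siteKer (p q : Site) : ℝ := if p.2 = q.2 then K.kac p.1 q.1 else 0

/-- The bilinear form of the horizontal interaction. -/
noncomputable def bilin (M T : Finset Site) (f : Site → ℝ) : ℝ :=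
  ∑ p ∈ M, ∑ q ∈ T, K.siteKer p q * f p * f q

/-- The Dirichlet form of the horizontal interaction. -/
noncomputable def dirichlet (M T : Finset Site) (f : Site → ℝ) : ℝ :=
  ∑ p ∈ M, ∑ q ∈ T, K.siteKer p q * (f p - f q) ^ 2

/-- The lower sites of the coupled vertical pairs in `M`. -/
def lowSites (M : Finset Site) : Finset Site :=
  M.filter fun p => Even (p.1 / (K.ellPlus : ℤ) + p.2)

/-- The upper neighbour of a site. -/
def up (p : Site) : Site := (p.1, p.2 + 1)

/-- `M` is a union of coupled vertical pairs. -/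
def PairClosed (M : Finset Site) : Prop :=
  ∀ p : Site, Even (p.1 / (K.ellPlus : ℤ) + p.2) → (p ∈ M ↔ up p ∈ M)

/-- `U` contains all the sites which interact horizontally with `M`. -/
def RangeIn (M U : Finset Site) : Prop :=
  ∀ p ∈ M, ∀ y : ℤ, |y - p.1| ≤ 2 ^ K.scales.n → (y, p.2) ∈ U

/-- The length of the blocks on the coarse-graining scale. -/
def blockLen : ℕ := 2 ^ K.scales.half

theorem blockLen_pos : 0 < K.blockLen := by unfold blockLen; positivity

variable {K} {C c : ℝ} {k₀ : ℕ}

theorem RangeIn.subset {M U : Finset Site} (h : K.RangeIn M U) : M ⊆ U := fun p hp => by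
  simpa using h p hp p.1 (by simp)

theorem RangeIn.mono {M N U : Finset Site} (h : K.RangeIn M U) (hN : N ⊆ M) : K.RangeIn N U :=
  fun p hp => h p (hN hp)

namespace KernelBounds

variable (hK : K.KernelBounds C c k₀)
include hK

theorem siteKer_nonneg (p q : Site) : 0 ≤ K.siteKer p q := by
  unfold siteKer
  split_ifs
  · exact hK.nonneg _ _
  · exact le_rfl

theorem siteKer_comm (p q : Site) : K.siteKer p q = K.siteKer q p := by
  unfold siteKer
  by_cases h : p.2 = q.2
  · rw [if_pos h, if_pos h.symm, hK.symm]
  · rw [if_neg h, if_neg (Ne.symm h)]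

theorem sum_siteKer {M U : Finset Site} (hU : K.RangeIn M U) {p : Site} (hp : p ∈ M) :
    ∑ q ∈ U, K.siteKer p q = 1 + K.kac 0 0 := by
  rw [← hK.row_sum p.1 ((U.filter fun q => q.2 = p.2).image Prod.fst)]
  · rw [Finset.sum_image]
    · rw [Finset.sum_filter]
      refine Finset.sum_congr rfl fun q _ => ?_
      unfold siteKer
      simp only [eq_comm]
    · intro q hq r hr h
      simp only [Finset.coe_filter, Set.mem_ofPred_eq] at hq hr
      exact Prod.ext h (hq.2.trans hr.2.symm)
  · intro y hy
    rw [Finset.mem_Icc] at hy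
    refine Finset.mem_image.2 ⟨(y, p.2), Finset.mem_filter.2 ⟨hU p hp y ?_, rfl⟩, rfl⟩
    rw [abs_le]
    constructor <;> linarith

theorem sum_siteKer_le (p : Site) (T : Finset Site) : ∑ q ∈ T, K.siteKer p q ≤ 1 + K.kac 0 0 := by
  set N : ℤ := 2 ^ K.scales.n
  set U := T ∪ Finset.Icc (p.1 - N) (p.1 + N) ×ˢ {p.2}
  rw [← hK.sum_siteKer (M := {p}) (U := U) ?_ (Finset.mem_singleton_self p)]
  · exact Finset.sum_le_sum_of_subset_of_nonneg Finset.subset_union_left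
      fun q _ _ => hK.siteKer_nonneg p q
  · intro q hq y hy
    obtain rfl := Finset.mem_singleton.1 hq
    rw [abs_le] at hy
    refine Finset.mem_union_right _ (Finset.mem_product.2 ⟨Finset.mem_Icc.2 ⟨?_, ?_⟩, by simp⟩)
    · linarith [hy.1]
    · linarith [hy.2]

/-- The energy in `M`, for `M` a union of coupled pairs. -/
theorem energy_eq {M U : Finset Site} (hM : K.PairClosed M) (hU : K.RangeIn M U) (σ : Config) :
    K.energy M σ = -(1 / 2) * K.bilin M M (spinVal σ) - K.bilin M (U \ M) (spinVal σ)
      + (1 / 2) * (M.card * K.kac 0 0)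
      - K.ε * ∑ p ∈ K.lowSites M, spinVal σ p * spinVal σ (up p) := by
  -- The diagonal terms, present in `bilin` and absent from the energy, are constants because the
  -- square of a spin is `1`.
  have hd : ∀ x, K.kac x x = K.kac 0 0 := fun x => by simp [kac]
  have h1 : (∑ p ∈ M, ∑ q ∈ M, if p.2 = q.2 ∧ p.1 ≠ q.1 then
      K.kac p.1 q.1 * spinVal σ p * spinVal σ q else 0)
      = K.bilin M M (spinVal σ) - M.card * K.kac 0 0 := by
    have : (M.card : ℝ) * K.kac 0 0 =
        ∑ p ∈ M, ∑ q ∈ M, if p = q then K.kac 0 0 else 0 := by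
      simp [Finset.sum_ite_eq]
    rw [this, bilin, ← Finset.sum_sub_distrib]
    refine Finset.sum_congr rfl fun p _ => ?_
    rw [← Finset.sum_sub_distrib]
    refine Finset.sum_congr rfl fun q _ => ?_
    unfold siteKer
    by_cases h2 : p.2 = q.2
    · by_cases h1 : p.1 = q.1
      · have hpq : p = q := Prod.ext h1 h2
        subst hpq
        simp [hd, mul_assoc, spinVal_mul_self]
      · have hpq : p ≠ q := fun h => h1 (by rw [h])
        simp [h1, h2, hpq]
    · have hpq : p ≠ q := fun h => h2 (by rw [h])
      simp [h2, hpq]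
  have h2 : (∑ p ∈ M, ∑' y : ℤ, if (y, p.2) ∈ M then 0 else
        K.kac p.1 y * spinVal σ p * spinVal σ (y, p.2)) = K.bilin M (U \ M) (spinVal σ) := by
    unfold bilin
    refine Finset.sum_congr rfl fun p hp => ?_
    rw [tsum_eq_sum (s := (U.filter fun q => q.2 = p.2).image Prod.fst)]
    · rw [Finset.sum_image]
      · rw [Finset.sum_filter, ← Finset.sum_sdiff hU.subset, add_eq_left.2]
        · refine Finset.sum_congr rfl fun q hq => ?_
          unfold siteKer
          by_cases h : q.2 = p.2
          · have : (q.1, p.2) = q := by rw [← h]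
            rw [if_pos h, this, if_neg (Finset.mem_sdiff.1 hq).2, if_pos h.symm]
          · rw [if_neg h, if_neg (Ne.symm h)]; ring
        · refine Finset.sum_eq_zero fun q hq => ?_
          split_ifs with h h'
          · rfl
          · exact absurd (by rw [← h]; exact hq) h'
          · rfl
      · intro q hq r hr h
        simp only [Finset.coe_filter, Set.mem_ofPred_eq] at hq hr
        exact Prod.ext h (hq.2.trans hr.2.symm)
    · intro y hy
      split_ifs
      · rfl
      · rw [hK.range, zero_mul, zero_mul]
        by_contra hcon
        refine hy (Finset.mem_image.2 ⟨(y, p.2), Finset.mem_filter.2 ⟨hU p hp y ?_, rfl⟩, rfl⟩)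
        rw [abs_sub_comm]
        exact not_lt.1 hcon
  -- No coupled vertical bond crosses the boundary of a union of coupled pairs, so the bonds with
  -- lower end below `M` have `χ = 0`.
  have h3 : (∑ p ∈ M ∪ M.image (fun p => (p.1, p.2 - 1)),
        K.chi p * spinVal σ p * spinVal σ (p.1, p.2 + 1))
      = ∑ p ∈ K.lowSites M, spinVal σ p * spinVal σ (up p) := by
    rw [lowSites, Finset.sum_filter, ← Finset.sum_subset Finset.subset_union_left]
    · refine Finset.sum_congr rfl fun p _ => ?_
      unfold chi up
      split_ifs <;> ring
    · intro p hp hpM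
      unfold chi
      split_ifs with h
      · rcases Finset.mem_union.1 hp with hp | hp
        · exact absurd hp hpM
        · obtain ⟨q, hq, rfl⟩ := Finset.mem_image.1 hp
          refine absurd ((hM _ h).2 ?_) hpM
          simpa [up] using hq
      · ring
  rw [energy, h1, h2, h3]
  ring

/-- Completing the squares. -/
theorem bilin_eq_dirichlet {M U : Finset Site} (hU : K.RangeIn M U) (u : Site → ℝ) :
    -(1 / 2) * K.bilin M M u - K.bilin M (U \ M) u =
      -((1 + K.kac 0 0) / 2) * ∑ p ∈ M, u p ^ 2 + (1 / 4) * K.dirichlet M M u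
      + (1 / 2) * K.dirichlet M (U \ M) u
      - (1 / 2) * ∑ p ∈ M, ∑ q ∈ U \ M, K.siteKer p q * u q ^ 2 := by
  -- The identity is `-u v = ((u - v) ^ 2 - u ^ 2 - v ^ 2) / 2`. Bonds inside `M` are counted twice
  -- and those across the boundary once, whence `1 / 4` and `1 / 2`; the squares in `M` are
  -- collected with the row sums.
  have hsymm : ∑ p ∈ M, ∑ q ∈ M, K.siteKer p q * u q ^ 2 =
      ∑ p ∈ M, ∑ q ∈ M, K.siteKer p q * u p ^ 2 := by
    rw [Finset.sum_comm]
    exact Finset.sum_congr rfl fun p _ => Finset.sum_congr rfl fun q _ => by rw [hK.siteKer_comm]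
  have hrow : (1 + K.kac 0 0) * ∑ p ∈ M, u p ^ 2 = ∑ p ∈ M, ∑ q ∈ M, K.siteKer p q * u p ^ 2
      + ∑ p ∈ M, ∑ q ∈ U \ M, K.siteKer p q * u p ^ 2 := by
    rw [Finset.mul_sum, ← Finset.sum_add_distrib]
    refine Finset.sum_congr rfl fun p hp => ?_
    rw [← hK.sum_siteKer hU hp, ← Finset.sum_sdiff hU.subset, add_mul, Finset.sum_mul,
      Finset.sum_mul, add_comm]
  have e : ∀ T : Finset Site, K.dirichlet M T u = ∑ p ∈ M, ∑ q ∈ T, K.siteKer p q * u p ^ 2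
      + ∑ p ∈ M, ∑ q ∈ T, K.siteKer p q * u q ^ 2 - 2 * K.bilin M T u := by
    intro T
    simp only [dirichlet, bilin, Finset.mul_sum, ← Finset.sum_add_distrib,
      ← Finset.sum_sub_distrib]
    exact Finset.sum_congr rfl fun p _ => Finset.sum_congr rfl fun q _ => by ring
  rw [e M, e (U \ M), hsymm]
  linear_combination (1 / 2) * hrow

end KernelBounds

end KacModel


/-! ### Replacing spins by block averages in the horizontal interaction -/

namespace KacModel

namespace KernelBounds

variable {K : KacModel} {C c : ℝ} {k₀ : ℕ}

theorem abs_sub_le_of_mem_blockOf {ℓ : ℕ} {p q : Site} (hq : q ∈ blockOf ℓ p) (hℓ : 0 < ℓ) :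
    |p.1 - q.1| ≤ ℓ := by
  have hp := self_mem_blockOf hℓ p
  unfold blockOf at hp hq
  rw [Finset.mem_product, Finset.mem_Ico] at hp hq
  rw [abs_le]
  have : (p.1 / (ℓ : ℤ) + 1) * ℓ = p.1 / (ℓ : ℤ) * ℓ + ℓ := by ring
  omega

variable (hK : K.KernelBounds C c k₀)
include hK

/-- Replacing the spins by their block averages. -/
theorem bilin_sub_blockAvg_le (hC : 0 ≤ C) (hL : K.blockLen ≤ 2 ^ K.scales.n) {M T : Finset Site}
    (hM : BlockClosed K.blockLen M) (hT : BlockClosed K.blockLen T) {f : Site → ℝ}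
    (hf : ∀ p, |f p| ≤ 1) :
    |K.bilin M T f - K.bilin M T (blockAvg K.blockLen f)| ≤
      14 * C * K.γ * K.blockLen * M.card := by
  set ℓ := K.blockLen with hℓdef
  have hℓ : 0 < ℓ := K.blockLen_pos
  have hγ := K.gamma_pos
  set N : ℤ := 2 ^ K.scales.n with hN
  have hℓN : (ℓ : ℤ) ≤ N := by rw [hN]; exact_mod_cast hL
  -- By symmetry of the averaging, averaging the spins amounts to averaging the kernel in both
  -- variables. The kernel is Lipschitz, so it changes by at most `b`. Both sites move by at most `ℓ
  -- ≤ N`, so nothing changes beyond distance `3 N`, and `γ N = 1`.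
  set kk : Site → Site → ℝ := fun p q =>
    blockAvg ℓ (fun q' => blockAvg ℓ (fun p' => K.siteKer p' q') p) q with hkk
  have e1 : K.bilin M T (blockAvg ℓ f) = ∑ p ∈ M, ∑ q ∈ T, kk p q * f p * f q := by
    have h1 : ∀ q, ∑ p ∈ M, K.siteKer p q * blockAvg ℓ f p * blockAvg ℓ f q =
        ∑ p ∈ M, blockAvg ℓ (fun p' => K.siteKer p' q) p * f p * blockAvg ℓ f q := by
      intro q
      rw [← Finset.sum_mul, ← Finset.sum_mul]
      congr 1
      have := sum_blockAvg_mul hℓ hM f fun p' => K.siteKer p' q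
      calc _ = ∑ p ∈ M, blockAvg ℓ f p * K.siteKer p q :=
            Finset.sum_congr rfl fun p _ => by ring
        _ = _ := this
        _ = _ := Finset.sum_congr rfl fun p _ => by ring
    unfold bilin
    rw [Finset.sum_comm, Finset.sum_congr rfl fun q _ => h1 q, Finset.sum_comm]
    refine Finset.sum_congr rfl fun p _ => ?_
    have := sum_blockAvg_mul hℓ hT f fun q' => blockAvg ℓ (fun p' => K.siteKer p' q') p
    calc _ = f p * ∑ q ∈ T, blockAvg ℓ f q * blockAvg ℓ (fun p' => K.siteKer p' q) p := by
          rw [Finset.mul_sum]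
          exact Finset.sum_congr rfl fun q _ => by ring
      _ = f p * ∑ q ∈ T, f q * kk p q := by rw [this]
      _ = _ := by
          rw [Finset.mul_sum]
          exact Finset.sum_congr rfl fun q _ => by ring
  set b : ℝ := 2 * C * K.γ ^ 2 * ℓ with hb
  have hb0 : 0 ≤ b := by positivity
  have hpt : ∀ p q, |K.siteKer p q - kk p q| ≤
      if q ∈ Finset.Icc (p.1 - 3 * N) (p.1 + 3 * N) ×ˢ ({p.2} : Finset ℤ) then b else 0 := by
    intro p q
    refine abs_sub_blockAvg_le hℓ fun q' hq' => abs_sub_blockAvg_le hℓ fun p' hp' => ?_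
    have hp1 := abs_sub_le_of_mem_blockOf hp' hℓ
    have hq1 := abs_sub_le_of_mem_blockOf hq' hℓ
    have hp2 := ((mem_blockOf hℓ).1 hp').1
    have hq2 := ((mem_blockOf hℓ).1 hq').1
    unfold siteKer
    by_cases h2 : p.2 = q.2
    · rw [if_pos h2, if_pos (by rw [hp2, hq2, h2])]
      split_ifs with h
      · refine (hK.lip _ _ _ _).trans ?_
        have h3 : |(p.1 : ℝ) - p'.1| ≤ ℓ := by exact_mod_cast hp1
        have h4 : |(q.1 : ℝ) - q'.1| ≤ ℓ := by exact_mod_cast hq1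
        calc C * K.γ ^ 2 * (|(p.1 : ℝ) - p'.1| + |(q.1 : ℝ) - q'.1|)
            ≤ C * K.γ ^ 2 * (ℓ + ℓ) := by gcongr
          _ = b := by rw [hb]; ring
      · have hfar : 3 * N < |p.1 - q.1| := by
          by_contra hcon
          have := abs_le.1 (not_lt.1 hcon)
          refine h (Finset.mem_product.2 ⟨Finset.mem_Icc.2 ⟨?_, ?_⟩, by simp [h2]⟩)
          · linarith [this.2]
          · linarith [this.1]
        have hN0 : 0 < N := by positivity
        have hfar' : N < |p'.1 - q'.1| := by
          have t1 : |p.1 - q.1| ≤ |p.1 - p'.1| + |p'.1 - q'.1| + |q.1 - q'.1| := by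
            have := abs_add_le (p.1 - p'.1 + (p'.1 - q'.1)) (q'.1 - q.1)
            have h5 := abs_add_le (p.1 - p'.1) (p'.1 - q'.1)
            rw [abs_sub_comm q'.1 q.1] at this
            rw [show p.1 - q.1 = p.1 - p'.1 + (p'.1 - q'.1) + (q'.1 - q.1) by ring]
            linarith
          linarith
        rw [hK.range _ _ hfar', hK.range _ _ (by linarith)]
        simp
    · rw [if_neg h2, if_neg (by rw [hp2, hq2]; exact h2)]
      split_ifs <;> simp [hb0]
  have hcard : ((6 * N + 1 : ℤ) : ℝ) ≤ 7 * N := by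
    have : (1 : ℤ) ≤ N := by
      have : 0 < N := by positivity
      omega
    have h' : (1 : ℝ) ≤ N := by exact_mod_cast this
    push_cast
    linarith
  have hγN : K.γ * N = 1 := by rw [hN]; push_cast; exact K.gamma_mul_pow
  rw [e1, bilin, ← Finset.sum_sub_distrib]
  calc |∑ p ∈ M, (∑ q ∈ T, K.siteKer p q * f p * f q - ∑ q ∈ T, kk p q * f p * f q)|
      ≤ ∑ p ∈ M, ∑ q ∈ T, |K.siteKer p q - kk p q| := by
        refine (Finset.abs_sum_le_sum_abs _ _).trans (Finset.sum_le_sum fun p _ => ?_)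
        rw [← Finset.sum_sub_distrib]
        refine (Finset.abs_sum_le_sum_abs _ _).trans (Finset.sum_le_sum fun q _ => ?_)
        rw [← sub_mul, ← sub_mul, abs_mul, abs_mul, mul_assoc]
        refine mul_le_of_le_one_right (abs_nonneg _) ?_
        exact mul_le_one₀ (hf p) (abs_nonneg _) (hf q)
    _ ≤ ∑ p ∈ M, 7 * N * b := by
        refine Finset.sum_le_sum fun p _ => ?_
        calc _ ≤ ∑ q ∈ T, if q ∈ Finset.Icc (p.1 - 3 * N) (p.1 + 3 * N) ×ˢ ({p.2} : Finset ℤ)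
              then b else 0 := Finset.sum_le_sum fun q _ => hpt p q
          _ = (T.filter fun q => q ∈ Finset.Icc (p.1 - 3 * N) (p.1 + 3 * N) ×ˢ
              ({p.2} : Finset ℤ)).card * b := by
              rw [← Finset.sum_filter, Finset.sum_const, nsmul_eq_mul]
          _ ≤ (Finset.Icc (p.1 - 3 * N) (p.1 + 3 * N) ×ˢ ({p.2} : Finset ℤ)).card * b := by
              gcongr
              intro q hq
              exact (Finset.mem_filter.1 hq).2
          _ = ((6 * N + 1 : ℤ) : ℝ) * b := by
              congr 1
              rw [Finset.card_product, Int.card_Icc, Finset.card_singleton, mul_one]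
              have hN0 : 0 < N := by positivity
              have : ((p.1 + 3 * N + 1 - (p.1 - 3 * N)).toNat : ℤ) = 6 * N + 1 := by omega
              exact_mod_cast this
          _ ≤ 7 * N * b := by gcongr
    _ = 14 * C * K.γ * ℓ * M.card := by
        rw [Finset.sum_const, nsmul_eq_mul, hb]
        linear_combination (14 * C * K.γ * ℓ * M.card) * hγN

end KernelBounds

end KacModel


namespace KacModel

variable (K : KacModel)

/-! ### Scales -/

theorem scale_eq {β : ℝ} {k : ℕ} (h : K.γ ^ (-β) = 2 ^ k) : (k : ℝ) = K.scales.n * β := by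
  have h2 : K.γ ^ (-β) = (2 : ℝ) ^ ((K.scales.n : ℝ) * β) := by
    have hg := K.scales.gamma_eq
    generalize K.scales.n = n at hg
    rw [hg, ← Real.rpow_natCast, ← Real.rpow_neg (by norm_num), ← Real.rpow_mul (by norm_num)]
    congr 1; ring
  rw [h2, ← Real.rpow_natCast] at h
  exact ((Real.rpow_right_inj (by norm_num) (by norm_num)).1 h).symm

theorem vert_cast : (K.scales.vert : ℝ) = K.scales.n * K.α := K.scale_eq K.scales.vert_eq

theorem minus_add_vert : K.scales.minus + K.scales.vert = K.scales.n := by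
  have h1 := K.scale_eq K.scales.minus_eq
  have h2 := K.vert_cast
  have : ((K.scales.minus + K.scales.vert : ℕ) : ℝ) = K.scales.n := by
    push_cast; rw [h1, h2]; ring
  exact_mod_cast this

theorem plus_eq_add : K.scales.plus = K.scales.n + K.scales.vert := by
  have h1 := K.scale_eq K.scales.plus_eq
  have h2 := K.vert_cast
  have : (K.scales.plus : ℝ) = ((K.scales.n + K.scales.vert : ℕ) : ℝ) := by
    push_cast; rw [h1, h2]; ring
  exact_mod_cast this

theorem half_add_half : K.scales.half + K.scales.half = K.scales.n := by
  have h1 := K.scale_eq (β := 1 / 2) K.scales.half_eq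
  have : ((K.scales.half + K.scales.half : ℕ) : ℝ) = K.scales.n := by
    push_cast; rw [h1]; ring
  exact_mod_cast this

theorem half_le_minus (hα : K.α ≤ 1 / 2) : K.scales.half ≤ K.scales.minus := by
  have h1 := K.scale_eq K.scales.minus_eq
  have h2 := K.scale_eq (β := 1 / 2) K.scales.half_eq
  have : (K.scales.half : ℝ) ≤ K.scales.minus := by
    rw [h1, h2]
    have : (0 : ℝ) ≤ K.scales.n := by positivity
    nlinarith
  exact_mod_cast this

/-- The range of the interaction, `γ⁻¹`. -/
def tileLen : ℕ := 2 ^ K.scales.n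

theorem blockLen_dvd_tileLen : K.blockLen ∣ K.tileLen :=
  pow_dvd_pow 2 (by have := K.half_add_half; omega)

theorem blockLen_dvd_ellMinus (hα : K.α ≤ 1 / 2) : K.blockLen ∣ K.ellMinus :=
  pow_dvd_pow 2 (K.half_le_minus hα)

theorem ellMinus_dvd_tileLen : K.ellMinus ∣ K.tileLen :=
  pow_dvd_pow 2 (by have := K.minus_add_vert; omega)

theorem ellPlus_eq : K.ellPlus = K.tileLen * K.height := by
  rw [ellPlus, tileLen, height, ← pow_add, K.plus_eq_add]

theorem tileLen_dvd_ellPlus : K.tileLen ∣ K.ellPlus := ⟨_, K.ellPlus_eq⟩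

theorem tileLen_pos : 0 < K.tileLen := by unfold tileLen; positivity

theorem ellPlus_pos : 0 < K.ellPlus := by unfold ellPlus; positivity

theorem ellMinus_pos : 0 < K.ellMinus := by unfold ellMinus; positivity

theorem height_pos : 0 < K.height := by unfold height; positivity

/-- Parity is what prevents a rectangle from cutting a coupled pair, see `rectOf_up`; it needs
`γ^(-α)` to be a positive power of `2`. -/
theorem even_height : Even (K.height : ℤ) := by
  unfold height
  push_cast
  exact (even_two).pow_of_ne_zero K.scales.vert_pos.ne'

theorem ediv_eq_of_dvd {ℓ ℓ' : ℕ} (hd : ℓ ∣ ℓ') {x y : ℤ} (h : x / (ℓ : ℤ) = y / (ℓ : ℤ)) :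
    x / (ℓ' : ℤ) = y / (ℓ' : ℤ) := by
  obtain ⟨k, rfl⟩ := hd
  push_cast
  rw [← Int.ediv_ediv_of_nonneg (by positivity), ← Int.ediv_ediv_of_nonneg (by positivity), h]

/-! ### Coupled pairs -/

/-- `p` is the lower site of a coupled pair. -/
def IsLow (p : Site) : Prop := Even (p.1 / (K.ellPlus : ℤ) + p.2)

instance (p : Site) : Decidable (K.IsLow p) := by unfold IsLow; infer_instance

/-- The lower row of the coupled pair of `p`. -/
def lowRow (p : Site) : ℤ := if K.IsLow p then p.2 else p.2 - 1

/-- The lower site of the coupled pair of `p`. -/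
def lowRep (p : Site) : Site := (p.1, K.lowRow p)

theorem mem_lowSites {M : Finset Site} {p : Site} : p ∈ K.lowSites M ↔ p ∈ M ∧ K.IsLow p :=
  Finset.mem_filter

theorem isLow_up {p : Site} : K.IsLow (up p) ↔ ¬K.IsLow p := by
  unfold IsLow up
  rw [← add_assoc, Int.even_add_one]

theorem isLow_lowRep (p : Site) : K.IsLow (K.lowRep p) := by
  unfold lowRep lowRow
  split_ifs with h
  · exact h
  · by_contra h'
    refine h ?_
    rw [← K.isLow_up] at h'
    simpa [up] using h'

theorem eq_lowRep_or (p : Site) : p = K.lowRep p ∨ p = up (K.lowRep p) := by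
  unfold lowRep lowRow up
  split_ifs
  · exact Or.inl rfl
  · exact Or.inr (by simp)

theorem lowRep_of_isLow {p : Site} (h : K.IsLow p) : K.lowRep p = p := by
  simp [lowRep, lowRow, h]

theorem lowRep_up {p : Site} (h : K.IsLow p) : K.lowRep (up p) = p := by
  have : ¬K.IsLow (up p) := by rw [isLow_up]; simpa using h
  unfold lowRep lowRow
  rw [if_neg this]
  simp [up]

theorem up_ne (p : Site) : p ≠ up p := by
  intro h
  have := congrArg Prod.snd h
  simp [up] at this

variable {K}

theorem PairClosed.lowRep_mem {M : Finset Site} (hM : K.PairClosed M) {p : Site} :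
    K.lowRep p ∈ M ↔ p ∈ M := by
  rcases K.eq_lowRep_or p with h | h
  · rw [← h]
  · conv_rhs => rw [h]
    exact hM _ (K.isLow_lowRep p)

theorem PairClosed.eq_biUnion {M : Finset Site} (hM : K.PairClosed M) :
    M = (K.lowSites M).biUnion fun p => {p, up p} := by
  ext q
  simp only [Finset.mem_biUnion, Finset.mem_insert, Finset.mem_singleton, K.mem_lowSites]
  constructor
  · exact fun hq => ⟨K.lowRep q, ⟨hM.lowRep_mem.2 hq, K.isLow_lowRep q⟩, K.eq_lowRep_or q⟩
  · rintro ⟨p, ⟨hp, hl⟩, rfl | rfl⟩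
    · exact hp
    · exact (hM p hl).1 hp

theorem lowSites_disjoint {M : Finset Site} : ∀ p ∈ K.lowSites M, ∀ q ∈ K.lowSites M, p ≠ q →
    Disjoint ({p, up p} : Finset Site) {q, up q} := by
  intro p hp q hq hpq
  rw [K.mem_lowSites] at hp hq
  rw [Finset.disjoint_left]
  intro r hr hr'
  have h1 : K.lowRep r = p := by
    rcases Finset.mem_insert.1 hr with rfl | h
    · exact K.lowRep_of_isLow hp.2
    · rw [Finset.mem_singleton.1 h]; exact K.lowRep_up hp.2
  have h2 : K.lowRep r = q := by
    rcases Finset.mem_insert.1 hr' with rfl | h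
    · exact K.lowRep_of_isLow hq.2
    · rw [Finset.mem_singleton.1 h]; exact K.lowRep_up hq.2
  exact hpq (h1.symm.trans h2)

theorem PairClosed.sum_eq {M : Finset Site} (hM : K.PairClosed M) (f : Site → ℝ) :
    ∑ p ∈ M, f p = ∑ p ∈ K.lowSites M, (f p + f (up p)) := by
  conv_lhs => rw [hM.eq_biUnion]
  rw [Finset.sum_biUnion fun p hp q hq h => lowSites_disjoint p hp q hq h]
  exact Finset.sum_congr rfl fun p _ => Finset.sum_pair (up_ne p)

theorem PairClosed.sdiff {M N : Finset Site} (hM : K.PairClosed M) (hN : K.PairClosed N) :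
    K.PairClosed (M \ N) := fun p hp => by
  rw [Finset.mem_sdiff, Finset.mem_sdiff, hM p hp, hN p hp]

/-! ### The product Gibbs measure of the coupled pairs -/

variable (K)

/-- The Gibbs weight of the coupled pairs of `M` in the field `h`, without horizontal
interaction. -/
noncomputable def gibbs (h : Site → ℝ) (M : Finset Site) (σ : Config) : ℝ :=
  ∏ p ∈ K.lowSites M, pairWeight K.ε (h p) (h (up p)) (σ p) (σ (up p))

theorem gibbs_pos (h : Site → ℝ) (M : Finset Site) (σ : Config) : 0 < K.gibbs h M σ :=
  Finset.prod_pos fun _ _ => pairWeight_pos _ _ _ _ _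

theorem gibbs_eq_exp (h : Site → ℝ) {M : Finset Site} (hM : K.PairClosed M) (σ : Config) :
    K.gibbs h M σ = Real.exp (∑ p ∈ M, h p * spinVal σ p
      + K.ε * ∑ p ∈ K.lowSites M, spinVal σ p * spinVal σ (up p)
      - ∑ p ∈ K.lowSites M, pressure K.ε (h p, h (up p))) := by
  rw [hM.sum_eq, Finset.mul_sum, ← Finset.sum_add_distrib, ← Finset.sum_sub_distrib, Real.exp_sum]
  refine Finset.prod_congr rfl fun p _ => ?_
  unfold pairWeight spinVal
  congr 1
  ring

variable {K}

theorem localOn_pairWeight (x y : ℝ) (p : Site) :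
    LocalOn {p, up p} fun σ => pairWeight K.ε x y (σ p) (σ (up p)) := by
  intro σ σ' h
  dsimp only
  rw [h p (by simp), h (up p) (by simp)]

theorem spinSum_gibbs (h : Site → ℝ) {M : Finset Site} (hM : K.PairClosed M) (σ : Config) :
    spinSum M σ (K.gibbs h M) = 1 := by
  conv_lhs => rw [hM.eq_biUnion]
  have e : K.gibbs h ((K.lowSites M).biUnion fun p => {p, up p}) = fun σ' =>
      ∏ p ∈ K.lowSites M, pairWeight K.ε (h p) (h (up p)) (σ' p) (σ' (up p)) := by
    rw [← hM.eq_biUnion]; rfl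
  rw [e, spinSum_biUnion _ _ lowSites_disjoint
    (fun p σ' => pairWeight K.ε (h p) (h (up p)) (σ' p) (σ' (up p)))
    fun p _ => localOn_pairWeight _ _ p]
  refine Finset.prod_eq_one fun p _ => ?_
  rw [spinSum_pair (up_ne p) σ (fun s t => pairWeight K.ε (h p) (h (up p)) s t), sum_pairWeight]

/-- Distinct columns are uncorrelated. -/
theorem spinSum_gibbs_cov {m : ℝ} (hz : diagSlope (Real.exp (-2 * K.ε)) (2 * m) = 0)
    {M : Finset Site} (hM : K.PairClosed M) (σ : Config) {p q : Site} (hp : p ∈ M) (hq : q ∈ M)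
    (hpq : p.1 ≠ q.1) :
    spinSum M σ (fun σ' => K.gibbs (fun _ => m) M σ' *
      ((spinVal σ' p - m) * (spinVal σ' q - m))) = 0 := by
  have hne : K.lowRep p ≠ K.lowRep q := fun h => hpq (congrArg (fun r : Site => r.1) h :)
  have hpl : K.lowRep p ∈ K.lowSites M := K.mem_lowSites.2 ⟨hM.lowRep_mem.2 hp, K.isLow_lowRep p⟩
  have hql : K.lowRep q ∈ K.lowSites M := K.mem_lowSites.2 ⟨hM.lowRep_mem.2 hq, K.isLow_lowRep q⟩
  have hmem : ∀ r, r ∈ ({K.lowRep r, up (K.lowRep r)} : Finset Site) := fun r => by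
    rw [Finset.mem_insert, Finset.mem_singleton]; exact K.eq_lowRep_or r
  -- Sites in distinct columns belong to distinct pairs. The expectation factorizes over pairs, and
  -- the factor of the pair of `p` is the centred mean, zero by the mean field equation.
  set F : Site → Config → ℝ := fun r σ' => pairWeight K.ε m m (σ' r) (σ' (up r)) *
    ((if K.lowRep p = r then spinVal σ' p - m else 1) *
      (if K.lowRep q = r then spinVal σ' q - m else 1)) with hF
  have hloc : ∀ r ∈ K.lowSites M, LocalOn {r, up r} (F r) := by
    intro r _ σ₁ σ₂ h
    have h1 := h r (by simp)
    have h2 := h (up r) (by simp)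
    have h3 : K.lowRep p = r → spinVal σ₁ p = spinVal σ₂ p := fun e => by
      unfold spinVal; rw [h p (by rw [← e]; exact hmem p)]
    have h4 : K.lowRep q = r → spinVal σ₁ q = spinVal σ₂ q := fun e => by
      unfold spinVal; rw [h q (by rw [← e]; exact hmem q)]
    simp only [hF, h1, h2]
    congr 2
    · split_ifs with e
      · rw [h3 e]
      · rfl
    · split_ifs with e
      · rw [h4 e]
      · rfl
  have e : (fun σ' => K.gibbs (fun _ => m) M σ' * ((spinVal σ' p - m) * (spinVal σ' q - m))) =
      fun σ' => ∏ r ∈ K.lowSites M, F r σ' := by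
    funext σ'
    rw [hF, Finset.prod_mul_distrib, Finset.prod_mul_distrib, Finset.prod_ite_eq,
      Finset.prod_ite_eq, if_pos hpl, if_pos hql, gibbs]
  have hprod := spinSum_biUnion (K.lowSites M) (fun p => {p, up p}) lowSites_disjoint F hloc σ
  rw [← hM.eq_biUnion] at hprod
  rw [e, hprod]
  refine Finset.prod_eq_zero hpl ?_
  have h1 := sum_pairWeight_fst hz
  simp only [← Finset.sum_mul] at h1
  have h0 := sum_pairWeight K.ε m m
  have e1 : F (K.lowRep p) = fun σ' => pairWeight K.ε m m (σ' (K.lowRep p))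
      (σ' (up (K.lowRep p))) * (spinVal σ' p - m) := by
    funext σ'
    simp only [hF, if_true]
    rw [if_neg hne.symm, mul_one]
  rw [e1]
  rcases K.eq_lowRep_or p with h | h
  · have := spinSum_pair (up_ne (K.lowRep p)) σ
      (fun s t => pairWeight K.ε m m s t * (((s : ℤ) : ℝ) - m))
    unfold spinVal
    rw [← h] at this ⊢
    rw [this]
    simp only [mul_sub, Finset.sum_sub_distrib, ← Finset.sum_mul]
    rw [h0, h1]; ring
  · have := spinSum_pair (up_ne (K.lowRep p)) σ
      (fun s t => pairWeight K.ε m m s t * (((t : ℤ) : ℝ) - m))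
    have e2 : ∀ σ' : Config, spinVal σ' p = ((σ' (up (K.lowRep p)) : ℤ) : ℝ) := fun σ' => by
      unfold spinVal; rw [← h]
    simp only [e2]
    rw [this, Finset.sum_comm]
    simp only [pairWeight_swap K.ε m, mul_sub, Finset.sum_sub_distrib, ← Finset.sum_mul]
    rw [h0, h1]; ring

end KacModel


/-! ### Pairs of blocks: counting profiles and the law of large numbers -/

namespace KacModel

variable (K : KacModel)

theorem blockLen_dvd_ellPlus : K.blockLen ∣ K.ellPlus :=
  K.blockLen_dvd_tileLen.trans K.tileLen_dvd_ellPlus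

theorem isLow_congr {p q : Site} (h2 : q.2 = p.2)
    (h1 : q.1 / (K.blockLen : ℤ) = p.1 / (K.blockLen : ℤ)) : K.IsLow q ↔ K.IsLow p := by
  unfold IsLow
  rw [h2, ediv_eq_of_dvd K.blockLen_dvd_ellPlus h1]

/-- The lower left corner of the pair of blocks containing `p`. -/
def corner (p : Site) : Site := (p.1 / (K.blockLen : ℤ) * K.blockLen, K.lowRow p)

theorem corner_fst_ediv (p : Site) :
    (K.corner p).1 / (K.blockLen : ℤ) = p.1 / (K.blockLen : ℤ) := by
  have : (K.blockLen : ℤ) ≠ 0 := by exact_mod_cast K.blockLen_pos.ne'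
  exact Int.mul_ediv_cancel _ this

theorem corner_congr {p q : Site} (h2 : q.2 = p.2)
    (h1 : q.1 / (K.blockLen : ℤ) = p.1 / (K.blockLen : ℤ)) : K.corner q = K.corner p := by
  have := K.isLow_congr h2 h1
  simp only [corner, lowRow, this, h1, h2]

theorem corner_up {p : Site} (h : K.IsLow p) : K.corner (up p) = K.corner p := by
  have h1 : K.lowRow (up p) = p.2 := congrArg Prod.snd (K.lowRep_up h)
  have h2 : K.lowRow p = p.2 := congrArg Prod.snd (K.lowRep_of_isLow h)
  rw [corner, corner, h1, h2]
  rfl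

theorem isLow_corner (p : Site) : K.IsLow (K.corner p) :=
  (K.isLow_congr (q := K.corner p) (p := K.lowRep p) rfl (K.corner_fst_ediv p)).2 (K.isLow_lowRep p)

theorem corner_corner (p : Site) : K.corner (K.corner p) = K.corner p := by
  have h : K.corner (K.corner p) = K.corner (K.lowRep p) :=
    K.corner_congr rfl (K.corner_fst_ediv p)
  rw [h]
  rcases K.eq_lowRep_or p with h | h
  · rw [← h]
  · conv_rhs => rw [h]
    rw [K.corner_up (K.isLow_lowRep p)]

/-- The part of `M` with corner `c`. -/
noncomputable def piece (M : Finset Site) (c : Site) : Finset Site := M.filter fun p => K.corner p = c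

/-- The corners of the pairs of blocks in `M`. -/
noncomputable def corners (M : Finset Site) : Finset Site := M.image K.corner

variable {K} {M : Finset Site}

theorem biUnion_piece (M : Finset Site) : (K.corners M).biUnion (K.piece M) = M := by
  ext p
  simp only [Finset.mem_biUnion, piece, Finset.mem_filter, corners, Finset.mem_image]
  constructor
  · rintro ⟨_, _, h, _⟩; exact h
  · exact fun h => ⟨K.corner p, ⟨p, h, rfl⟩, h, rfl⟩

theorem piece_disjoint : ∀ c ∈ K.corners M, ∀ d ∈ K.corners M, c ≠ d →
    Disjoint (K.piece M c) (K.piece M d) := by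
  intro c _ d _ hcd
  rw [Finset.disjoint_left]
  intro p hp hp'
  exact hcd ((Finset.mem_filter.1 hp).2.symm.trans (Finset.mem_filter.1 hp').2)

theorem PairClosed.piece (hM : K.PairClosed M) (c : Site) : K.PairClosed (K.piece M c) := by
  intro p hp
  unfold KacModel.piece
  rw [Finset.mem_filter, Finset.mem_filter, hM p hp, K.corner_up hp]

theorem blockClosed_piece (hM : BlockClosed K.blockLen M) (c : Site) :
    BlockClosed K.blockLen (K.piece M c) := by
  intro p q h2 h1 hp
  unfold piece at hp ⊢
  rw [Finset.mem_filter] at hp ⊢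
  exact ⟨hM p q h2 h1 hp.1, (K.corner_congr h2 h1).trans hp.2⟩

theorem corner_mem (hM : K.PairClosed M) (hB : BlockClosed K.blockLen M) {c : Site}
    (hc : c ∈ K.corners M) : c ∈ M ∧ K.IsLow c ∧ K.corner c = c := by
  obtain ⟨p, hp, rfl⟩ := Finset.mem_image.1 hc
  refine ⟨?_, K.isLow_corner p, K.corner_corner p⟩
  exact hB (K.lowRep p) _ rfl (K.corner_fst_ediv p) (hM.lowRep_mem.2 hp)

theorem lowSites_piece (hM : K.PairClosed M) (hB : BlockClosed K.blockLen M) {c : Site}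
    (hc : c ∈ K.corners M) : K.lowSites (K.piece M c) = blockOf K.blockLen c := by
  obtain ⟨hcM, hcl, hcc⟩ := corner_mem hM hB hc
  ext p
  rw [mem_lowSites, piece, Finset.mem_filter, mem_blockOf K.blockLen_pos]
  constructor
  · rintro ⟨⟨hp, rfl⟩, hl⟩
    exact ⟨(congrArg Prod.snd (K.lowRep_of_isLow hl)).symm, (K.corner_fst_ediv p).symm⟩
  · rintro ⟨h2, h1⟩
    exact ⟨⟨hB c p h2 h1 hcM, (K.corner_congr h2 h1).trans hcc⟩, (K.isLow_congr h2 h1).2 hcl⟩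

theorem card_piece (hM : K.PairClosed M) (hB : BlockClosed K.blockLen M) {c : Site}
    (hc : c ∈ K.corners M) : (K.piece M c).card = 2 * K.blockLen := by
  have h := (hM.piece c).sum_eq fun _ => (1 : ℝ)
  rw [lowSites_piece hM hB hc, Finset.sum_const, Finset.sum_const, card_blockOf] at h
  simp only [nsmul_eq_mul, mul_one] at h
  have : ((K.piece M c).card : ℝ) = ((2 * K.blockLen : ℕ) : ℝ) := by rw [h]; push_cast; ring
  exact_mod_cast this

theorem card_corners (hM : K.PairClosed M) (hB : BlockClosed K.blockLen M) :
    M.card = (K.corners M).card * (2 * K.blockLen) := by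
  conv_lhs => rw [← biUnion_piece (K := K) M]
  rw [Finset.card_biUnion fun c hc d hd h => piece_disjoint c hc d hd h,
    Finset.sum_congr rfl fun c hc => card_piece hM hB hc, Finset.sum_const, smul_eq_mul]

theorem gibbs_eq_prod (h : Site → ℝ) (M : Finset Site) (σ : Config) :
    K.gibbs h M σ = ∏ c ∈ K.corners M, K.gibbs h (K.piece M c) σ := by
  unfold gibbs
  rw [← Finset.prod_fiberwise_of_maps_to (s := K.lowSites M) (t := K.corners M) (g := K.corner)
    fun p hp => Finset.mem_image_of_mem _ (K.mem_lowSites.1 hp).1]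
  refine Finset.prod_congr rfl fun c _ => Finset.prod_congr ?_ fun _ _ => rfl
  ext p
  rw [Finset.mem_filter, mem_lowSites, mem_lowSites, piece, Finset.mem_filter]
  tauto

theorem gibbs_congr {h h' : Site → ℝ} {P : Finset Site} (hP : K.PairClosed P) {σ σ' : Config}
    (hh : ∀ p ∈ P, h p = h' p) (hσ : ∀ p ∈ P, σ p = σ' p) : K.gibbs h P σ = K.gibbs h' P σ' := by
  refine Finset.prod_congr rfl fun p hp => ?_
  rw [K.mem_lowSites] at hp
  have hu := (hP p hp.2).1 hp.1
  rw [hh p hp.1, hh _ hu, hσ p hp.1, hσ _ hu]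

theorem blockAvg_local {ℓ : ℕ} (hℓ : 0 < ℓ) {P : Finset Site} (hB : BlockClosed ℓ P)
    {σ σ' : Config} (hσ : ∀ p ∈ P, σ p = σ' p) {p : Site} (hp : p ∈ P) :
    blockAvg ℓ (spinVal σ) p = blockAvg ℓ (spinVal σ') p :=
  blockAvg_congr fun q hq => by unfold spinVal; rw [hσ q (hB.blockOf_subset hℓ hp hq)]

theorem abs_blockAvg_spin_le (σ : Config) (p : Site) :
    |blockAvg K.blockLen (spinVal σ) p| ≤ 1 :=
  abs_blockAvg_le K.blockLen_pos fun q _ => (abs_spinVal σ q).le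

/-- The possible values of the block averages. -/
noncomputable def avgValues (ℓ : ℕ) : Finset ℝ :=
  (Finset.range (ℓ + 1)).image fun k : ℕ => (1 / (ℓ : ℝ)) * (2 * k - ℓ)

theorem card_avgValues_le (ℓ : ℕ) : (avgValues ℓ).card ≤ ℓ + 1 :=
  Finset.card_image_le.trans (by simp)

theorem blockAvg_mem_avgValues (ℓ : ℕ) (σ : Config) (p : Site) :
    blockAvg ℓ (spinVal σ) p ∈ avgValues ℓ := by
  set B := blockOf ℓ p
  refine Finset.mem_image.2 ⟨(B.filter fun q => σ q = 1).card, ?_, ?_⟩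
  · rw [Finset.mem_range, Nat.lt_succ_iff]
    exact (Finset.card_filter_le _ _).trans (card_blockOf ℓ p).le
  · unfold blockAvg
    congr 1
    have h1 : ∀ q, spinVal σ q = 2 * (if σ q = 1 then 1 else 0) - 1 := fun q => by
      unfold spinVal
      rcases Int.units_eq_one_or (σ q) with h | h
      · simp [h]; norm_num
      · rw [h, if_neg (by decide)]; simp
    rw [Finset.sum_congr rfl fun q _ => h1 q, Finset.sum_sub_distrib, ← Finset.mul_sum,
      Finset.sum_boole, Finset.sum_const, card_blockOf]
    simp [B]

/-- Tilting by the actual block averages costs only their number. -/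
theorem spinSum_gibbs_blockAvg_le (hM : K.PairClosed M) (hB : BlockClosed K.blockLen M)
    (σ : Config) : spinSum M σ (fun σ' => K.gibbs (blockAvg K.blockLen (spinVal σ')) M σ') ≤
      (((K.blockLen : ℝ) + 1) ^ 2) ^ (K.corners M).card := by
  have hl := K.blockLen_pos
  set F : Site → Config → ℝ := fun c σ' =>
    K.gibbs (blockAvg K.blockLen (spinVal σ')) (K.piece M c) σ' with hF
  have hloc : ∀ c ∈ K.corners M, LocalOn (K.piece M c) (F c) := fun c _ σ₁ σ₂ h =>
    gibbs_congr (hM.piece c) (fun p hp => blockAvg_local hl (blockClosed_piece hB c) h hp) h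
  have hprod := spinSum_biUnion (K.corners M) (K.piece M) piece_disjoint F hloc σ
  rw [biUnion_piece] at hprod
  have e : (fun σ' => K.gibbs (blockAvg K.blockLen (spinVal σ')) M σ') =
      fun σ' => ∏ c ∈ K.corners M, F c σ' := funext fun σ' => gibbs_eq_prod _ M σ'
  rw [e, hprod]
  rw [← Finset.prod_const]
  refine Finset.prod_le_prod (fun c _ => spinSum_nonneg fun _ _ => (K.gibbs_pos _ _ _).le)
    fun c hc => ?_
  have hlow := lowSites_piece hM hB hc
  set P := K.piece M c
  set A := avgValues K.blockLen
  set fld : ℝ → ℝ → Site → ℝ := fun x y p => if K.IsLow p then x else y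
  -- The field depends on the configuration, so the weights do not sum to `1`. Summing instead over
  -- all possible values of the two averages gives one probability measure for each pair of values,
  -- and there are at most `(ℓ + 1) ^ 2` of them.
  have hle : ∀ σ', F c σ' ≤ ∑ x ∈ A, ∑ y ∈ A, K.gibbs (fld x y) P σ' := by
    intro σ'
    set x := blockAvg K.blockLen (spinVal σ') c
    set y := blockAvg K.blockLen (spinVal σ') (up c)
    have hx : x ∈ A := blockAvg_mem_avgValues _ _ _
    have hy : y ∈ A := blockAvg_mem_avgValues _ _ _
    have e1 : F c σ' = K.gibbs (fld x y) P σ' := by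
      refine Finset.prod_congr rfl fun p hp => ?_
      have hpl := (K.mem_lowSites.1 hp).2
      have hpl' : ¬K.IsLow (up p) := by rw [isLow_up]; simpa using hpl
      rw [hlow] at hp
      have hp2 : up p ∈ blockOf K.blockLen (up c) := by
        rw [mem_blockOf hl] at hp ⊢
        exact ⟨by simp [up, hp.1], hp.2⟩
      rw [blockAvg_eq hl _ hp, blockAvg_eq hl _ hp2]
      simp only [fld, hpl, hpl', if_true, if_false]
      rfl
    rw [e1]
    calc K.gibbs (fld x y) P σ' ≤ ∑ y ∈ A, K.gibbs (fld x y) P σ' :=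
          Finset.single_le_sum (f := fun y => K.gibbs (fld x y) P σ')
            (fun _ _ => (K.gibbs_pos _ _ _).le) hy
      _ ≤ _ := Finset.single_le_sum (f := fun x => ∑ y ∈ A, K.gibbs (fld x y) P σ')
            (fun _ _ => Finset.sum_nonneg fun _ _ => (K.gibbs_pos _ _ _).le) hx
  calc spinSum P σ (F c) ≤ spinSum P σ (fun σ' => ∑ x ∈ A, ∑ y ∈ A, K.gibbs (fld x y) P σ') :=
        spinSum_le fun σ' _ => hle σ'
    _ = (A.card : ℝ) ^ 2 := by
        rw [spinSum_sum]
        simp only [spinSum_sum, spinSum_gibbs _ (hM.piece c), P]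
        simp; ring
    _ ≤ _ := by
        have : (A.card : ℝ) ≤ K.blockLen + 1 := by exact_mod_cast card_avgValues_le _
        gcongr

open Classical in
/-- A law of large numbers: with probability at least one half per pair of blocks, all the block
averages are close to their mean. -/
theorem spinSum_gibbs_good_ge {m δ : ℝ} (hz : diagSlope (Real.exp (-2 * K.ε)) (2 * m) = 0)
    (hm : |m| ≤ 1) (hδ : 0 < δ) (hδL : 16 ≤ δ ^ 2 * K.blockLen)
    (hM : K.PairClosed M) (hB : BlockClosed K.blockLen M) (σ : Config) :
    (1 / 2 : ℝ) ^ (K.corners M).card ≤ spinSum M σ (fun σ' =>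
      if ∀ p ∈ M, |blockAvg K.blockLen (spinVal σ') p - m| ≤ δ
      then K.gibbs (fun _ => m) M σ' else 0) := by
  have hl := K.blockLen_pos
  have hl' : (0 : ℝ) < K.blockLen := by exact_mod_cast hl
  set F : Site → Config → ℝ := fun c σ' =>
    if ∀ p ∈ K.piece M c, |blockAvg K.blockLen (spinVal σ') p - m| ≤ δ
      then K.gibbs (fun _ => m) (K.piece M c) σ' else 0 with hF
  have hloc : ∀ c ∈ K.corners M, LocalOn (K.piece M c) (F c) := by
    intro c _ σ₁ σ₂ h
    have h1 : (∀ p ∈ K.piece M c, |blockAvg K.blockLen (spinVal σ₁) p - m| ≤ δ) ↔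
        ∀ p ∈ K.piece M c, |blockAvg K.blockLen (spinVal σ₂) p - m| ≤ δ :=
      forall₂_congr fun p hp => by rw [blockAvg_local hl (blockClosed_piece hB c) h hp]
    simp only [hF, h1, gibbs_congr (hM.piece c) (fun _ _ => rfl) h]
  have hprod := spinSum_biUnion (K.corners M) (K.piece M) piece_disjoint F hloc σ
  rw [biUnion_piece] at hprod
  have e : (fun σ' => if ∀ p ∈ M, |blockAvg K.blockLen (spinVal σ') p - m| ≤ δ
      then K.gibbs (fun _ => m) M σ' else 0) = fun σ' => ∏ c ∈ K.corners M, F c σ' := by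
    funext σ'
    split_ifs with h
    · rw [gibbs_eq_prod]
      refine Finset.prod_congr rfl fun c _ => ?_
      exact (if_pos fun p hp => h p (Finset.mem_filter.1 hp).1).symm
    · push Not at h
      obtain ⟨p, hp, hpd⟩ := h
      symm
      refine Finset.prod_eq_zero (Finset.mem_image_of_mem K.corner hp) (if_neg fun hall => ?_)
      exact absurd (hall p (Finset.mem_filter.2 ⟨hp, rfl⟩)) (not_le.2 hpd)
  rw [e, hprod]
  rw [← Finset.prod_const]
  refine Finset.prod_le_prod (fun _ _ => by norm_num) fun c hc => ?_
  have hlow := lowSites_piece hM hB hc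
  have hPP := hM.piece c
  have hPB := blockClosed_piece hB c
  obtain ⟨hcM, hcl, hcc⟩ := corner_mem hM hB hc
  have hcP : c ∈ K.piece M c := Finset.mem_filter.2 ⟨hcM, hcc⟩
  set P := K.piece M c
  have hucP : up c ∈ P := (hPP c hcl).1 hcP
  set dev : Site → Config → ℝ := fun r σ' => ∑ q ∈ blockOf K.blockLen r, (spinVal σ' q - m)
  -- The sites of a block lie in distinct columns, hence only the diagonal covariances survive, each
  -- at most `(1 + |m|) ^ 2 ≤ 4`.
  have hvar : ∀ r ∈ P, spinSum P σ (fun σ' => K.gibbs (fun _ => m) P σ' * dev r σ' ^ 2) ≤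
      4 * K.blockLen := by
    intro r hr
    have hsub : blockOf K.blockLen r ⊆ P := hPB.blockOf_subset hl hr
    have e1 : (fun σ' => K.gibbs (fun _ => m) P σ' * dev r σ' ^ 2) = fun σ' =>
        ∑ q ∈ blockOf K.blockLen r, ∑ q' ∈ blockOf K.blockLen r,
          K.gibbs (fun _ => m) P σ' * ((spinVal σ' q - m) * (spinVal σ' q' - m)) := by
      funext σ'
      simp only [dev]
      rw [sq, Finset.sum_mul_sum, Finset.mul_sum]
      exact Finset.sum_congr rfl fun q _ => Finset.mul_sum _ _ _
    rw [e1, spinSum_sum]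
    simp only [spinSum_sum]
    calc _ ≤ ∑ q ∈ blockOf K.blockLen r, (4 : ℝ) := by
          refine Finset.sum_le_sum fun q hq => ?_
          rw [Finset.sum_eq_single_of_mem q hq]
          · calc _ ≤ spinSum P σ (fun σ' => 4 * K.gibbs (fun _ => m) P σ') := by
                  refine spinSum_le fun σ' _ => ?_
                  have h1 := abs_le.1 (abs_spinVal σ' q).le
                  have h2 := abs_le.1 hm
                  have h3 : (spinVal σ' q - m) * (spinVal σ' q - m) ≤ 4 := by nlinarith
                  have := (K.gibbs_pos (fun _ => m) P σ').le
                  nlinarith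
              _ = 4 := by rw [spinSum_const_mul, spinSum_gibbs _ hPP, mul_one]
          · intro q' hq' hne
            refine spinSum_gibbs_cov hz hPP σ (hsub hq) (hsub hq') fun h => hne ?_
            rw [mem_blockOf hl] at hq hq'
            exact Prod.ext h.symm (hq'.1.trans hq.1.symm)
      _ = 4 * K.blockLen := by rw [Finset.sum_const, card_blockOf, nsmul_eq_mul]; ring
  have hrep : ∀ p ∈ P, p ∈ blockOf K.blockLen c ∨ p ∈ blockOf K.blockLen (up c) := by
    intro p hp
    have hlr : K.lowRep p ∈ K.lowSites P :=
      K.mem_lowSites.2 ⟨hPP.lowRep_mem.2 hp, K.isLow_lowRep p⟩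
    rw [hlow] at hlr
    rcases K.eq_lowRep_or p with h | h
    · exact Or.inl (h ▸ hlr)
    · right
      rw [mem_blockOf hl] at hlr ⊢
      rw [h]
      exact ⟨by simp [up, hlr.1], hlr.2⟩
  set D : ℝ := (K.blockLen * δ) ^ 2 with hD
  have hD0 : 0 < D := by positivity
  have hdev : ∀ r σ', blockAvg K.blockLen (spinVal σ') r - m = (1 / (K.blockLen : ℝ)) * dev r σ' := by
    intro r σ'
    simp only [dev, blockAvg]
    rw [Finset.sum_sub_distrib, Finset.sum_const, card_blockOf, nsmul_eq_mul]
    field_simp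
  have hlarge : ∀ r σ', δ < |blockAvg K.blockLen (spinVal σ') r - m| → D ≤ dev r σ' ^ 2 := by
    intro r σ' h
    rw [hdev, abs_mul, abs_of_pos (by positivity), one_div, inv_mul_eq_div, lt_div_iff₀ hl'] at h
    rw [hD, ← sq_abs (dev r σ')]
    have : (K.blockLen : ℝ) * δ ≤ |dev r σ'| := by linarith
    gcongr
  have hpt : ∀ σ', K.gibbs (fun _ => m) P σ' ≤ F c σ' + (1 / D) *
      (K.gibbs (fun _ => m) P σ' * dev c σ' ^ 2) + (1 / D) *
      (K.gibbs (fun _ => m) P σ' * dev (up c) σ' ^ 2) := by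
    intro σ'
    have hg := (K.gibbs_pos (fun _ => m) P σ').le
    by_cases h : ∀ p ∈ P, |blockAvg K.blockLen (spinVal σ') p - m| ≤ δ
    · have : F c σ' = K.gibbs (fun _ => m) P σ' := if_pos h
      rw [this]
      have h1 : 0 ≤ (1 / D) * (K.gibbs (fun _ => m) P σ' * dev c σ' ^ 2) := by positivity
      have h2 : 0 ≤ (1 / D) * (K.gibbs (fun _ => m) P σ' * dev (up c) σ' ^ 2) := by positivity
      linarith
    · have h0 : F c σ' = 0 := if_neg h
      push Not at h
      obtain ⟨p, hp, hpd⟩ := h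
      have key : ∀ r, D ≤ dev r σ' ^ 2 → K.gibbs (fun _ => m) P σ' ≤
          (1 / D) * (K.gibbs (fun _ => m) P σ' * dev r σ' ^ 2) := by
        intro r hr
        rw [one_div, inv_mul_eq_div, le_div_iff₀ hD0]
        gcongr
      have h1 : 0 ≤ (1 / D) * (K.gibbs (fun _ => m) P σ' * dev c σ' ^ 2) := by positivity
      have h2 : 0 ≤ (1 / D) * (K.gibbs (fun _ => m) P σ' * dev (up c) σ' ^ 2) := by positivity
      rw [h0]
      rcases hrep p hp with h | h
      · rw [blockAvg_eq hl _ h] at hpd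
        linarith [key c (hlarge c σ' hpd)]
      · rw [blockAvg_eq hl _ h] at hpd
        linarith [key (up c) (hlarge (up c) σ' hpd)]
  have hsum := spinSum_le (Λ := P) (σ := σ) fun σ' _ => hpt σ'
  have hadd : ∀ f g : Config → ℝ, spinSum P σ (fun σ' => f σ' + g σ') =
      spinSum P σ f + spinSum P σ g := fun f g => Finset.sum_add_distrib
  rw [hadd, hadd, spinSum_const_mul, spinSum_const_mul] at hsum
  have h1 := spinSum_gibbs (fun _ => m) hPP σ
  have h2 := hvar c hcP
  have h3 := hvar (up c) hucP
  -- Chebyshev's inequality: `4 / (δ ^ 2 ℓ) ≤ 1 / 4` by `hδL`. A piece consists of two blocks, so it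
  -- fails with probability at most `1 / 2`.
  have h4 : (1 / D) * (4 * K.blockLen) ≤ 1 / 4 := by
    rw [one_div, inv_mul_eq_div, div_le_iff₀ hD0, hD]
    nlinarith
  have h5 : (1 / D) * spinSum P σ (fun σ' => K.gibbs (fun _ => m) P σ' * dev c σ' ^ 2) ≤ 1 / 4 :=
    (mul_le_mul_of_nonneg_left h2 (by positivity)).trans h4
  have h6 : (1 / D) * spinSum P σ (fun σ' => K.gibbs (fun _ => m) P σ' * dev (up c) σ' ^ 2)
      ≤ 1 / 4 := (mul_le_mul_of_nonneg_left h3 (by positivity)).trans h4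
  have h7 : spinSum P σ (fun σ' => K.gibbs (fun _ => m) P σ') = 1 := h1
  change 1 / 2 ≤ spinSum P σ (fun σ' => F c σ')
  linarith

end KacModel


/-! ### Partition functions and the excess free energy -/

namespace KacModel

variable (K : KacModel)

/-- The excess free energy of the profile `u` in `M`, with respect to the pure phases `±m`. -/
noncomputable def excess (m : ℝ) (M : Finset Site) (u : Site → ℝ) : ℝ :=
  ∑ p ∈ K.lowSites M, (dualEnergy K.ε (u p) (u (up p)) - dualEnergy K.ε m m)
    + (1 / 4) * K.dirichlet M M u

/-- The profile of block averages. -/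
noncomputable def profile (σ : Config) : Site → ℝ := blockAvg K.blockLen (spinVal σ)

/-- The error per site in the comparison of partition functions with free energies. -/
noncomputable def errRate (C δ : ℝ) : ℝ :=
  -- In this order: the passage from spins to averages, made in an upper and in a lower bound; the
  -- tolerance `δ` of good profiles; the self-interaction; and, per pair of blocks of `2 ℓ` sites,
  -- the number of profiles divided by the probability `1 / 2` of good ones.
  42 * C * K.γ * K.blockLen + 9 * δ + C * K.γ
    + Real.log (2 * ((K.blockLen : ℝ) + 1) ^ 2) / (2 * K.blockLen)

variable {K} {C c : ℝ} {k₀ : ℕ} {M U : Finset Site}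

theorem abs_profile_le (σ : Config) (p : Site) : |K.profile σ p| ≤ 1 := abs_blockAvg_spin_le σ p

namespace KernelBounds

variable (hK : K.KernelBounds C c k₀)
include hK

theorem sum_siteKer_le_two (hCγ : C * K.γ ≤ 1) (p : Site) (T : Finset Site) :
    ∑ q ∈ T, K.siteKer p q ≤ 2 := by
  have := hK.sum_siteKer_le p T
  have := hK.upper 0 0
  linarith

theorem dirichlet_nonneg (M T : Finset Site) (u : Site → ℝ) : 0 ≤ K.dirichlet M T u :=
  Finset.sum_nonneg fun p _ => Finset.sum_nonneg fun q _ =>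
    mul_nonneg (hK.siteKer_nonneg p q) (sq_nonneg _)

/-- The horizontal energy, in terms of the profile. -/
theorem abs_bilin_sub_le (hC : 0 ≤ C) (hB : BlockClosed K.blockLen M)
    (hUB : BlockClosed K.blockLen U) (σ : Config) :
    |(-(1 / 2) * K.bilin M M (spinVal σ) - K.bilin M (U \ M) (spinVal σ)) -
      (-(1 / 2) * K.bilin M M (K.profile σ) - K.bilin M (U \ M) (K.profile σ))| ≤
      21 * C * K.γ * K.blockLen * M.card := by
  have hL : K.blockLen ≤ 2 ^ K.scales.n := Nat.le_of_dvd K.tileLen_pos K.blockLen_dvd_tileLen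
  have hf : ∀ p, |spinVal σ p| ≤ 1 := fun p => (abs_spinVal σ p).le
  have h1 := abs_le.1 (hK.bilin_sub_blockAvg_le hC hL hB hB hf)
  have h2 := abs_le.1 (hK.bilin_sub_blockAvg_le hC hL hB (hUB.sdiff hB) hf)
  unfold profile
  rw [abs_le]
  constructor <;> linarith [h1.1, h1.2, h2.1, h2.2]

/-- By `sum_blockAvg_sq`, `∑ u ^ 2 / 2 = ∑ u σ - ∑ u ^ 2 / 2`. The linear term with the vertical
coupling, normalized by the pressure, is the logarithm of `gibbs` in the field `u`; the remaining
`pressure - u ^ 2 / 2` is `-dualEnergy`. The Dirichlet form across the boundary only helps and is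
dropped. -/
theorem energy_lower (hC : 0 ≤ C) (hM : K.PairClosed M) (hB : BlockClosed K.blockLen M)
    (hUB : BlockClosed K.blockLen U) (hU : K.RangeIn M U) (m : ℝ) (σ : Config) :
    -K.energy M σ ≤ Real.log (K.gibbs (K.profile σ) M σ) - K.excess m M (K.profile σ)
      - (K.lowSites M).card * dualEnergy K.ε m m
      + (1 / 2) * ∑ p ∈ M, ∑ q ∈ U \ M, K.siteKer p q * K.profile σ q ^ 2
      + 21 * C * K.γ * K.blockLen * M.card := by
  set u := K.profile σ with hu
  have h1 := (abs_le.1 (hK.abs_bilin_sub_le hC hB hUB σ)).1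
  have h2 := hK.bilin_eq_dirichlet hU u
  have h3 := hK.energy_eq hM hU σ
  have h4 : ∑ p ∈ M, u p ^ 2 = ∑ p ∈ M, u p * spinVal σ p := by
    rw [hu, profile, sum_blockAvg_sq K.blockLen_pos hB]
    exact Finset.sum_congr rfl fun p _ => mul_comm _ _
  have h5 : ∑ p ∈ M, u p ^ 2 ≤ M.card := by
    calc _ ≤ ∑ p ∈ M, (1 : ℝ) := Finset.sum_le_sum fun p _ => by
          have := abs_le.1 (abs_profile_le (K := K) σ p)
          nlinarith
      _ = _ := by simp
  have h6 : ∑ p ∈ M, u p ^ 2 = ∑ p ∈ K.lowSites M, (u p ^ 2 + u (up p) ^ 2) := hM.sum_eq _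
  have h7 : ∑ p ∈ K.lowSites M, (dualEnergy K.ε (u p) (u (up p)) - dualEnergy K.ε m m) =
      (1 / 2) * ∑ p ∈ M, u p ^ 2 - ∑ p ∈ K.lowSites M, pressure K.ε (u p, u (up p))
        - (K.lowSites M).card * dualEnergy K.ε m m := by
    rw [h6, Finset.sum_sub_distrib, Finset.sum_const, nsmul_eq_mul, Finset.mul_sum,
      ← Finset.sum_sub_distrib]
    congr 1
    exact Finset.sum_congr rfl fun p _ => by unfold dualEnergy; ring
  have hk0 := hK.nonneg 0 0
  have h8 : K.kac 0 0 * ∑ p ∈ M, u p ^ 2 ≤ K.kac 0 0 * M.card :=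
    mul_le_mul_of_nonneg_left h5 hk0
  have h9 := hK.dirichlet_nonneg M (U \ M) u
  rw [K.gibbs_eq_exp u hM σ, Real.log_exp, ← h4, excess, h7, h3]
  rw [← hu] at h1
  linarith

/-- The converse for profiles close to `m`. The interaction with the outside cannot be dropped here,
and it remains as the cost of the jump from `m` to the outer profile. The term `9 δ` is the sum of
`δ + δ` from the quadratic and linear terms, `2 δ` from the inner Dirichlet form and `5 δ` from the
outer one. -/
theorem energy_upper (hC : 0 ≤ C) (hCγ : C * K.γ ≤ 1) (hM : K.PairClosed M)
    (hB : BlockClosed K.blockLen M) (hUB : BlockClosed K.blockLen U) (hU : K.RangeIn M U)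
    {m δ : ℝ} (hm : |m| ≤ 1) (hδ : 0 ≤ δ) (hδ1 : δ ≤ 1) {σ : Config}
    (hgood : ∀ p ∈ M, |K.profile σ p - m| ≤ δ) :
    Real.log (K.gibbs (fun _ => m) M σ)
      - (K.lowSites M).card * dualEnergy K.ε m m
      - (1 / 2) * ∑ p ∈ M, ∑ q ∈ U \ M, K.siteKer p q * (m - K.profile σ q) ^ 2
      + (1 / 2) * ∑ p ∈ M, ∑ q ∈ U \ M, K.siteKer p q * K.profile σ q ^ 2
      - 21 * C * K.γ * K.blockLen * M.card - (9 * δ + C * K.γ) * M.card ≤ -K.energy M σ := by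
  set u := K.profile σ with hu
  have h1 := (abs_le.1 (hK.abs_bilin_sub_le hC hB hUB σ)).2
  have h2 := hK.bilin_eq_dirichlet hU u
  have h3 := hK.energy_eq hM hU σ
  have hua : ∀ p, |u p| ≤ 1 := fun p => abs_profile_le σ p
  have hm' := abs_le.1 hm
  have hγ := K.gamma_pos
  have h4 : ∑ p ∈ M, u p = ∑ p ∈ M, spinVal σ p := sum_blockAvg K.blockLen_pos hB _
  have h5 : (1 / 2) * (m ^ 2 * M.card) - δ * M.card ≤ (1 / 2) * ∑ p ∈ M, u p ^ 2 := by
    rw [Finset.mul_sum]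
    calc (1 / 2) * (m ^ 2 * M.card) - δ * M.card = ∑ p ∈ M, ((1 / 2) * m ^ 2 - δ) := by
          rw [Finset.sum_const, nsmul_eq_mul]; ring
      _ ≤ _ := Finset.sum_le_sum fun p hp => by
          have h := abs_le.1 (hgood p hp)
          have h' := abs_le.1 (hua p)
          nlinarith
  have h6 : m * ∑ p ∈ M, spinVal σ p ≤ m ^ 2 * M.card + δ * M.card := by
    rw [← h4, Finset.mul_sum]
    calc _ ≤ ∑ p ∈ M, (m ^ 2 + δ) := Finset.sum_le_sum fun p hp => by
          have h := abs_le.1 (hgood p hp)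
          nlinarith
      _ = _ := by rw [Finset.sum_const, nsmul_eq_mul]; ring
  have h7 : (M.card : ℝ) = 2 * (K.lowSites M).card := by
    have := hM.sum_eq fun _ => (1 : ℝ)
    simp only [Finset.sum_const, nsmul_eq_mul, mul_one] at this
    rw [this]; ring
  have h8 : K.dirichlet M M u ≤ 8 * δ * M.card := by
    calc K.dirichlet M M u ≤ ∑ p ∈ M, ∑ q ∈ M, K.siteKer p q * (4 * δ) := by
          refine Finset.sum_le_sum fun p hp => Finset.sum_le_sum fun q hq => ?_
          refine mul_le_mul_of_nonneg_left ?_ (hK.siteKer_nonneg p q)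
          have h := abs_le.1 (hgood p hp)
          have h' := abs_le.1 (hgood q hq)
          nlinarith
      _ ≤ ∑ p ∈ M, 2 * (4 * δ) := by
          refine Finset.sum_le_sum fun p _ => ?_
          rw [← Finset.sum_mul]
          exact mul_le_mul_of_nonneg_right (hK.sum_siteKer_le_two hCγ p M) (by positivity)
      _ = _ := by rw [Finset.sum_const, nsmul_eq_mul]; ring
  have h9 : K.dirichlet M (U \ M) u ≤
      ∑ p ∈ M, ∑ q ∈ U \ M, K.siteKer p q * (m - u q) ^ 2 + 10 * δ * M.card := by
    calc K.dirichlet M (U \ M) u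
        ≤ ∑ p ∈ M, ∑ q ∈ U \ M, (K.siteKer p q * (m - u q) ^ 2 + K.siteKer p q * (5 * δ)) := by
          refine Finset.sum_le_sum fun p hp => Finset.sum_le_sum fun q hq => ?_
          rw [← mul_add]
          refine mul_le_mul_of_nonneg_left ?_ (hK.siteKer_nonneg p q)
          have h := abs_le.1 (hgood p hp)
          have h' := abs_le.1 (hua q)
          nlinarith
      _ = ∑ p ∈ M, ∑ q ∈ U \ M, K.siteKer p q * (m - u q) ^ 2
          + ∑ p ∈ M, (∑ q ∈ U \ M, K.siteKer p q) * (5 * δ) := by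
          simp only [Finset.sum_add_distrib, Finset.sum_mul]
      _ ≤ ∑ p ∈ M, ∑ q ∈ U \ M, K.siteKer p q * (m - u q) ^ 2 + ∑ p ∈ M, 2 * (5 * δ) := by
          gcongr
          exact hK.sum_siteKer_le_two hCγ _ _
      _ = _ := by rw [Finset.sum_const, nsmul_eq_mul]; ring
  have h10 : K.kac 0 0 * M.card ≤ C * K.γ * M.card :=
    mul_le_mul_of_nonneg_right (hK.upper 0 0) (by positivity)
  have h10' : 0 ≤ K.kac 0 0 * M.card := mul_nonneg (hK.nonneg 0 0) (by positivity)
  have h11 : 0 ≤ K.kac 0 0 * ∑ p ∈ M, u p ^ 2 :=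
    mul_nonneg (hK.nonneg 0 0) (Finset.sum_nonneg fun _ _ => sq_nonneg _)
  rw [K.gibbs_eq_exp _ hM σ, Real.log_exp, ← Finset.mul_sum, Finset.sum_const, nsmul_eq_mul, h3]
  rw [← hu] at h1
  have h12 : ((K.lowSites M).card : ℝ) * dualEnergy K.ε m m = (1 / 2) * (m ^ 2 * M.card)
      - (K.lowSites M).card * pressure K.ε (m, m) := by
    rw [h7, dualEnergy]; ring
  have h13 : 0 ≤ C * K.γ * M.card := by positivity
  linarith

open Classical in
/-- The comparison of two partition functions in `M`. -/
theorem spinSum_le_of_excess (hC : 0 ≤ C) (hCγ : C * K.γ ≤ 1) (hM : K.PairClosed M)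
    (hB : BlockClosed K.blockLen M) (hUB : BlockClosed K.blockLen U) (hU : K.RangeIn M U)
    {m δ : ℝ} (hz : diagSlope (Real.exp (-2 * K.ε)) (2 * m) = 0) (hm : |m| ≤ 1) (hδ : 0 < δ)
    (hδ1 : δ ≤ 1) (hδL : 16 ≤ δ ^ 2 * K.blockLen) {ρ ρ' : Config}
    (hbd : ∑ p ∈ M, ∑ q ∈ U \ M, K.siteKer p q * K.profile ρ q ^ 2 =
      ∑ p ∈ M, ∑ q ∈ U \ M, K.siteKer p q * K.profile ρ' q ^ 2)
    (valid : Config → Prop) {g : ℝ}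
    (hvalid : ∀ σ, (∀ p ∉ M, σ p = ρ p) → valid σ →
      g + (1 / 2) * ∑ p ∈ M, ∑ q ∈ U \ M, K.siteKer p q * (m - K.profile ρ' q) ^ 2 ≤
        K.excess m M (K.profile σ)) :
    spinSum M ρ (fun σ => if valid σ then Real.exp (-K.energy M σ) else 0) ≤
      Real.exp (-g + K.errRate C δ * M.card) * spinSum M ρ' (fun σ =>
        if ∀ p ∈ M, |K.profile σ p - m| ≤ δ then Real.exp (-K.energy M σ) else 0) := by
  have hl : (0 : ℝ) < K.blockLen := by exact_mod_cast K.blockLen_pos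
  -- The exponent common to both bounds: by `hbd` the squares outside `M` agree for the two boundary
  -- conditions, and by `hvalid` the excess on the left pays for the jump across the boundary on the
  -- right, with `g` to spare.
  set A := -((K.lowSites M).card * dualEnergy K.ε m m)
    - (1 / 2) * ∑ p ∈ M, ∑ q ∈ U \ M, K.siteKer p q * (m - K.profile ρ' q) ^ 2
    + (1 / 2) * ∑ p ∈ M, ∑ q ∈ U \ M, K.siteKer p q * K.profile ρ' q ^ 2 with hA
  set e₁ := 21 * C * K.γ * K.blockLen * M.card with he₁
  set n := (K.corners M).card with hn
  have hout : ∀ (ρ σ : Config), (∀ p ∉ M, σ p = ρ p) → ∀ q ∈ U \ M,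
      K.profile σ q = K.profile ρ q := fun ρ σ h q hq =>
    blockAvg_local K.blockLen_pos (hUB.sdiff hB) (fun r hr => h r (Finset.mem_sdiff.1 hr).2) hq
  have hup : spinSum M ρ (fun σ => if valid σ then Real.exp (-K.energy M σ) else 0) ≤
      Real.exp (A - g + e₁) * (((K.blockLen : ℝ) + 1) ^ 2) ^ n := by
    calc _ ≤ spinSum M ρ (fun σ => Real.exp (A - g + e₁) * K.gibbs (K.profile σ) M σ) := by
          refine spinSum_le fun σ hσ => ?_
          have hg := K.gibbs_pos (K.profile σ) M σ
          split_ifs with hv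
          · have h1 := hK.energy_lower hC hM hB hUB hU m σ
            have h2 := hvalid σ hσ hv
            have h3 : ∑ p ∈ M, ∑ q ∈ U \ M, K.siteKer p q * K.profile σ q ^ 2 =
                ∑ p ∈ M, ∑ q ∈ U \ M, K.siteKer p q * K.profile ρ' q ^ 2 := by
              rw [← hbd]
              exact Finset.sum_congr rfl fun p _ => Finset.sum_congr rfl fun q hq => by
                rw [hout ρ σ hσ q hq]
            rw [h3] at h1
            rw [← Real.exp_log hg, ← Real.exp_add]
            refine Real.exp_le_exp.2 ?_
            linarith
          · positivity
      _ = Real.exp (A - g + e₁) * spinSum M ρ (fun σ => K.gibbs (K.profile σ) M σ) :=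
          spinSum_const_mul _ _ _ _
      _ ≤ _ := by
          gcongr
          exact spinSum_gibbs_blockAvg_le hM hB ρ
  have hlow : Real.exp (A - e₁ - (9 * δ + C * K.γ) * M.card) * (1 / 2) ^ n ≤
      spinSum M ρ' (fun σ => if ∀ p ∈ M, |K.profile σ p - m| ≤ δ
        then Real.exp (-K.energy M σ) else 0) := by
    calc _ ≤ Real.exp (A - e₁ - (9 * δ + C * K.γ) * M.card) * spinSum M ρ' (fun σ =>
          if ∀ p ∈ M, |K.profile σ p - m| ≤ δ then K.gibbs (fun _ => m) M σ else 0) := by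
          gcongr
          exact spinSum_gibbs_good_ge hz hm hδ hδL hM hB ρ'
      _ = spinSum M ρ' (fun σ => Real.exp (A - e₁ - (9 * δ + C * K.γ) * M.card) *
          if ∀ p ∈ M, |K.profile σ p - m| ≤ δ then K.gibbs (fun _ => m) M σ else 0) :=
          (spinSum_const_mul _ _ _ _).symm
      _ ≤ _ := by
          refine spinSum_le fun σ hσ => ?_
          split_ifs with hgood
          · have h1 := hK.energy_upper hC hCγ hM hB hUB hU hm hδ.le hδ1 hgood
            have hg := K.gibbs_pos (fun _ => m) M σ
            have h3 : ∑ p ∈ M, ∑ q ∈ U \ M, K.siteKer p q * K.profile σ q ^ 2 =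
                ∑ p ∈ M, ∑ q ∈ U \ M, K.siteKer p q * K.profile ρ' q ^ 2 :=
              Finset.sum_congr rfl fun p _ => Finset.sum_congr rfl fun q hq => by
                rw [hout ρ' σ hσ q hq]
            have h4 : ∑ p ∈ M, ∑ q ∈ U \ M, K.siteKer p q * (m - K.profile σ q) ^ 2 =
                ∑ p ∈ M, ∑ q ∈ U \ M, K.siteKer p q * (m - K.profile ρ' q) ^ 2 :=
              Finset.sum_congr rfl fun p _ => Finset.sum_congr rfl fun q hq => by
                rw [hout ρ' σ hσ q hq]
            rw [h3, h4] at h1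
            rw [← Real.exp_log hg, ← Real.exp_add]
            refine Real.exp_le_exp.2 ?_
            linarith
          · simp
  refine hup.trans ?_
  calc Real.exp (A - g + e₁) * (((K.blockLen : ℝ) + 1) ^ 2) ^ n
      = Real.exp (-g + K.errRate C δ * M.card) *
        (Real.exp (A - e₁ - (9 * δ + C * K.γ) * M.card) * (1 / 2) ^ n) := by
        have hcard : (M.card : ℝ) = n * (2 * K.blockLen) := by
          exact_mod_cast card_corners hM hB
        have hb : (((K.blockLen : ℝ) + 1) ^ 2) ^ n = (1 / 2) ^ n *
            Real.exp (n * Real.log (2 * ((K.blockLen : ℝ) + 1) ^ 2)) := by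
          rw [Real.exp_nat_mul, Real.exp_log (by positivity), ← mul_pow]
          congr 1; ring
        have hlog : Real.log (2 * ((K.blockLen : ℝ) + 1) ^ 2) / (2 * K.blockLen) * M.card =
            n * Real.log (2 * ((K.blockLen : ℝ) + 1) ^ 2) := by
          rw [hcard]; field_simp
        rw [hb, mul_left_comm, ← Real.exp_add, ← mul_assoc, ← Real.exp_add, mul_comm]
        congr 2
        rw [errRate, add_mul, hlog, he₁]
        ring
    _ ≤ _ := by gcongr

end KernelBounds

end KacModel


/-! ### Constancy of a function along the boundary of a component -/

theorem exists_int_primitive {G : Type*} [AddCommGroup G] (g : ℤ → G) :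
    ∃ F : ℤ → G, ∀ x, F (x + 1) = F x + g x := by
  refine ⟨fun x => ∑ t ∈ Finset.Ico 0 x, g t - ∑ t ∈ Finset.Ico x 0, g t, fun x => ?_⟩
  rcases le_or_gt 0 x with h | h
  · have e1 : Finset.Ico 0 (x + 1) = insert x (Finset.Ico 0 x) := by
      ext t; simp only [Finset.mem_Ico, Finset.mem_insert]; omega
    have e2 : Finset.Ico (x + 1) 0 = ∅ := Finset.Ico_eq_empty (by omega)
    have e3 : Finset.Ico x 0 = ∅ := Finset.Ico_eq_empty (by omega)
    dsimp only
    rw [e1, e2, e3, Finset.sum_insert (by simp)]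
    simp [add_comm]
  · have e1 : Finset.Ico x 0 = insert x (Finset.Ico (x + 1) 0) := by
      ext t; simp only [Finset.mem_Ico, Finset.mem_insert]; omega
    have e2 : Finset.Ico 0 (x + 1) = ∅ := Finset.Ico_eq_empty (by omega)
    have e3 : Finset.Ico 0 x = ∅ := Finset.Ico_eq_empty (by omega)
    dsimp only
    rw [e1, e2, e3, Finset.sum_insert (by simp)]
    simp

/-- A symmetric function on the edges of the `*`-lattice, with values in `ZMod 2`, whose sum
vanishes on triangles, is a gradient. -/
theorem exists_potential (f : RectIdx → RectIdx → ZMod 2) (hsymm : ∀ x y, f x y = f y x)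
    (htri : ∀ x y z, starGraph.Adj x y → starGraph.Adj y z → starGraph.Adj x z →
      f x y + f y z = f x z) :
    ∃ F : RectIdx → ZMod 2, ∀ x y, starGraph.Adj x y → f x y = F x + F y := by
  have hadj : ∀ a b c d : ℤ, (a, b) ≠ (c, d) → |a - c| ≤ 1 → |b - d| ≤ 1 →
      starGraph.Adj (a, b) (c, d) := fun a b c d h1 h2 h3 => ⟨h1, h2, h3⟩
  obtain ⟨A, hA⟩ := exists_int_primitive fun x => f (x, 0) (x + 1, 0)
  have hV : ∀ x, ∃ V : ℤ → ZMod 2, ∀ y, V (y + 1) = V y + f (x, y) (x, y + 1) := fun x =>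
    exists_int_primitive _
  choose V hV using hV
  -- Integration along row `0` and then up the columns. The two triangles of each unit square carry
  -- the identity for horizontal edges from one row to the next; the diagonals follow from one more
  -- triangle.
  set F : RectIdx → ZMod 2 := fun q => A q.1 + V q.1 q.2 - V q.1 0 with hF
  have two : ∀ a : ZMod 2, a + a = 0 := by decide
  have hvert : ∀ x y, f (x, y) (x, y + 1) = F (x, y) + F (x, y + 1) := by
    intro x y
    simp only [hF, hV]
    have h1 := two (A x)
    have h2 := two (V x y)
    have h3 := two (V x 0)
    linear_combination -h1 - h2 + h3
  have hsq : ∀ x y, f (x, y) (x + 1, y) + f (x + 1, y) (x + 1, y + 1) =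
      f (x, y) (x, y + 1) + f (x, y + 1) (x + 1, y + 1) := by
    intro x y
    rw [htri _ _ (x + 1, y + 1) (hadj _ _ _ _ (by simp) (by simp) (by simp))
        (hadj _ _ _ _ (by simp) (by simp) (by simp)) (hadj _ _ _ _ (by simp) (by simp) (by simp)),
      htri _ _ (x + 1, y + 1) (hadj _ _ _ _ (by simp) (by simp) (by simp))
        (hadj _ _ _ _ (by simp) (by simp) (by simp)) (hadj _ _ _ _ (by simp) (by simp) (by simp))]
  have hstep : ∀ x y, f (x, y) (x + 1, y) = F (x, y) + F (x + 1, y) ↔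
      f (x, y + 1) (x + 1, y + 1) = F (x, y + 1) + F (x + 1, y + 1) := by
    intro x y
    have h1 := hsq x y
    rw [hvert x y, hvert (x + 1) y] at h1
    have key : ∀ a b c d e g : ZMod 2, a + (d + g) = c + e + b → (a = c + d ↔ b = e + g) := by
      decide
    exact key _ _ _ _ _ _ h1
  have hhor : ∀ x y, f (x, y) (x + 1, y) = F (x, y) + F (x + 1, y) := by
    intro x y
    induction y using Int.induction_on with
    | zero =>
      simp only [hF, hA]
      linear_combination -two (A x)
    | succ y ih => exact (hstep x y).1 ih
    | pred y ih =>
      rw [hstep]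
      simpa using ih
  have hne : ∀ x y, f (x, y) (x + 1, y + 1) = F (x, y) + F (x + 1, y + 1) := by
    intro x y
    rw [← htri (x, y) (x + 1, y) (x + 1, y + 1) (hadj _ _ _ _ (by simp) (by simp) (by simp))
        (hadj _ _ _ _ (by simp) (by simp) (by simp)) (hadj _ _ _ _ (by simp) (by simp) (by simp)),
      hhor, hvert]
    linear_combination two (F (x + 1, y))
  have hnw : ∀ x y, f (x + 1, y) (x, y + 1) = F (x + 1, y) + F (x, y + 1) := by
    intro x y
    rw [← htri (x + 1, y) (x, y) (x, y + 1) (hadj _ _ _ _ (by simp) (by simp) (by simp))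
        (hadj _ _ _ _ (by simp) (by simp) (by simp)) (hadj _ _ _ _ (by simp) (by simp) (by simp)),
      hsymm (x + 1, y) (x, y), hhor, hvert]
    linear_combination two (F (x, y))
  refine ⟨F, ?_⟩
  rintro ⟨a, b⟩ ⟨c, d⟩ ⟨h0, h1, h2⟩
  rw [abs_le] at h1 h2
  dsimp only at h1 h2
  have h1' : c = a - 1 ∨ c = a ∨ c = a + 1 := by omega
  have h2' : d = b - 1 ∨ d = b ∨ d = b + 1 := by omega
  rcases h1' with rfl | rfl | rfl <;> rcases h2' with rfl | rfl | rfl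
  · have := hne (a - 1) (b - 1)
    simp only [sub_add_cancel] at this
    rw [hsymm, this, add_comm]
  · have := hhor (a - 1) d
    simp only [sub_add_cancel] at this
    rw [hsymm, this, add_comm]
  · have := hnw (a - 1) b
    simpa only [sub_add_cancel] using this
  · have := hvert c (b - 1)
    simp only [sub_add_cancel] at this
    rw [hsymm, this, add_comm]
  · exact absurd rfl h0
  · exact hvert _ _
  · have := hnw a (b - 1)
    simp only [sub_add_cancel] at this
    rw [hsymm, this, add_comm]
  · exact hhor _ _
  · exact hne _ _

/-- A function which is constant along the edges of a connected set is constant. -/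
theorem eq_of_induce_connected {α : Type*} {A : Set RectIdx} (hA : (starGraph.induce A).Connected)
    {F : RectIdx → α} (hF : ∀ x ∈ A, ∀ y ∈ A, starGraph.Adj x y → F x = F y) {x y : RectIdx}
    (hx : x ∈ A) (hy : y ∈ A) : F x = F y := by
  obtain ⟨w⟩ := hA.preconnected ⟨x, hx⟩ ⟨y, hy⟩
  suffices h : ∀ {a b : A}, (starGraph.induce A).Walk a b → F a = F b from h w
  intro a b w
  induction w with
  | nil => rfl
  | cons h _ ih => exact (hF _ (Subtype.coe_prop _) _ (Subtype.coe_prop _) h).trans ih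

/-- A neighbour of a component in the ambient set belongs to the component. -/
theorem IsStarComponent.mem_of_adj {S B : Set RectIdx} (hB : IsStarComponent S B) {q q' : RectIdx}
    (hq : q ∈ B) (hq' : q' ∈ S) (hadj : starGraph.Adj q q') : q' ∈ B := by
  have hun : (starGraph.induce (B ∪ {q, q'})).Connected :=
    SimpleGraph.induce_union_connected hB.prop.2.preconnected
      (SimpleGraph.induce_pair_connected_of_adj hadj).preconnected ⟨q, hq, by simp⟩
  refine hB.le_of_ge ⟨?_, hun⟩ Set.subset_union_left (by simp)
  rintro r (hr | rfl | rfl)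
  · exact hB.prop.1 hr
  · exact hB.prop.1 hq
  · exact hq'

theorem exists_isStarComponent {S : Set RectIdx} {q : RectIdx} (hq : q ∈ S) :
    ∃ B, IsStarComponent S B ∧ q ∈ B := by
  set B : Set RectIdx := ⋃₀ {D | D ⊆ S ∧ (starGraph.induce D).Connected ∧ q ∈ D} with hBdef
  have hmem : ∀ D, D ⊆ S → (starGraph.induce D).Connected → q ∈ D → D ⊆ B :=
    fun D h1 h2 h3 => Set.subset_sUnion_of_mem ⟨h1, h2, h3⟩
  have hq1 : (starGraph.induce ({q} : Set RectIdx)).Connected := by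
    refine SimpleGraph.Connected.mk ?_
    rintro ⟨a, ha⟩ ⟨b, hb⟩
    obtain rfl : a = q := ha
    obtain rfl : b = a := hb
    exact SimpleGraph.Reachable.refl _
  have hqB : q ∈ B := hmem {q} (by simpa using hq) hq1 rfl rfl
  have hBS : B ⊆ S := Set.sUnion_subset fun D hD => hD.1
  have hBc : (starGraph.induce B).Connected := by
    have : Nonempty B := ⟨⟨q, hqB⟩⟩
    refine SimpleGraph.Connected.mk ?_
    have key : ∀ x : B, (starGraph.induce B).Reachable ⟨q, hqB⟩ x := by
      rintro ⟨x, D, hD, hx⟩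
      have hDB : D ⊆ B := hmem D hD.1 hD.2.1 hD.2.2
      have := hD.2.1.preconnected ⟨q, hD.2.2⟩ ⟨x, hx⟩
      exact this.map (SimpleGraph.induceHomOfLE starGraph hDB).toHom
    exact fun x y => (key x).symm.trans (key y)
  refine ⟨B, ⟨⟨hBS, hBc⟩, fun D hD hBD => hmem D hD.1 hD.2 (hBD hqB)⟩, hqB⟩

/-- A function on the outer boundary of `A` in a component `B` of its complement is constant if
it is constant along edges. -/
theorem eq_on_outBoundary {α : Type*} {A B : Set RectIdx} (hA : (starGraph.induce A).Connected)
    (hB : IsStarComponent Aᶜ B) {τ : RectIdx → α}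
    (hτ : ∀ x ∈ outBoundary A B, ∀ y ∈ outBoundary A B, starGraph.Adj x y → τ x = τ y)
    {x y : RectIdx} (hx : x ∈ outBoundary A B) (hy : y ∈ outBoundary A B) : τ x = τ y := by
  classical
  have hdisj : ∀ q, q ∈ A → q ∉ B := fun q h1 h2 => hB.prop.1 h2 h1
  -- The indicator of the edges between `A` and `B` whose end in `B` carries the value `τ x`. It
  -- sums to zero on triangles: a neighbour of `B` outside `A` is in `B`, and two adjacent vertices
  -- of `B` next to `A` have the same `τ`. So it is the gradient of some `F`, constant on `A` and on
  -- `B` since both are connected. Hence `f` takes the same value on all edges between `A` and `B`,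
  -- and this value is `1` at `x`.
  set f : RectIdx → RectIdx → ZMod 2 := fun p q =>
    if (p ∈ A ∧ q ∈ B ∧ τ q = τ x) ∨ (p ∈ B ∧ q ∈ A ∧ τ p = τ x) then 1 else 0 with hf
  have hsymm : ∀ p q, f p q = f q p := by
    intro p q
    simp only [hf]
    congr 1
    apply propext
    tauto
  have f0 : ∀ p q, (p ∈ A → q ∉ B) → (p ∈ B → q ∉ A) → f p q = 0 := by
    intro p q h1 h2
    refine if_neg ?_
    tauto
  have fAB : ∀ p q, p ∈ A → q ∈ B → f p q = if τ q = τ x then 1 else 0 := by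
    intro p q h1 h2
    simp only [hf]
    congr 1
    apply propext
    have := hdisj p h1
    tauto
  have htri : ∀ p q r, starGraph.Adj p q → starGraph.Adj q r → starGraph.Adj p r →
      f p q + f q r = f p r := by
    have two : ∀ a : ZMod 2, a + a = 0 := by decide
    have hout : ∀ p q, starGraph.Adj p q → p ∈ B → q ∉ A → q ∈ B := fun p q h hp hq =>
      hB.mem_of_adj hp hq h
    intro p q r hpq hqr hpr
    by_cases hpA : p ∈ A <;> by_cases hqA : q ∈ A <;> by_cases hrA : r ∈ A
    · rw [f0 p q (fun _ => hdisj q hqA) (fun h => absurd h (hdisj p hpA)),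
        f0 q r (fun _ => hdisj r hrA) (fun h => absurd h (hdisj q hqA)),
        f0 p r (fun _ => hdisj r hrA) (fun h => absurd h (hdisj p hpA)), add_zero]
    · rw [f0 p q (fun _ => hdisj q hqA) (fun h => absurd h (hdisj p hpA)), zero_add]
      by_cases hrB : r ∈ B
      · rw [fAB q r hqA hrB, fAB p r hpA hrB]
      · rw [f0 q r (fun _ => hrB) (fun _ => hrA), f0 p r (fun _ => hrB) (fun _ => hrA)]
    · rw [f0 p r (fun _ => hdisj r hrA) (fun h => absurd h (hdisj p hpA)), hsymm q r]
      by_cases hqB : q ∈ B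
      · rw [fAB p q hpA hqB, fAB r q hrA hqB, two]
      · rw [f0 p q (fun _ => hqB) (fun _ => hqA), f0 r q (fun _ => hqB) (fun _ => hqA), add_zero]
    · rw [f0 q r (fun h => absurd h hqA) (fun _ => hrA), add_zero]
      by_cases hqB : q ∈ B
      · have hrB := hout q r hqr hqB hrA
        rw [fAB p q hpA hqB, fAB p r hpA hrB,
          hτ q ⟨hqB, p, hpA, hpq.symm⟩ r ⟨hrB, p, hpA, hpr.symm⟩ hqr]
      · have hrB : r ∉ B := fun h => hqB (hout r q hqr.symm h hqA)
        rw [f0 p q (fun _ => hqB) (fun _ => hqA), f0 p r (fun _ => hrB) (fun _ => hrA)]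
    · rw [f0 q r (fun _ => hdisj r hrA) (fun h => absurd h (hdisj q hqA)), add_zero, hsymm p q,
        hsymm p r]
      by_cases hpB : p ∈ B
      · rw [fAB q p hqA hpB, fAB r p hrA hpB]
      · rw [f0 q p (fun _ => hpB) (fun _ => hpA), f0 r p (fun _ => hpB) (fun _ => hpA)]
    · rw [f0 p r (fun h => absurd h hpA) (fun _ => hrA), hsymm p q]
      by_cases hpB : p ∈ B
      · have hrB := hout p r hpr hpB hrA
        rw [fAB q p hqA hpB, fAB q r hqA hrB,
          hτ p ⟨hpB, q, hqA, hpq⟩ r ⟨hrB, q, hqA, hqr.symm⟩ hpr, two]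
      · have hrB : r ∉ B := fun h => hpB (hout r p hpr.symm h hpA)
        rw [f0 q p (fun _ => hpB) (fun _ => hpA), f0 q r (fun _ => hrB) (fun _ => hrA), add_zero]
    · rw [f0 p q (fun h => absurd h hpA) (fun _ => hqA), zero_add, hsymm q r, hsymm p r]
      by_cases hpB : p ∈ B
      · have hqB := hout p q hpq hpB hqA
        rw [fAB r q hrA hqB, fAB r p hrA hpB,
          hτ q ⟨hqB, r, hrA, hqr⟩ p ⟨hpB, r, hrA, hpr⟩ hpq.symm]
      · have hqB : q ∉ B := fun h => hpB (hout q p hpq.symm h hpA)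
        rw [f0 r q (fun _ => hqB) (fun _ => hqA), f0 r p (fun _ => hpB) (fun _ => hpA)]
    · rw [f0 p q (fun h => absurd h hpA) (fun _ => hqA),
        f0 q r (fun h => absurd h hqA) (fun _ => hrA),
        f0 p r (fun h => absurd h hpA) (fun _ => hrA), add_zero]
  obtain ⟨F, hF⟩ := exists_potential f hsymm htri
  have cancel : ∀ a b : ZMod 2, 0 = a + b → a = b := by decide
  have hFA : ∀ p ∈ A, ∀ q ∈ A, F p = F q := fun p hp q hq =>
    eq_of_induce_connected hA (fun a ha b hb hab => cancel _ _ (by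
      rw [← hF a b hab, f0 a b (fun _ => hdisj b hb) fun h => absurd h (hdisj a ha)])) hp hq
  have hFB : ∀ p ∈ B, ∀ q ∈ B, F p = F q := fun p hp q hq =>
    eq_of_induce_connected hB.prop.2 (fun a ha b hb hab => cancel _ _ (by
      rw [← hF a b hab, f0 a b (fun h => absurd ha (hdisj a h)) fun _ h => hdisj b h hb])) hp hq
  obtain ⟨hxB, x', hx'A, hxx'⟩ := hx
  obtain ⟨hyB, y', hy'A, hyy'⟩ := hy
  have h1 : f x' x = 1 := by rw [fAB x' x hx'A hxB, if_pos rfl]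
  have h2 : f y' y = 1 := by
    rw [hF _ _ hyy'.symm, hFA y' hy'A x' hx'A, hFB y hyB x hxB, ← hF _ _ hxx'.symm, h1]
  rw [fAB y' y hy'A hyB] at h2
  by_contra hne
  rw [if_neg fun h => hne h.symm] at h2
  exact absurd h2 (by decide)


/-! ### Geometry of rectangles and tiles -/

theorem ediv_near {H a b : ℤ} (hH : 0 < H) (h : |a - b| ≤ H) : |a / H - b / H| ≤ 1 := by
  rw [abs_le] at h ⊢
  have h1 : a / H ≤ (b + H) / H := Int.ediv_le_ediv hH (by linarith)
  have h2 : b / H ≤ (a + H) / H := Int.ediv_le_ediv hH (by linarith)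
  rw [Int.add_ediv_of_dvd_right dvd_rfl, Int.ediv_self hH.ne'] at h1 h2
  constructor <;> linarith

theorem even_add_one_ediv {H a : ℤ} (hH : 0 < H) (hHe : Even H) (ha : Even a) :
    (a + 1) / H = a / H := by
  rw [Int.ediv_eq_iff_of_pos hH]
  have h1 := Int.mul_ediv_add_emod a H
  have h2 := Int.emod_nonneg a hH.ne'
  have h3 := Int.emod_lt_of_pos a hH
  have h4 : Even (a % H) := by
    rw [Int.emod_def]
    exact ha.sub (hHe.mul_right _)
  obtain ⟨x, hx⟩ := h4
  obtain ⟨y, hy⟩ := hHe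
  have h5 : H * (a / H) = a / H * H := mul_comm _ _
  constructor <;> omega

/-- Rectangles which are equal or connected. -/
def RectNear (r r' : RectIdx) : Prop := |r.1 - r'.1| ≤ 1 ∧ |r.2 - r'.2| ≤ 1

theorem RectNear.symm {r r' : RectIdx} (h : RectNear r r') : RectNear r' r := by
  unfold RectNear at *
  rwa [abs_sub_comm r'.1, abs_sub_comm r'.2]

theorem RectNear.adj {r r' : RectIdx} (h : RectNear r r') (hne : r ≠ r') : starGraph.Adj r r' :=
  ⟨hne, h.1, h.2⟩

namespace KacModel

variable (K : KacModel)

/-- The index of the rectangle containing `p`. -/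
def rectOf (p : Site) : RectIdx :=
  (p.1 / (K.ellPlus : ℤ),
    (p.2 - if Even (p.1 / (K.ellPlus : ℤ)) then 0 else 1) / (K.height : ℤ))

theorem mem_Q {p : Site} {r : RectIdx} : p ∈ K.Q r ↔ K.rectOf p = r := by
  have h1 : (0 : ℤ) < K.ellPlus := by exact_mod_cast K.ellPlus_pos
  have h2 : (0 : ℤ) < K.height := by exact_mod_cast K.height_pos
  unfold Q
  rw [Finset.mem_product, Finset.mem_Ico, rectOf, Prod.ext_iff]
  dsimp only
  rw [Int.ediv_eq_iff_of_pos h1, add_mul, one_mul]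
  refine and_congr_right fun hx => ?_
  have hk : p.1 / (K.ellPlus : ℤ) = r.1 := (Int.ediv_eq_iff_of_pos h1).2 hx
  rw [hk]
  by_cases he : Even r.1
  · rw [if_pos he, if_pos he, Finset.mem_Ico, sub_zero, Int.ediv_eq_iff_of_pos h2, add_mul, one_mul]
  · rw [if_neg he, if_neg he, Finset.mem_Ioc, Int.ediv_eq_iff_of_pos h2, add_mul, one_mul]
    constructor <;> intro h <;> constructor <;> omega

theorem mem_region {A : Finset RectIdx} {p : Site} : p ∈ K.region A ↔ K.rectOf p ∈ A := by
  unfold region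
  rw [Finset.mem_biUnion]
  constructor
  · rintro ⟨r, hr, hp⟩; rwa [K.mem_Q.1 hp]
  · exact fun h => ⟨_, h, K.mem_Q.2 rfl⟩

theorem rectOf_congr {p q : Site} (h2 : q.2 = p.2)
    (h1 : q.1 / (K.ellPlus : ℤ) = p.1 / (K.ellPlus : ℤ)) : K.rectOf q = K.rectOf p := by
  simp only [rectOf, h1, h2]

/-- The reason for the two half-open conventions in the rectangles: the lower rows of coupled pairs,
like the lowest rows of the rectangles, are even in even columns and odd in odd ones, and the height
is even. -/
theorem rectOf_up {p : Site} (h : K.IsLow p) : K.rectOf (up p) = K.rectOf p := by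
  have h2 : (0 : ℤ) < K.height := by exact_mod_cast K.height_pos
  unfold IsLow at h
  unfold rectOf up
  dsimp only
  congr 1
  rw [Int.even_add] at h
  split_ifs with he
  · rw [sub_zero, sub_zero]
    exact even_add_one_ediv h2 K.even_height (h.1 he)
  · have ho : Even (p.2 - 1) := by
      have := (not_congr h).1 he
      rw [Int.even_sub_one]
      exact this
    have := even_add_one_ediv h2 K.even_height ho
    rw [← this]
    congr 1; ring

theorem rectOf_lowRep (p : Site) : K.rectOf (K.lowRep p) = K.rectOf p := by
  rcases K.eq_lowRep_or p with h | h
  · rw [← h]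
  · conv_rhs => rw [h]
    rw [K.rectOf_up (K.isLow_lowRep p)]

theorem blockClosed_region {ℓ : ℕ} (hd : ℓ ∣ K.ellPlus) (A : Finset RectIdx) :
    BlockClosed ℓ (K.region A) := by
  intro p q h2 h1 hp
  rw [mem_region] at hp ⊢
  rwa [K.rectOf_congr h2 (ediv_eq_of_dvd hd h1)]

theorem pairClosed_region (A : Finset RectIdx) : K.PairClosed (K.region A) := by
  intro p hp
  rw [mem_region, mem_region, K.rectOf_up hp]

theorem ediv_ellPlus (x : ℤ) : x / (K.ellPlus : ℤ) = x / (K.tileLen : ℤ) / (K.height : ℤ) := by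
  rw [ellPlus_eq]
  push_cast
  rw [← Int.ediv_ediv_of_nonneg (by positivity)]

/-- The extra `1` in the vertical condition absorbs the shift by one row between even and odd
columns. -/
theorem rectNear_of_close {p q : Site}
    (h1 : |p.1 / (K.tileLen : ℤ) - q.1 / (K.tileLen : ℤ)| ≤ K.height)
    (h2 : |p.2 - q.2| + 1 ≤ K.height) : RectNear (K.rectOf p) (K.rectOf q) := by
  have hH : (0 : ℤ) < K.height := by exact_mod_cast K.height_pos
  refine ⟨?_, ?_⟩
  · unfold rectOf
    dsimp only
    rw [K.ediv_ellPlus, K.ediv_ellPlus]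
    exact ediv_near hH h1
  · unfold rectOf
    dsimp only
    refine ediv_near hH ?_
    have h3 := le_abs_self (p.2 - q.2)
    have h4 := neg_abs_le (p.2 - q.2)
    rw [abs_le]
    split_ifs <;> constructor <;> linarith

theorem tile_close {x y : ℤ} (h : |x - y| ≤ K.tileLen) :
    |x / (K.tileLen : ℤ) - y / (K.tileLen : ℤ)| ≤ 1 :=
  ediv_near (by exact_mod_cast K.tileLen_pos) h

theorem lowRow_le (p : Site) : K.lowRow p ≤ p.2 ∧ p.2 - 1 ≤ K.lowRow p := by
  unfold lowRow
  split_ifs <;> constructor <;> omega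

theorem card_Q (r : RectIdx) : (K.Q r).card = K.ellPlus * K.height := by
  unfold Q
  rw [Finset.card_product, Int.card_Ico]
  have h1 : ((r.1 + 1) * (K.ellPlus : ℤ) - r.1 * K.ellPlus).toNat = K.ellPlus := by
    rw [add_mul, one_mul, add_sub_cancel_left, Int.toNat_natCast]
  rw [h1]
  congr 1
  split_ifs
  · rw [Int.card_Ico, add_mul, one_mul, add_sub_cancel_left, Int.toNat_natCast]
  · rw [Int.card_Ioc, add_mul, one_mul, add_sub_cancel_left, Int.toNat_natCast]

theorem card_region (A : Finset RectIdx) : (K.region A).card = A.card * (K.ellPlus * K.height) := by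
  unfold region
  rw [Finset.card_biUnion, Finset.sum_congr rfl fun r _ => K.card_Q r, Finset.sum_const, smul_eq_mul]
  refine fun r _ r' _ hne => Finset.disjoint_left.2 fun p hp hp' => ?_
  exact hne ((K.mem_Q.1 hp).symm.trans (K.mem_Q.1 hp'))

/-! ### The inner part of a region -/

open Classical in
/-- The sites of `Λ` at distance larger than `d` (in units of tiles) from the complement. -/
noncomputable def deep (Λ : Finset Site) (d : ℕ) : Finset Site :=
  -- Distances are taken in whole tiles and from the lower row of the pair, which makes the set a
  -- union of tiles and of coupled pairs. With `d + 1`, both rows of a pair see at least `d` rows on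
  -- either side.
  Λ.filter fun p => ∀ q : Site, |q.1 / (K.tileLen : ℤ) - p.1 / (K.tileLen : ℤ)| ≤ d →
    |q.2 - K.lowRow p| ≤ d + 1 → q ∈ Λ

variable {K} {Λ : Finset Site}

theorem mem_deep {d : ℕ} {p : Site} : p ∈ K.deep Λ d ↔
    ∀ q : Site, |q.1 / (K.tileLen : ℤ) - p.1 / (K.tileLen : ℤ)| ≤ d →
      |q.2 - K.lowRow p| ≤ d + 1 → q ∈ Λ := by
  classical
  unfold deep
  rw [Finset.mem_filter]
  refine and_iff_right_of_imp fun h => h p (by simp) ?_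
  have := K.lowRow_le p
  rw [abs_le]
  constructor <;> omega

theorem deep_subset (d : ℕ) : K.deep Λ d ⊆ Λ := by
  classical
  exact Finset.filter_subset _ _

/-- The lower rows of two sites of the same row differ by at most one, which the extra unit of depth
absorbs. -/
theorem mem_deep_of_close {d : ℕ} {p q : Site} (hp : p ∈ K.deep Λ (d + 1))
    (h1 : |q.1 / (K.tileLen : ℤ) - p.1 / (K.tileLen : ℤ)| ≤ 1) (h2 : q.2 = p.2) :
    q ∈ K.deep Λ d := by
  rw [mem_deep] at hp ⊢
  intro r hr1 hr2
  have h3 := K.lowRow_le p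
  have h4 := K.lowRow_le q
  refine hp r ?_ ?_
  · rw [abs_le] at *
    push_cast
    constructor <;> omega
  · rw [abs_le] at *
    push_cast
    constructor <;> omega

theorem deep_succ_subset (d : ℕ) : K.deep Λ (d + 1) ⊆ K.deep Λ d := fun _ hp =>
  mem_deep_of_close hp (by simp) rfl

theorem deep_anti {d e : ℕ} (h : d ≤ e) : K.deep Λ e ⊆ K.deep Λ d := by
  induction h with
  | refl => exact subset_rfl
  | step _ ih => exact (deep_succ_subset _).trans ih

theorem mem_deep_congr {d : ℕ} {p q : Site}
    (h1 : q.1 / (K.tileLen : ℤ) = p.1 / (K.tileLen : ℤ)) (h2 : K.lowRow q = K.lowRow p) :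
    q ∈ K.deep Λ d ↔ p ∈ K.deep Λ d := by
  rw [mem_deep, mem_deep, h1, h2]

theorem blockClosed_deep {ℓ : ℕ} (hd : ℓ ∣ K.tileLen) (d : ℕ) : BlockClosed ℓ (K.deep Λ d) := by
  intro p q h2 h1 hp
  have h3 := ediv_eq_of_dvd hd h1
  refine (mem_deep_congr h3 ?_).2 hp
  have h4 := ediv_eq_of_dvd K.tileLen_dvd_ellPlus h3
  have h5 : K.IsLow q ↔ K.IsLow p := by unfold IsLow; rw [h2, h4]
  simp only [lowRow, h5, h2]

theorem pairClosed_deep (d : ℕ) : K.PairClosed (K.deep Λ d) := by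
  intro p hp
  have h1 : K.lowRow (up p) = p.2 := congrArg Prod.snd (K.lowRep_up hp)
  have h2 : K.lowRow p = p.2 := congrArg Prod.snd (K.lowRep_of_isLow hp)
  exact mem_deep_congr rfl (h2.trans h1.symm)

/-- A site outside the inner part is close to the complement. -/
theorem exists_close_of_notMem_deep {A : Finset RectIdx} {d : ℕ} {p : Site}
    (hd : (d : ℤ) + 5 ≤ K.height) (hp : p ∉ K.deep (K.region A) d) :
    ∃ r, r ∉ A ∧ ∀ q : Site, |q.1 / (K.tileLen : ℤ) - p.1 / (K.tileLen : ℤ)| ≤ 1 →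
      |q.2 - p.2| ≤ 1 → RectNear (K.rectOf q) r := by
  rw [mem_deep] at hp
  push Not at hp
  obtain ⟨p', h1, h2, hp'⟩ := hp
  rw [mem_region] at hp'
  refine ⟨K.rectOf p', hp', fun q hq1 hq2 => K.rectNear_of_close ?_ ?_⟩
  · rw [abs_le] at *
    constructor <;> omega
  · have h3 := K.lowRow_le p
    have : |q.2 - p'.2| ≤ d + 3 := by
      rw [abs_le] at *
      constructor <;> omega
    linarith

/-- A finite union of blocks containing all the sites interacting with `Λ`. -/
theorem exists_rangeIn (Λ : Finset Site) :
    ∃ U, BlockClosed K.blockLen U ∧ K.RangeIn Λ U := by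
  have hW : (0 : ℤ) < K.tileLen := by exact_mod_cast K.tileLen_pos
  set U := Λ.biUnion fun p => Finset.Ico ((p.1 / (K.tileLen : ℤ) - 1) * K.tileLen)
    ((p.1 / (K.tileLen : ℤ) + 2) * K.tileLen) ×ˢ ({p.2} : Finset ℤ) with hU
  have hmem : ∀ q, q ∈ U ↔ ∃ p ∈ Λ, q.2 = p.2 ∧
      |q.1 / (K.tileLen : ℤ) - p.1 / (K.tileLen : ℤ)| ≤ 1 := by
    intro q
    simp only [hU, Finset.mem_biUnion, Finset.mem_product, Finset.mem_Ico, Finset.mem_singleton]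
    refine exists_congr fun p => and_congr_right fun _ => ?_
    rw [and_comm]
    refine and_congr_right fun _ => ?_
    rw [← Int.le_ediv_iff_mul_le hW, ← Int.ediv_lt_iff_lt_mul hW, abs_le]
    constructor <;> intro h <;> constructor <;> omega
  refine ⟨U, fun p q h2 h1 hp => ?_, fun p hp y hy => ?_⟩
  · rw [hmem] at hp ⊢
    obtain ⟨r, hr, h3, h4⟩ := hp
    exact ⟨r, hr, h2.trans h3, by rw [ediv_eq_of_dvd K.blockLen_dvd_tileLen h1]; exact h4⟩
  · rw [hmem]
    refine ⟨p, hp, rfl, K.tile_close ?_⟩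
    unfold tileLen
    push_cast
    exact hy

theorem KernelBounds.close_of_siteKer_ne_zero {C c : ℝ} {k₀ : ℕ} (hK : K.KernelBounds C c k₀)
    {p q : Site} (h : K.siteKer p q ≠ 0) :
    q.2 = p.2 ∧ |q.1 / (K.tileLen : ℤ) - p.1 / (K.tileLen : ℤ)| ≤ 1 := by
  unfold siteKer at h
  by_cases h2 : p.2 = q.2
  · rw [if_pos h2] at h
    refine ⟨h2.symm, K.tile_close ?_⟩
    by_contra hcon
    refine h (hK.range _ _ ?_)
    unfold tileLen at hcon
    push_cast at hcon
    rw [abs_sub_comm]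
    exact not_le.1 hcon
  · exact absurd (if_neg h2) h

/-! ### The phase indicators -/

theorem eta_congr {σ σ' : Config} {p q : Site} (h : K.empMag σ p = K.empMag σ' q) :
    K.eta σ p = K.eta σ' q := by
  unfold eta
  rw [h]

theorem eta_eq_one_iff {σ : Config} {p : Site} :
    K.eta σ p = 1 ↔ |K.empMag σ p - spontMag K.ε| ≤ K.zeta := by
  unfold eta
  split_ifs <;> simp_all

theorem eta_eq_neg_one_iff (hζ : K.zeta < spontMag K.ε) {σ : Config} {p : Site} :
    K.eta σ p = -1 ↔ |K.empMag σ p + spontMag K.ε| ≤ K.zeta := by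
  unfold eta
  split_ifs with h1 h2
  · refine ⟨fun h => absurd h (by decide), fun h => ?_⟩
    rw [abs_le] at h h1
    linarith [h.2, h1.1]
  · simp [h2]
  · simp [h2]

/-- The phase indicator of sign `s` in terms of the real number `s`. -/
theorem eta_eq_iff (hζ : K.zeta < spontMag K.ε) {s : SignType} (hs : s = 1 ∨ s = -1)
    {σ : Config} {p : Site} :
    K.eta σ p = s ↔ |K.empMag σ p - (s : ℝ) * spontMag K.ε| ≤ K.zeta := by
  rcases hs with rfl | rfl
  · rw [eta_eq_one_iff]; simp
  · rw [eta_eq_neg_one_iff hζ]; simp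

theorem etaOnBlock_iff {σ : Config} {r : RectIdx} {s : SignType} :
    K.EtaOnBlock σ r s ↔ ∀ p, RectNear (K.rectOf p) r → K.eta σ p = s := by
  unfold EtaOnBlock
  constructor
  · intro h p hp
    obtain ⟨h1, h2⟩ := hp
    rw [abs_le] at h1 h2
    refine h ((K.rectOf p).1 - r.1) (Finset.mem_Icc.2 h1) ((K.rectOf p).2 - r.2)
      (Finset.mem_Icc.2 h2) p (K.mem_Q.2 ?_)
    simp
  · intro h u hu v hv p hp
    rw [K.mem_Q] at hp
    refine h p ?_
    rw [hp]
    rw [Finset.mem_Icc] at hu hv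
    constructor <;> rw [abs_le] <;> simpa using by assumption

theorem etaOnBlock_theta {σ : Config} {r : RectIdx} (h : K.Theta σ r ≠ 0) :
    K.EtaOnBlock σ r (K.Theta σ r) := by
  unfold Theta at h ⊢
  split_ifs with h1 h2
  · exact h1
  · exact h2
  · simp [h1, h2] at h

theorem eta_eq_of_theta_near {σ : Config} {r : RectIdx} (h : K.Theta σ r ≠ 0) {p : Site}
    (hp : RectNear (K.rectOf p) r) : K.eta σ p = K.Theta σ r :=
  etaOnBlock_iff.1 (etaOnBlock_theta h) p hp

theorem theta_eq_of_etaOnBlock {σ : Config} {r : RectIdx} {s : SignType} (hs : s = 1 ∨ s = -1)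
    (h : K.EtaOnBlock σ r s) : K.Theta σ r = s := by
  rcases hs with rfl | rfl
  · exact if_pos h
  · unfold Theta
    rw [if_neg, if_pos h]
    intro h1
    obtain ⟨p, hp⟩ := K.Q_nonempty r
    have hn : RectNear (K.rectOf p) r := by rw [K.mem_Q.1 hp]; simp [RectNear]
    have := (etaOnBlock_iff.1 h1 p hn).symm.trans (etaOnBlock_iff.1 h p hn)
    exact absurd this (by decide)

end KacModel


/-! ### Estimates for the excess free energy -/

theorem wellDist_le_two_mul (m a b x y : ℝ) :
    wellDist m a b ≤ 2 * wellDist m x y + 2 * ((x - a) ^ 2 + (y - b) ^ 2) := by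
  unfold wellDist
  rcases min_choice ((x - m) ^ 2 + (y - m) ^ 2) ((x + m) ^ 2 + (y + m) ^ 2) with h | h <;> rw [h]
  · refine (min_le_left _ _).trans ?_
    nlinarith [sq_nonneg (a - 2 * x + m), sq_nonneg (b - 2 * y + m)]
  · refine (min_le_right _ _).trans ?_
    nlinarith [sq_nonneg (a - 2 * x - m), sq_nonneg (b - 2 * y - m)]

/-- The distance to a well is controlled by the distance to the set of wells, for points
close to an average near this well. -/
theorem sq_sub_well_le {m t ζ a b : ℝ} (ht : t = 1 ∨ t = -1) (hζ : ζ < m)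
    (ha : |a - t * m| ≤ ζ) (hb : |b - t * m| ≤ ζ) (x y : ℝ) :
    (x - t * m) ^ 2 + (y - t * m) ^ 2 ≤
      6 * ((x - a) ^ 2 + (y - b) ^ 2) + 4 * wellDist m x y := by
  have h0 : 0 ≤ ζ := (abs_nonneg _).trans ha
  -- As `ζ < m`, the averages `a` and `b` have the sign `t`, so the well `t m` is the nearest one.
  have h1 : (a - t * m) ^ 2 + (b - t * m) ^ 2 ≤ wellDist m a b := by
    unfold wellDist
    rw [abs_le] at ha hb
    rcases ht with rfl | rfl
    · refine le_min (by ring_nf; rfl) ?_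
      nlinarith [ha.1, hb.1]
    · refine le_min ?_ (by ring_nf; rfl)
      nlinarith [ha.2, hb.2]
  have h2 := wellDist_le_two_mul m a b x y
  nlinarith [sq_nonneg (x - 2 * a + t * m), sq_nonneg (y - 2 * b + t * m)]

theorem mul_sq_sub_blockAvg_le {ℓ : ℕ} (hℓ : 0 < ℓ) (x : ℝ) (f : Site → ℝ) (p : Site) :
    ℓ * (x - blockAvg ℓ f p) ^ 2 ≤ ∑ q ∈ blockOf ℓ p, (x - f q) ^ 2 := by
  have hl : (0 : ℝ) < ℓ := by exact_mod_cast hℓ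
  have e : ℓ * (x - blockAvg ℓ f p) = ∑ q ∈ blockOf ℓ p, (x - f q) := by
    rw [Finset.sum_sub_distrib, Finset.sum_const, card_blockOf, nsmul_eq_mul, blockAvg]
    field_simp
  have h := sq_sum_le_card_mul_sum_sq (s := blockOf ℓ p) (f := fun q => x - f q)
  rw [← e, card_blockOf, mul_pow, sq (ℓ : ℝ), mul_assoc] at h
  exact le_of_mul_le_mul_left h hl

namespace KacModel

variable (K : KacModel)

/-- The part of the excess free energy in `M` which belongs to `T ⊆ M`. -/
noncomputable def partExcess (m : ℝ) (M T : Finset Site) (u : Site → ℝ) : ℝ :=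
  ∑ p ∈ K.lowSites T, (dualEnergy K.ε (u p) (u (up p)) - dualEnergy K.ε m m)
    + (1 / 4) * K.dirichlet T M u

variable {K} {C c κ m : ℝ} {k₀ ℓ : ℕ} {M T : Finset Site} {u : Site → ℝ}

theorem lowSites_sdiff (M T : Finset Site) : K.lowSites (M \ T) = K.lowSites M \ K.lowSites T := by
  ext p
  simp only [mem_lowSites, Finset.mem_sdiff]
  tauto

theorem lowSites_subset (h : T ⊆ M) : K.lowSites T ⊆ K.lowSites M := Finset.filter_subset_filter _ h

namespace KernelBounds

variable (hK : K.KernelBounds C c k₀)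
include hK

/-- The Dirichlet terms between `T` and `M \ T` are dropped. Superadditivity makes the excess of a
layer a lower bound for the increment of the excess with the depth. -/
theorem excess_add_le (hT : T ⊆ M) :
    K.excess m T u + K.excess m (M \ T) u ≤ K.excess m M u := by
  unfold excess
  have h1 := Finset.sum_sdiff (lowSites_subset (K := K) hT)
    (f := fun p => dualEnergy K.ε (u p) (u (up p)) - dualEnergy K.ε m m)
  have h2 : K.dirichlet M M u = K.dirichlet T T u + K.dirichlet (M \ T) (M \ T) u
      + K.dirichlet T (M \ T) u + K.dirichlet (M \ T) T u := by
    simp only [dirichlet]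
    rw [← Finset.sum_sdiff hT]
    simp only [← Finset.sum_sdiff hT, Finset.sum_add_distrib]
    ring
  have h3 := hK.dirichlet_nonneg T (M \ T) u
  have h4 := hK.dirichlet_nonneg (M \ T) T u
  rw [lowSites_sdiff]
  linarith

/-- The excess free energy is at most proportional to the volume. -/
theorem excess_le (hCγ : C * K.γ ≤ 1) (hu : ∀ p, |u p| ≤ 1) :
    K.excess m M u ≤ (|1 + |K.ε| - dualEnergy K.ε m m| + 2) * M.card := by
  have h1 : ∑ p ∈ K.lowSites M, (dualEnergy K.ε (u p) (u (up p)) - dualEnergy K.ε m m) ≤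
      |1 + |K.ε| - dualEnergy K.ε m m| * M.card := by
    calc _ ≤ ∑ p ∈ K.lowSites M, |1 + |K.ε| - dualEnergy K.ε m m| := by
          refine Finset.sum_le_sum fun p _ => le_trans ?_ (le_abs_self _)
          have h := pressure_ge K.ε (u p) (u (up p))
          have h3 := hu p
          have h4 := hu (up p)
          have h5 := sq_abs (u p)
          have h6 := sq_abs (u (up p))
          have h7 := abs_nonneg (u p)
          have h8 := abs_nonneg (u (up p))
          unfold dualEnergy
          nlinarith
      _ = |1 + |K.ε| - dualEnergy K.ε m m| * (K.lowSites M).card := by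
          rw [Finset.sum_const, nsmul_eq_mul, mul_comm]
      _ ≤ _ := by
          gcongr
          exact Finset.filter_subset _ _
  have h2 : K.dirichlet M M u ≤ 8 * M.card := by
    calc K.dirichlet M M u ≤ ∑ p ∈ M, ∑ q ∈ M, K.siteKer p q * 4 := by
          refine Finset.sum_le_sum fun p _ => Finset.sum_le_sum fun q _ => ?_
          refine mul_le_mul_of_nonneg_left ?_ (hK.siteKer_nonneg p q)
          have h := abs_le.1 (hu p)
          have h' := abs_le.1 (hu q)
          nlinarith
      _ ≤ ∑ p ∈ M, (2 : ℝ) * 4 := by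
          refine Finset.sum_le_sum fun p _ => ?_
          rw [← Finset.sum_mul]
          exact mul_le_mul_of_nonneg_right (hK.sum_siteKer_le_two hCγ p M) (by norm_num)
      _ = _ := by rw [Finset.sum_const, nsmul_eq_mul]; ring
  unfold excess
  linarith

theorem le_siteKer {p q : Site} (h2 : p.2 = q.2)
    (h : |p.1 - q.1| * 2 ^ k₀ ≤ (2 : ℤ) ^ K.scales.n) : c * K.γ ≤ K.siteKer p q := by
  unfold siteKer
  rw [if_pos h2]
  exact hK.lower _ _ h

/-- A Poincaré inequality: all sites of a block of length at most `2 ^ (-k₀) γ⁻¹` interact with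
strength at least `c γ`, and the squared distance to an average is at most the average squared
distance. -/
theorem variance_le (hc : 0 < c) (hℓ : 0 < ℓ) (hℓk : ℓ * 2 ^ k₀ ≤ 2 ^ K.scales.n) (hT : T ⊆ M)
    (hM : BlockClosed ℓ M) (u : Site → ℝ) :
    c * K.γ * ℓ * ∑ p ∈ T, (u p - blockAvg ℓ u p) ^ 2 ≤ K.dirichlet T M u := by
  unfold dirichlet
  have hγ := K.gamma_pos
  rw [Finset.mul_sum]
  refine Finset.sum_le_sum fun p hp => ?_
  calc c * K.γ * ℓ * (u p - blockAvg ℓ u p) ^ 2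
      = c * K.γ * (ℓ * (u p - blockAvg ℓ u p) ^ 2) := by ring
    _ ≤ c * K.γ * ∑ q ∈ blockOf ℓ p, (u p - u q) ^ 2 := by
        gcongr
        exact mul_sq_sub_blockAvg_le hℓ _ _ _
    _ ≤ ∑ q ∈ blockOf ℓ p, K.siteKer p q * (u p - u q) ^ 2 := by
        rw [Finset.mul_sum]
        refine Finset.sum_le_sum fun q hq => ?_
        refine mul_le_mul_of_nonneg_right (hK.le_siteKer ((mem_blockOf hℓ).1 hq).1.symm ?_)
          (sq_nonneg _)
        have h1 := ((mem_blockOf hℓ).1 hq).2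
        have hl : (0 : ℤ) < ℓ := by exact_mod_cast hℓ
        have h3 : |p.1 - q.1| ≤ ℓ := by
          rw [Int.ediv_eq_iff_of_pos hl] at h1
          have h5 := Int.mul_ediv_add_emod p.1 ℓ
          have h6 := Int.emod_nonneg p.1 hl.ne'
          have h7 := Int.emod_lt_of_pos p.1 hl
          have h8 := mul_comm (p.1 / (ℓ : ℤ)) ℓ
          rw [abs_le]
          constructor <;> linarith [h1.1, h1.2]
        calc |p.1 - q.1| * 2 ^ k₀ ≤ (ℓ : ℤ) * 2 ^ k₀ := by gcongr
          _ ≤ _ := by exact_mod_cast hℓk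
    _ ≤ _ := Finset.sum_le_sum_of_subset_of_nonneg (hM.blockOf_subset hℓ (hT hp))
        fun q _ _ => mul_nonneg (hK.siteKer_nonneg p q) (sq_nonneg _)

section wells

variable (hκ : 0 < κ) (hu : ∀ p, |u p| ≤ 1)
  (hwell : ∀ x y : ℝ, |x| ≤ 1 → |y| ≤ 1 →
    κ * wellDist m x y ≤ dualEnergy K.ε x y - dualEnergy K.ε m m)
include hκ hu hwell

omit hK hκ in
theorem mul_sum_wellDist_le (T : Finset Site) :
    κ * ∑ p ∈ K.lowSites T, wellDist m (u p) (u (up p)) ≤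
      ∑ p ∈ K.lowSites T, (dualEnergy K.ε (u p) (u (up p)) - dualEnergy K.ε m m) := by
  rw [Finset.mul_sum]
  exact Finset.sum_le_sum fun p _ => hwell _ _ (hu _) (hu _)

omit hK in
theorem lowSum_nonneg (T : Finset Site) :
    0 ≤ ∑ p ∈ K.lowSites T, (dualEnergy K.ε (u p) (u (up p)) - dualEnergy K.ε m m) :=
  (mul_nonneg hκ.le (Finset.sum_nonneg fun _ _ => wellDist_nonneg _ _ _)).trans
    (mul_sum_wellDist_le hu hwell T)

theorem partExcess_nonneg (M T : Finset Site) : 0 ≤ K.partExcess m M T u := by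
  unfold partExcess
  have := lowSum_nonneg hκ hu hwell T
  have := hK.dirichlet_nonneg T M u
  positivity

theorem excess_nonneg (M : Finset Site) : 0 ≤ K.excess m M u :=
  hK.partExcess_nonneg hκ hu hwell M M

/-- Near a well, the excess free energy controls the distance to the well. -/
theorem sum_sq_sub_well_le (hc : 0 < c) (hk₀ : k₀ ≤ K.scales.n) (hP : K.PairClosed M)
    (hM : BlockClosed (2 ^ (K.scales.n - k₀)) M) {ζ : ℝ} (hζ : ζ < m) {t : Site → ℝ}
    (ht : ∀ p ∈ M, t p = 1 ∨ t p = -1) (htp : ∀ p ∈ K.lowSites M, t (up p) = t p)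
    (hav : ∀ p ∈ M, |blockAvg (2 ^ (K.scales.n - k₀)) u p - t p * m| ≤ ζ) :
    ∑ p ∈ M, (u p - t p * m) ^ 2 ≤ (24 * 2 ^ k₀ / c + 4 / κ) * K.excess m M u := by
  -- Blocks of length `2 ^ (-k₀) γ⁻¹` have a Poincaré constant `c γ w = c / 2 ^ k₀` independent of
  -- `γ`. The final bound must not degenerate with `γ`, since it is compared with a fixed fraction
  -- of the excess.
  set w := 2 ^ (K.scales.n - k₀) with hw
  have hwk : w * 2 ^ k₀ = 2 ^ K.scales.n := by rw [hw, ← pow_add]; congr 1; omega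
  have hw0 : 0 < w := by positivity
  have hcw : c * K.γ * w = c / 2 ^ k₀ := by
    have h := K.gamma_mul_pow
    have h' : (w : ℝ) * 2 ^ k₀ = 2 ^ K.scales.n := by exact_mod_cast hwk
    rw [← h'] at h
    rw [eq_div_iff (by positivity)]
    linear_combination c * h
  have hvar := hK.variance_le hc hw0 hwk.le subset_rfl hM u
  rw [hcw] at hvar
  set V := ∑ p ∈ M, (u p - blockAvg w u p) ^ 2 with hV
  have h1 : ∑ p ∈ M, (u p - t p * m) ^ 2 ≤
      6 * V + 4 * ∑ p ∈ K.lowSites M, wellDist m (u p) (u (up p)) := by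
    rw [hV, hP.sum_eq, hP.sum_eq, Finset.mul_sum, Finset.mul_sum, ← Finset.sum_add_distrib]
    refine Finset.sum_le_sum fun p hp => ?_
    have hpM := (K.mem_lowSites.1 hp).1
    have hpu := (hP p (K.mem_lowSites.1 hp).2).1 hpM
    have hup := hav _ hpu
    rw [htp p hp] at hup ⊢
    exact sq_sub_well_le (ht p hpM) hζ (hav p hpM) hup _ _
  have h2 := mul_sum_wellDist_le hu hwell M
  have h3 := lowSum_nonneg hκ hu hwell M
  have h4 := hK.dirichlet_nonneg M M u
  set W := ∑ p ∈ K.lowSites M, wellDist m (u p) (u (up p))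
  set S := ∑ p ∈ K.lowSites M, (dualEnergy K.ε (u p) (u (up p)) - dualEnergy K.ε m m) with hS
  have h5 : V ≤ 2 ^ k₀ / c * K.dirichlet M M u := by
    rw [div_mul_eq_mul_div, le_div_iff₀ hc]
    rw [div_mul_eq_mul_div, div_le_iff₀ (by positivity)] at hvar
    linarith
  have h6 : W ≤ S / κ := by rw [le_div_iff₀ hκ]; linarith
  have h7 : 0 ≤ 24 * 2 ^ k₀ / c * S := by positivity
  have h8 : 0 ≤ 1 / κ * K.dirichlet M M u := by positivity
  unfold excess
  rw [← hS]
  calc _ ≤ 6 * V + 4 * W := h1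
    _ ≤ 6 * (2 ^ k₀ / c * K.dirichlet M M u) + 4 * (S / κ) := by gcongr
    _ ≤ 6 * (2 ^ k₀ / c * K.dirichlet M M u) + 4 * (S / κ) + 24 * 2 ^ k₀ / c * S
        + 1 / κ * K.dirichlet M M u := by linarith
    _ = _ := by ring

omit hκ in
/-- The excess free energy controls the distance of the coarse-grained profile to the wells. -/
theorem mul_sum_wellDist_blockAvg_le (hc : 0 < c) (hℓ : 0 < ℓ)
    (hℓk : ℓ * 2 ^ k₀ ≤ 2 ^ K.scales.n) (hκℓ : c * K.γ * ℓ ≤ 4 * κ) (hP : K.PairClosed T)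
    (hT : T ⊆ M) (hM : BlockClosed ℓ M) :
    c * K.γ * ℓ / 8 * ∑ p ∈ K.lowSites T, wellDist m (blockAvg ℓ u p) (blockAvg ℓ u (up p)) ≤
      K.partExcess m M T u := by
  have hvar := hK.variance_le hc hℓ hℓk hT hM u
  have hcp : 0 < c * K.γ * ℓ := by
    have := K.gamma_pos
    positivity
  set V := ∑ p ∈ T, (u p - blockAvg ℓ u p) ^ 2 with hV
  have h1 : ∑ p ∈ K.lowSites T, wellDist m (blockAvg ℓ u p) (blockAvg ℓ u (up p)) ≤
      2 * V + 2 * ∑ p ∈ K.lowSites T, wellDist m (u p) (u (up p)) := by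
    rw [hV, hP.sum_eq, Finset.mul_sum, Finset.mul_sum, ← Finset.sum_add_distrib]
    refine Finset.sum_le_sum fun p hp => ?_
    rw [add_comm]
    exact wellDist_le_two_mul m _ _ _ _
  have h2 := mul_sum_wellDist_le hu hwell T
  have hW : 0 ≤ ∑ p ∈ K.lowSites T, wellDist m (u p) (u (up p)) :=
    Finset.sum_nonneg fun _ _ => wellDist_nonneg _ _ _
  set W := ∑ p ∈ K.lowSites T, wellDist m (u p) (u (up p))
  unfold partExcess
  calc _ ≤ c * K.γ * ℓ / 8 * (2 * V + 2 * W) := by gcongr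
    _ = c * K.γ * ℓ * W / 4 + (1 / 4) * (c * K.γ * ℓ * V) := by ring
    _ ≤ 4 * κ * W / 4 + (1 / 4) * K.dirichlet T M u := by gcongr
    _ = κ * W + (1 / 4) * K.dirichlet T M u := by ring
    _ ≤ _ := by gcongr

omit hκ in
/-- The cost of a coupled pair of cells which is not close to a well. -/
theorem le_partExcess_of_pair (hc : 0 < c) (hℓ : 0 < ℓ)
    (hℓk : ℓ * 2 ^ k₀ ≤ 2 ^ K.scales.n) (hκℓ : c * K.γ * ℓ ≤ 4 * κ) (hd : ℓ ∣ K.ellPlus)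
    (hP : K.PairClosed T) (hTB : BlockClosed ℓ T) (hT : T ⊆ M) (hM : BlockClosed ℓ M) {p : Site}
    (hp : p ∈ K.lowSites T) {ζ : ℝ}
    (hζ : ζ ^ 2 ≤ wellDist m (blockAvg ℓ u p) (blockAvg ℓ u (up p))) :
    c * K.γ * ℓ ^ 2 * ζ ^ 2 / 8 ≤ K.partExcess m M T u := by
  refine le_trans ?_ (hK.mul_sum_wellDist_blockAvg_le hu hwell hc hℓ hℓk hκℓ hP hT hM)
  have hcp : 0 < c * K.γ * ℓ := by
    have := K.gamma_pos
    positivity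
  have hsub : blockOf ℓ p ⊆ K.lowSites T := fun q hq => by
    have hq' := (mem_blockOf hℓ).1 hq
    rw [mem_lowSites] at hp ⊢
    refine ⟨hTB.blockOf_subset hℓ hp.1 hq, ?_⟩
    have := hp.2
    unfold IsLow at this ⊢
    rwa [ediv_eq_of_dvd hd hq'.2, hq'.1]
  have h1 : ∑ q ∈ blockOf ℓ p, ζ ^ 2 ≤
      ∑ p ∈ K.lowSites T, wellDist m (blockAvg ℓ u p) (blockAvg ℓ u (up p)) := by
    refine le_trans (Finset.sum_le_sum fun q hq => ?_)
      (Finset.sum_le_sum_of_subset_of_nonneg hsub fun _ _ _ => wellDist_nonneg _ _ _)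
    have hq' := (mem_blockOf hℓ).1 hq
    have hq2 : up q ∈ blockOf ℓ (up p) := (mem_blockOf hℓ).2 ⟨by simp [up, hq'.1], hq'.2⟩
    rw [blockAvg_eq hℓ u hq, blockAvg_eq hℓ u hq2]
    exact hζ
  rw [Finset.sum_const, card_blockOf, nsmul_eq_mul] at h1
  calc c * K.γ * ℓ ^ 2 * ζ ^ 2 / 8 = c * K.γ * ℓ / 8 * (ℓ * ζ ^ 2) := by ring
    _ ≤ _ := by gcongr

/-- The cost of two neighbouring cells with different averages. -/
theorem le_partExcess_of_step (hc : 0 < c) (hℓ : 0 < ℓ)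
    (hℓk : 2 * ℓ * 2 ^ k₀ ≤ 2 ^ K.scales.n)
    (hTB : BlockClosed ℓ T) (hM : BlockClosed ℓ M) {p q : Site}
    (hp : p ∈ T) (hq : q ∈ M) (h2 : q.2 = p.2) (h1 : |q.1 / (ℓ : ℤ) - p.1 / (ℓ : ℤ)| ≤ 1) {ζ : ℝ}
    (hζ : ζ ^ 2 ≤ (blockAvg ℓ u p - blockAvg ℓ u q) ^ 2) :
    c * K.γ * ℓ ^ 2 * ζ ^ 2 / 8 ≤ K.partExcess m M T u := by
  have hγ := K.gamma_pos
  have hker : ∀ p' ∈ blockOf ℓ p, ∀ q' ∈ blockOf ℓ q, c * K.γ ≤ K.siteKer p' q' := by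
    intro p' hp' q' hq'
    rw [mem_blockOf hℓ] at hp' hq'
    refine hK.le_siteKer (by rw [hp'.1, hq'.1, h2]) ?_
    have hl : (0 : ℤ) < ℓ := by exact_mod_cast hℓ
    have h3 : |p'.1 - q'.1| ≤ 2 * ℓ := by
      rw [← hp'.2, ← hq'.2] at h1
      have e1 := Int.mul_ediv_add_emod p'.1 ℓ
      have e2 := Int.emod_nonneg p'.1 hl.ne'
      have e3 := Int.emod_lt_of_pos p'.1 hl
      have f1 := Int.mul_ediv_add_emod q'.1 ℓ
      have f2 := Int.emod_nonneg q'.1 hl.ne'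
      have f3 := Int.emod_lt_of_pos q'.1 hl
      rw [abs_le] at h1 ⊢
      constructor <;> nlinarith [h1.1, h1.2]
    calc |p'.1 - q'.1| * 2 ^ k₀ ≤ (2 * ℓ : ℤ) * 2 ^ k₀ := by gcongr
      _ ≤ _ := by exact_mod_cast hℓk
  -- All `ℓ ^ 2` pairs of sites of the two cells are within `2 ℓ` and interact with strength at
  -- least `c γ`; the square of the difference of averages is bounded by Jensen, once in each cell.
  have hdir : c * K.γ * (ℓ ^ 2 * (blockAvg ℓ u p - blockAvg ℓ u q) ^ 2) ≤ K.dirichlet T M u := by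
    calc c * K.γ * (ℓ ^ 2 * (blockAvg ℓ u p - blockAvg ℓ u q) ^ 2)
        = c * K.γ * (ℓ * (ℓ * (blockAvg ℓ u p - blockAvg ℓ u q) ^ 2)) := by ring
      _ ≤ c * K.γ * (ℓ * ∑ q' ∈ blockOf ℓ q, (blockAvg ℓ u p - u q') ^ 2) := by
          gcongr
          exact mul_sq_sub_blockAvg_le hℓ _ _ _
      _ = c * K.γ * ∑ q' ∈ blockOf ℓ q, ℓ * (u q' - blockAvg ℓ u p) ^ 2 := by
          rw [Finset.mul_sum]
          congr 1
          exact Finset.sum_congr rfl fun _ _ => by ring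
      _ ≤ c * K.γ * ∑ q' ∈ blockOf ℓ q, ∑ p' ∈ blockOf ℓ p, (u q' - u p') ^ 2 := by
          gcongr
          exact mul_sq_sub_blockAvg_le hℓ _ _ _
      _ = ∑ p' ∈ blockOf ℓ p, ∑ q' ∈ blockOf ℓ q, c * K.γ * (u p' - u q') ^ 2 := by
          rw [Finset.sum_comm, Finset.mul_sum]
          refine Finset.sum_congr rfl fun _ _ => ?_
          rw [Finset.mul_sum]
          exact Finset.sum_congr rfl fun _ _ => by ring
      _ ≤ ∑ p' ∈ blockOf ℓ p, ∑ q' ∈ blockOf ℓ q, K.siteKer p' q' * (u p' - u q') ^ 2 :=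
          Finset.sum_le_sum fun p' hp' => Finset.sum_le_sum fun q' hq' =>
            mul_le_mul_of_nonneg_right (hker p' hp' q' hq') (sq_nonneg _)
      _ ≤ ∑ p' ∈ blockOf ℓ p, ∑ q' ∈ M, K.siteKer p' q' * (u p' - u q') ^ 2 :=
          Finset.sum_le_sum fun p' _ => Finset.sum_le_sum_of_subset_of_nonneg
            (hM.blockOf_subset hℓ hq) fun q' _ _ =>
              mul_nonneg (hK.siteKer_nonneg _ _) (sq_nonneg _)
      _ ≤ K.dirichlet T M u := Finset.sum_le_sum_of_subset_of_nonneg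
            (hTB.blockOf_subset hℓ hp) fun p' _ _ => Finset.sum_nonneg fun q' _ =>
              mul_nonneg (hK.siteKer_nonneg _ _) (sq_nonneg _)
  have hl := lowSum_nonneg hκ hu hwell T
  unfold partExcess
  have h5 : c * K.γ * ℓ ^ 2 * ζ ^ 2 ≤
      c * K.γ * (ℓ ^ 2 * (blockAvg ℓ u p - blockAvg ℓ u q) ^ 2) := by
    rw [mul_assoc (c * K.γ)]
    gcongr
  have h6 := hK.dirichlet_nonneg T M u
  linarith

end wells

end KernelBounds

end KacModel


/-! ### The excess free energy of a contour -/

theorem eq_of_succ_eq {α : Type*} {f : ℤ → α} {a b : ℤ}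
    (h : ∀ x, a ≤ x → x + 1 < b → f (x + 1) = f x) {x y : ℤ} (hx : a ≤ x) (hxb : x < b)
    (hy : a ≤ y) (hyb : y < b) : f x = f y := by
  have key : ∀ z, a ≤ z → z < b → f z = f a := by
    intro z hz
    induction z, hz using Int.leInduction with
    | base => exact fun _ => rfl
    | succ z hz ih => exact fun hb => (h z hz hb).trans (ih (by linarith))
  rw [key x hx hxb, key y hy hyb]

theorem card_filter_rectNear_le (A : Finset RectIdx) (r : RectIdx) [DecidablePred (RectNear r)] :
    (A.filter (RectNear r)).card ≤ 9 := by
  have : A.filter (RectNear r) ⊆ Finset.Icc (r.1 - 1) (r.1 + 1) ×ˢ Finset.Icc (r.2 - 1) (r.2 + 1) := by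
    intro q hq
    have h := (Finset.mem_filter.1 hq).2
    rw [RectNear, abs_le, abs_le] at h
    rw [Finset.mem_product, Finset.mem_Icc, Finset.mem_Icc]
    omega
  refine (Finset.card_le_card this).trans ?_
  rw [Finset.card_product, Int.card_Icc, Int.card_Icc]
  have h1 : (r.1 + 1 + 1 - (r.1 - 1)).toNat = 3 := by omega
  have h2 : (r.2 + 1 + 1 - (r.2 - 1)).toNat = 3 := by omega
  rw [h1, h2]

namespace KacModel

variable {K : KacModel}

theorem rectNear_iff {p : Site} {r : RectIdx} : RectNear (K.rectOf p) r ↔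
    ((r.1 - 1) * (K.ellPlus : ℤ) ≤ p.1 ∧ p.1 < (r.1 + 2) * K.ellPlus) ∧
    (r.2 - 1) * (K.height : ℤ) ≤ (p.2 - if Even (p.1 / (K.ellPlus : ℤ)) then 0 else 1) ∧
    (p.2 - if Even (p.1 / (K.ellPlus : ℤ)) then 0 else 1) < (r.2 + 2) * K.height := by
  have h1 : (0 : ℤ) < K.ellPlus := by exact_mod_cast K.ellPlus_pos
  have h2 : (0 : ℤ) < K.height := by exact_mod_cast K.height_pos
  rw [← Int.le_ediv_iff_mul_le h1, ← Int.ediv_lt_iff_lt_mul h1,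
    ← Int.le_ediv_iff_mul_le h2, ← Int.ediv_lt_iff_lt_mul h2]
  simp only [RectNear, rectOf, abs_le]
  generalize (p.2 - if Even (p.1 / (K.ellPlus : ℤ)) then 0 else 1) / (K.height : ℤ) = y
  generalize p.1 / (K.ellPlus : ℤ) = x
  omega

/-- A function which is constant along horizontal bonds and coupled vertical bonds of a block of
`3 × 3` rectangles is constant on the block. -/
theorem eq_on_rectBlock {α : Type*} {f : Site → α} {r : RectIdx}
    (hh : ∀ p, RectNear (K.rectOf p) r → RectNear (K.rectOf (p.1 + 1, p.2)) r →
      f (p.1 + 1, p.2) = f p)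
    (hv : ∀ p, RectNear (K.rectOf p) r → K.IsLow p → f (up p) = f p) :
    ∃ a, ∀ p, RectNear (K.rectOf p) r → f p = a := by
  have hL : (0 : ℤ) < K.ellPlus := by exact_mod_cast K.ellPlus_pos
  have hH : (0 : ℤ) < K.height := by exact_mod_cast K.height_pos
  obtain ⟨k, j⟩ := r
  set L : ℤ := (K.ellPlus : ℤ) with hLdef
  set H : ℤ := (K.height : ℤ) with hHdef
  have hHe : Even H := K.even_height
  have hlow1 : Even ((j - 1) * H) := hHe.mul_left _
  have hlow2 : Even ((j + 2) * H) := hHe.mul_left _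
  have hLk : ∀ k' : ℤ, k' * L / L = k' := fun k' => Int.mul_ediv_cancel _ hL.ne'
  -- the rows met by all three columns
  have hmid : ∀ x i, (k - 1) * L ≤ x → x < (k + 2) * L → (j - 1) * H + 1 ≤ i → i < (j + 2) * H →
      RectNear (K.rectOf (x, i)) (k, j) := by
    intro x i h1 h2 h3 h4
    rw [rectNear_iff]
    refine ⟨⟨h1, h2⟩, ?_⟩
    rw [← hHdef]
    dsimp only
    split_ifs <;> constructor <;> linarith
  have hrow : ∀ x y i, (k - 1) * L ≤ x → x < (k + 2) * L → (k - 1) * L ≤ y → y < (k + 2) * L →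
      (j - 1) * H + 1 ≤ i → i < (j + 2) * H → f (x, i) = f (y, i) := by
    intro x y i hx hx' hy hy' hi hi'
    refine eq_of_succ_eq (f := fun x => f (x, i)) (a := (k - 1) * L) (b := (k + 2) * L)
      (fun z hz hz' => ?_) hx hx' hy hy'
    exact hh (z, i) (hmid z i hz (by linarith) hi hi') (hmid (z + 1) i (by linarith) hz' hi hi')
  have hx0 : (k - 1) * L ≤ k * L := by nlinarith
  have hx0' : k * L < (k + 2) * L := by nlinarith
  have hx1 : (k - 1) * L ≤ (k + 1) * L := by nlinarith
  have hx1' : (k + 1) * L < (k + 2) * L := by nlinarith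
  have hcol : ∀ i i', (j - 1) * H + 1 ≤ i → i < (j + 2) * H → (j - 1) * H + 1 ≤ i' →
      i' < (j + 2) * H → f (k * L, i) = f (k * L, i') := by
    intro i i' hi hi2 hi' hi2'
    refine eq_of_succ_eq (f := fun i => f (k * L, i)) (a := (j - 1) * H + 1) (b := (j + 2) * H)
      (fun z hz hz' => ?_) hi hi2 hi' hi2'
    -- On the chessboard, rows `z` and `z + 1` are coupled either in column `k` or in column `k +
    -- 1`; in the second case horizontal bonds lead there and back.
    by_cases he : Even (k + z)
    · refine hv (k * L, z) (hmid _ _ hx0 hx0' hz (by linarith)) ?_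
      unfold IsLow
      rwa [← hLdef, hLk]
    · have h1 := hv ((k + 1) * L, z) (hmid _ _ hx1 hx1' hz (by linarith)) (by
        unfold IsLow
        rw [← hLdef, hLk, add_right_comm, Int.even_add_one]
        exact he)
      exact (hrow _ _ _ hx0 hx0' hx1 hx1' (by linarith) hz').trans
        (h1.trans (hrow _ _ _ hx1 hx1' hx0 hx0' hz (by linarith)))
  refine ⟨f (k * L, (j - 1) * H + 1), fun p hp => ?_⟩
  have hwide : (j - 1) * H + 1 < (j + 2) * H := by
    obtain ⟨z, hz⟩ := hHe
    nlinarith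
  have hpmid : ∀ x i, (k - 1) * L ≤ x → x < (k + 2) * L → (j - 1) * H + 1 ≤ i → i < (j + 2) * H →
      f (x, i) = f (k * L, (j - 1) * H + 1) := fun x i h1 h2 h3 h4 =>
    (hrow x _ i h1 h2 hx0 hx0' h3 h4).trans (hcol _ _ h3 h4 le_rfl hwide)
  have hp' := hp
  rw [rectNear_iff] at hp
  obtain ⟨x, i⟩ := p
  obtain ⟨⟨h1, h2⟩, h3, h4⟩ := hp
  simp only [← hLdef, ← hHdef] at h1 h2 h3 h4
  -- Because of the shift, the lowest row of an even column and the highest row of an odd one are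
  -- not met by all columns. Each is coupled, within its own column, to a row which is.
  by_cases he : Even (x / L)
  · rw [if_pos he, sub_zero] at h3 h4
    rcases eq_or_lt_of_le h3 with h | h
    · have hl : K.IsLow (x, i) := by
        unfold IsLow
        exact he.add (h ▸ hlow1)
      rw [← hv (x, i) hp' hl]
      exact hpmid x (i + 1) h1 h2 (by linarith) (by linarith)
    · exact hpmid x i h1 h2 (by linarith) h4
  · rw [if_neg he] at h3 h4
    rcases eq_or_lt_of_le (show i ≤ (j + 2) * H by linarith) with h | h
    · have hl : K.IsLow (x, i - 1) := by
        unfold IsLow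
        rw [← hLdef]
        dsimp only
        rw [← add_sub_assoc, Int.even_sub_one, Int.even_add]
        simp only [he, h, hlow2]
        simp
      have h5 := hv (x, i - 1) (by rw [← K.rectOf_up hl]; simpa [up] using hp') hl
      have h6 : up (x, i - 1) = (x, i) := by simp [up]
      rw [h6] at h5
      rw [h5]
      exact hpmid x (i - 1) h1 h2 (by linarith) (by linarith)
    · exact hpmid x i h1 h2 (by linarith) h

/-- The defects of the phase indicator in a block where the phase is undetermined. -/
theorem exists_defect {σ : Config} {r : RectIdx} (h : K.Theta σ r = 0) :
    ∃ p, RectNear (K.rectOf p) r ∧ (K.eta σ p = 0 ∨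
      (RectNear (K.rectOf (p.1 + 1, p.2)) r ∧ K.eta σ (p.1 + 1, p.2) ≠ K.eta σ p) ∨
      (K.IsLow p ∧ K.eta σ (up p) ≠ K.eta σ p)) := by
  by_contra! hcon
  obtain ⟨s, hs⟩ := eq_on_rectBlock (K := K) (f := K.eta σ) (r := r)
    (fun p hp hp' => (hcon p hp).2.1 hp') (fun p hp hl => (hcon p hp).2.2 hl)
  obtain ⟨p, hp⟩ := K.Q_nonempty r
  have hn : RectNear (K.rectOf p) r := by rw [K.mem_Q.1 hp]; simp [RectNear]
  have hs0 : s ≠ 0 := by rw [← hs p hn]; exact (hcon p hn).1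
  have := theta_eq_of_etaOnBlock (σ := σ) (r := r) (s := s)
    (by revert hs0; cases s <;> decide) (etaOnBlock_iff.2 hs)
  rw [h] at this
  exact hs0 this.symm

/-- `A` is a union of undetermined rectangles of `σ`, surrounded by determined ones. -/
structure Isolated (K : KacModel) (σ : Config) (A : Finset RectIdx) : Prop where
  theta_eq_zero : ∀ r ∈ A, K.Theta σ r = 0
  theta_ne_zero : ∀ r ∉ A, ∀ r' ∈ A, RectNear r' r → K.Theta σ r ≠ 0

variable {σ₀ : Config} {A : Finset RectIdx} {d : ℕ}

/-- Near the boundary of an isolated set the phase is constant at short distances. -/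
theorem Isolated.exists_theta (hA : Isolated K σ₀ A) (hd : (d : ℤ) + 5 ≤ K.height) {p : Site}
    {r₀ : RectIdx} (hr₀ : r₀ ∈ A) (hpr : RectNear (K.rectOf p) r₀)
    (hp : p ∉ K.deep (K.region A) d) :
    ∃ r, K.Theta σ₀ r ≠ 0 ∧ ∀ q : Site, |q.1 / (K.tileLen : ℤ) - p.1 / (K.tileLen : ℤ)| ≤ 1 →
      |q.2 - p.2| ≤ 1 → K.eta σ₀ q = K.Theta σ₀ r := by
  by_cases hpA : K.rectOf p ∈ A
  · obtain ⟨r, hr, hnear⟩ := exists_close_of_notMem_deep hd hp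
    have h0 := hA.theta_ne_zero r hr _ hpA (hnear p (by simp) (by simp))
    exact ⟨r, h0, fun q h1 h2 => eta_eq_of_theta_near h0 (hnear q h1 h2)⟩
  · have h0 := hA.theta_ne_zero _ hpA _ hr₀ hpr.symm
    refine ⟨_, h0, fun q h1 h2 => eta_eq_of_theta_near h0 (K.rectNear_of_close ?_ ?_)⟩
    · linarith [Int.natCast_nonneg d]
    · linarith [Int.natCast_nonneg d]

theorem tile_succ (x : ℤ) : |(x + 1) / (K.tileLen : ℤ) - x / (K.tileLen : ℤ)| ≤ 1 := by
  refine K.tile_close ?_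
  have : (0 : ℤ) < K.tileLen := by exact_mod_cast K.tileLen_pos
  simp only [add_sub_cancel_left, abs_one]
  linarith

/-- The defects of an isolated set are in its inner part. -/
theorem Isolated.exists_defect (hA : Isolated K σ₀ A) (hd : (d : ℤ) + 5 ≤ K.height)
    {r₀ : RectIdx} (hr₀ : r₀ ∈ A) :
    ∃ p ∈ K.deep (K.region A) d, RectNear (K.rectOf p) r₀ ∧ (K.eta σ₀ p = 0 ∨
      ((p.1 + 1, p.2) ∈ K.deep (K.region A) d ∧ RectNear (K.rectOf (p.1 + 1, p.2)) r₀ ∧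
        K.eta σ₀ (p.1 + 1, p.2) ≠ K.eta σ₀ p) ∨
      (K.IsLow p ∧ K.eta σ₀ (up p) ≠ K.eta σ₀ p)) := by
  obtain ⟨p, hp, h⟩ := KacModel.exists_defect (hA.theta_eq_zero r₀ hr₀)
  have hpd : p ∈ K.deep (K.region A) d := by
    by_contra hcon
    obtain ⟨r, hr, hq⟩ := hA.exists_theta hd hr₀ hp hcon
    have hpp := hq p (by simp) (by simp)
    rcases h with h | h | h
    · exact hr (hpp.symm.trans h)
    · exact h.2 ((hq (p.1 + 1, p.2) (tile_succ _) (by simp)).trans hpp.symm)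
    · exact h.2 ((hq (up p) (by simp [up]) (by simp [up])).trans hpp.symm)
  refine ⟨p, hpd, hp, ?_⟩
  rcases h with h | h | h
  · exact Or.inl h
  · refine Or.inr (Or.inl ⟨?_, h⟩)
    by_contra hcon
    obtain ⟨r, hr, hq⟩ := hA.exists_theta hd hr₀ h.1 hcon
    refine h.2 ((hq _ (by simp) (by simp)).trans (hq p ?_ (by simp)).symm)
    rw [abs_sub_comm]
    exact tile_succ _
  · exact Or.inr (Or.inr h)

theorem sq_le_wellDist {m ζ a b : ℝ} (h0 : 0 ≤ ζ) (h1 : ζ ≤ |a - m| ∨ ζ ≤ |b - m|)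
    (h2 : ζ ≤ |a + m| ∨ ζ ≤ |b + m|) : ζ ^ 2 ≤ wellDist m a b := by
  have key : ∀ x y : ℝ, (ζ ≤ |x| ∨ ζ ≤ |y|) → ζ ^ 2 ≤ x ^ 2 + y ^ 2 := by
    intro x y h
    rcases h with h | h
    · have := sq_abs x
      nlinarith [sq_nonneg y]
    · have := sq_abs y
      nlinarith [sq_nonneg x]
  exact le_min (key _ _ h1) (key _ _ h2)

theorem blockClosed_filter_rectOf {ℓ : ℕ} (hd : ℓ ∣ K.ellPlus) {M : Finset Site}
    (hM : BlockClosed ℓ M) (r : RectIdx) : BlockClosed ℓ (M.filter fun p => K.rectOf p = r) := by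
  intro p q h2 h1 hp
  rw [Finset.mem_filter] at hp ⊢
  exact ⟨hM p q h2 h1 hp.1, by rw [K.rectOf_congr h2 (ediv_eq_of_dvd hd h1)]; exact hp.2⟩

theorem pairClosed_filter_rectOf {M : Finset Site} (hM : K.PairClosed M) (r : RectIdx) :
    K.PairClosed (M.filter fun p => K.rectOf p = r) := by
  intro p hp
  rw [Finset.mem_filter, Finset.mem_filter, hM p hp, K.rectOf_up hp]

theorem sum_partExcess {m : ℝ} {M : Finset Site} {u : Site → ℝ} {A : Finset RectIdx}
    (hM : ∀ p ∈ M, K.rectOf p ∈ A) :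
    ∑ r ∈ A, K.partExcess m M (M.filter fun p => K.rectOf p = r) u = K.excess m M u := by
  simp only [partExcess, excess, dirichlet, Finset.sum_add_distrib, ← Finset.mul_sum]
  have h1 : ∀ r, K.lowSites (M.filter fun p => K.rectOf p = r) =
      (K.lowSites M).filter fun p => K.rectOf p = r := fun r => by
    ext p
    simp only [mem_lowSites, Finset.mem_filter]
    tauto
  simp only [h1]
  rw [Finset.sum_fiberwise_of_maps_to fun p hp => hM p (K.mem_lowSites.1 hp).1,
    Finset.sum_fiberwise_of_maps_to hM]

/-- The excess free energy of a configuration with the phases of an isolated set. -/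
theorem KernelBounds.mul_card_le_excess {C c κ : ℝ} {k₀ : ℕ} (hK : K.KernelBounds C c k₀)
    (hc : 0 < c) (hα : K.α ≤ 1 / 2) (hκ : 0 < κ)
    (hwell : ∀ x y : ℝ, |x| ≤ 1 → |y| ≤ 1 → κ * wellDist (spontMag K.ε) x y ≤
      dualEnergy K.ε x y - dualEnergy K.ε (spontMag K.ε) (spontMag K.ε))
    (hℓk : 2 * K.ellMinus * 2 ^ k₀ ≤ 2 ^ K.scales.n) (hκℓ : c * K.γ * K.ellMinus ≤ 4 * κ)
    (hζ0 : 0 ≤ K.zeta) (hζ : 2 * K.zeta < spontMag K.ε)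
    (hA : Isolated K σ₀ A) (hd : (d : ℤ) + 5 ≤ K.height) {σ : Config}
    (hσ : ∀ p ∈ K.region A, K.eta σ p = K.eta σ₀ p) :
    A.card * (c * K.γ * K.ellMinus ^ 2 * K.zeta ^ 2 / 8) ≤
      9 * K.excess (spontMag K.ε) (K.deep (K.region A) d) (K.profile σ) := by
  classical
  set m := spontMag K.ε with hm
  set M := K.deep (K.region A) d with hM
  set g := c * K.γ * K.ellMinus ^ 2 * K.zeta ^ 2 / 8 with hg
  have hu := abs_profile_le (K := K) σ
  set u := K.profile σ with hudef
  have hℓ := K.ellMinus_pos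
  have hdP : K.ellMinus ∣ K.ellPlus := K.ellMinus_dvd_tileLen.trans K.tileLen_dvd_ellPlus
  have hav : ∀ p, blockAvg K.ellMinus u p = K.empMag σ p := fun p => by
    rw [hudef, profile, blockAvg_blockAvg K.blockLen_pos hℓ (K.blockLen_dvd_ellMinus hα), empMag_eq]
  have hMB : BlockClosed K.ellMinus M := blockClosed_deep K.ellMinus_dvd_tileLen d
  have hMP : K.PairClosed M := pairClosed_deep d
  have hMσ : ∀ p ∈ M, K.eta σ p = K.eta σ₀ p := fun p hp => hσ p (deep_subset d hp)
  have hℓk' : K.ellMinus * 2 ^ k₀ ≤ 2 ^ K.scales.n := le_trans (by gcongr; omega) hℓk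
  have hzero : ∀ p, K.eta σ p = 0 → K.zeta ≤ |K.empMag σ p - m| ∧ K.zeta ≤ |K.empMag σ p + m| := by
    intro p hp
    unfold eta at hp
    split_ifs at hp with h1 h2
    exact ⟨(not_le.1 h1).le, (not_le.1 h2).le⟩
  have hne : ∀ p q, K.eta σ p ≠ 0 → K.eta σ q ≠ 0 → K.eta σ p ≠ K.eta σ q →
      (|K.empMag σ p - m| ≤ K.zeta ∧ |K.empMag σ q + m| ≤ K.zeta) ∨
      (|K.empMag σ p + m| ≤ K.zeta ∧ |K.empMag σ q - m| ≤ K.zeta) := by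
    intro p q hp hq hpq
    have h1 := fun p => eta_eq_one_iff (K := K) (σ := σ) (p := p)
    have h2 := fun p => eta_eq_neg_one_iff (K := K) (by linarith) (σ := σ) (p := p)
    simp only [← hm] at h1 h2
    rw [← h1, ← h1, ← h2, ← h2]
    generalize K.eta σ p = s at *
    generalize K.eta σ q = t at *
    revert hp hq hpq
    cases s <;> cases t <;> decide
  set e : RectIdx → ℝ := fun r => K.partExcess m M (M.filter fun p => K.rectOf p = r) u with he
  have he0 : ∀ r, 0 ≤ e r := fun r => hK.partExcess_nonneg hκ hu hwell _ _
  have hMA : ∀ p ∈ M, K.rectOf p ∈ A := fun p hp => K.mem_region.1 (deep_subset d hp)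
  -- a pair far from the wells
  have hpair : ∀ p ∈ M, K.zeta ^ 2 ≤ wellDist m (K.empMag σ (K.lowRep p))
      (K.empMag σ (up (K.lowRep p))) → g ≤ e (K.rectOf p) := by
    intro p hp hw
    refine hK.le_partExcess_of_pair hu hwell hc hℓ hℓk' hκℓ hdP
      (pairClosed_filter_rectOf hMP _) (blockClosed_filter_rectOf hdP hMB _)
      (Finset.filter_subset _ _) hMB (p := K.lowRep p) ?_ (by rw [hav, hav]; exact hw)
    rw [mem_lowSites, Finset.mem_filter]
    exact ⟨⟨hMP.lowRep_mem.2 hp, K.rectOf_lowRep p⟩, K.isLow_lowRep p⟩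
  have hz : ∀ p ∈ M, K.eta σ p = 0 → g ≤ e (K.rectOf p) := by
    intro p hp h0
    obtain ⟨h1, h2⟩ := hzero p h0
    refine hpair p hp (sq_le_wellDist hζ0 ?_ ?_)
    · rcases K.eq_lowRep_or p with h | h
      · left; rwa [← h]
      · right; rwa [← h]
    · rcases K.eq_lowRep_or p with h | h
      · left; rwa [← h]
      · right; rwa [← h]
  -- Where `η = 0`, a pair is at distance at least `ζ` from both wells. Opposite phases in adjacent
  -- cells differ by at least `2 m - 2 ζ > ζ`, which costs Dirichlet energy. Opposite phases in a
  -- coupled pair put it near `±(m, -m)`, again far from both wells.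
  have hcost : ∀ r₀ ∈ A, ∃ r ∈ A, RectNear r r₀ ∧ g ≤ e r := by
    intro r₀ hr₀
    obtain ⟨p, hp, hpr, h⟩ := hA.exists_defect hd hr₀
    by_cases h0 : K.eta σ p = 0
    · exact ⟨K.rectOf p, hMA p hp, hpr, hz p hp h0⟩
    rcases h with h | ⟨hq, hqr, h⟩ | ⟨hl, h⟩
    · exact absurd ((hMσ p hp).trans h) h0
    · rw [← hMσ p hp, ← hMσ _ hq] at h
      by_cases h0' : K.eta σ (p.1 + 1, p.2) = 0
      · exact ⟨_, hMA _ hq, hqr, hz _ hq h0'⟩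
      refine ⟨K.rectOf p, hMA p hp, hpr, ?_⟩
      have hcell : |(p.1 + 1) / (K.ellMinus : ℤ) - p.1 / (K.ellMinus : ℤ)| ≤ 1 := by
        have : (0 : ℤ) < K.ellMinus := by exact_mod_cast hℓ
        refine ediv_near this ?_
        simp only [add_sub_cancel_left, abs_one]
        linarith
      refine hK.le_partExcess_of_step hκ hu hwell hc hℓ hℓk
        (blockClosed_filter_rectOf hdP hMB _) hMB (p := p) (q := (p.1 + 1, p.2))
        (Finset.mem_filter.2 ⟨hp, rfl⟩) hq rfl hcell ?_
      rw [hav, hav]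
      rcases hne _ _ h0' h0 h with ⟨h3, h4⟩ | ⟨h3, h4⟩
      · rw [abs_le] at h3 h4
        nlinarith [h3.1, h4.2]
      · rw [abs_le] at h3 h4
        nlinarith [h3.2, h4.1]
    · refine ⟨K.rectOf p, hMA p hp, hpr, ?_⟩
      have hup : up p ∈ M := (hMP p hl).1 hp
      rw [← hMσ p hp, ← hMσ _ hup] at h
      by_cases h0' : K.eta σ (up p) = 0
      · rw [← K.rectOf_up hl]
        exact hz _ hup h0'
      · refine hpair p hp ?_
        rw [K.lowRep_of_isLow hl]
        rcases hne _ _ h0' h0 h with ⟨h3, h4⟩ | ⟨h3, h4⟩ <;> rw [abs_le] at h3 h4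
        · refine sq_le_wellDist hζ0 (Or.inl ?_) (Or.inr ?_)
          · rw [abs_sub_comm]; exact le_trans (by linarith [h4.2]) (le_abs_self _)
          · exact le_trans (by linarith [h3.1]) (le_abs_self _)
        · refine sq_le_wellDist hζ0 (Or.inr ?_) (Or.inl ?_)
          · rw [abs_sub_comm]; exact le_trans (by linarith [h3.2]) (le_abs_self _)
          · exact le_trans (by linarith [h4.1]) (le_abs_self _)
  calc A.card * g = ∑ r₀ ∈ A, g := by rw [Finset.sum_const, nsmul_eq_mul]
    _ ≤ ∑ r₀ ∈ A, ∑ r ∈ A, if RectNear r r₀ then e r else 0 := by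
        refine Finset.sum_le_sum fun r₀ hr₀ => ?_
        obtain ⟨r, hr, hn, hge⟩ := hcost r₀ hr₀
        refine hge.trans ?_
        have := Finset.single_le_sum (f := fun r => if RectNear r r₀ then e r else 0)
          (fun r _ => by split_ifs; exacts [he0 r, le_rfl]) hr
        simpa [hn] using this
    -- The same cost may serve all rectangles near `r`, itself included: at most nine.
    _ = ∑ r ∈ A, ((A.filter (RectNear r)).card : ℝ) * e r := by
        rw [Finset.sum_comm]
        refine Finset.sum_congr rfl fun r _ => ?_
        rw [← Finset.sum_filter, Finset.sum_const, nsmul_eq_mul]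
    _ ≤ ∑ r ∈ A, 9 * e r := by
        refine Finset.sum_le_sum fun r _ => mul_le_mul_of_nonneg_right ?_ (he0 r)
        exact_mod_cast card_filter_rectNear_le A r
    _ = 9 * K.excess m M u := by rw [← Finset.mul_sum, sum_partExcess hMA]

end KacModel


/-! ### Boundary layers -/

/-- If every increment were large, `E` would gain a factor `1 + 1 / (2 b)` with each step outwards,
hence its `N`-th power in total. -/
theorem exists_small_increment {E y : ℕ → ℝ} {b : ℝ} (hb : 0 < b) {N : ℕ}
    (h : ∀ d < N, E (d + 1) + y d ≤ E d) (hN : E 0 < (1 + 1 / (2 * b)) ^ N * E N) :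
    ∃ d < N, b * y d ≤ (1 / 2) * E (d + 1) := by
  by_contra! hcon
  have key : ∀ k ≤ N, (1 + 1 / (2 * b)) ^ k * E k ≤ E 0 := by
    intro k
    induction k with
    | zero => simp
    | succ k ih =>
      intro hk
      refine le_trans ?_ (ih (by omega))
      have h1 := hcon k (by omega)
      have h2 := h k (by omega)
      rw [pow_succ, mul_assoc]
      gcongr
      have h3 : 1 / (2 * b) * E (k + 1) ≤ y k := by
        rw [div_mul_eq_mul_div, div_le_iff₀ (by positivity)]
        linarith
      linarith
  exact absurd hN (not_lt.2 (key N le_rfl))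

namespace KacModel

variable {K : KacModel} {C c κ : ℝ} {k₀ d : ℕ}

/-- Only the boundary layer interacts with the inner part. -/
theorem KernelBounds.sum_siteKer_layer_le (hK : K.KernelBounds C c k₀) (hCγ : C * K.γ ≤ 1)
    (Λ U : Finset Site) {f : Site → ℝ} (hf : ∀ q, 0 ≤ f q) :
    ∑ p ∈ K.deep Λ (d + 1), ∑ q ∈ U \ K.deep Λ (d + 1), K.siteKer p q * f q ≤
      2 * ∑ q ∈ K.deep Λ d \ K.deep Λ (d + 1), f q := by
  calc _ ≤ ∑ p ∈ K.deep Λ (d + 1), ∑ q ∈ K.deep Λ d \ K.deep Λ (d + 1), K.siteKer p q * f q := by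
        refine Finset.sum_le_sum fun p hp => ?_
        rw [← Finset.sum_filter_ne_zero]
        refine Finset.sum_le_sum_of_subset_of_nonneg (fun q hq => ?_)
          fun q _ _ => mul_nonneg (hK.siteKer_nonneg p q) (hf q)
        obtain ⟨hq, hne⟩ := Finset.mem_filter.1 hq
        have h := hK.close_of_siteKer_ne_zero (left_ne_zero_of_mul hne)
        exact Finset.mem_sdiff.2 ⟨mem_deep_of_close hp h.2 h.1, (Finset.mem_sdiff.1 hq).2⟩
    _ = ∑ q ∈ K.deep Λ d \ K.deep Λ (d + 1), (∑ p ∈ K.deep Λ (d + 1), K.siteKer q p) * f q := by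
        rw [Finset.sum_comm]
        refine Finset.sum_congr rfl fun q _ => ?_
        rw [Finset.sum_mul]
        exact Finset.sum_congr rfl fun p _ => by rw [hK.siteKer_comm]
    _ ≤ ∑ q ∈ K.deep Λ d \ K.deep Λ (d + 1), 2 * f q :=
        Finset.sum_le_sum fun q _ =>
          mul_le_mul_of_nonneg_right (hK.sum_siteKer_le_two hCγ q _) (hf q)
    _ = _ := by rw [Finset.mul_sum]

variable {σ₀ σ : Config} {A : Finset RectIdx}

/-- In the boundary layers of an isolated set, the profile is close to a well. -/
theorem KernelBounds.sum_sq_layer_le (hK : K.KernelBounds C c k₀)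
    (hc : 0 < c) (hα : K.α ≤ 1 / 2) (hκ : 0 < κ)
    (hwell : ∀ x y : ℝ, |x| ≤ 1 → |y| ≤ 1 → κ * wellDist (spontMag K.ε) x y ≤
      dualEnergy K.ε x y - dualEnergy K.ε (spontMag K.ε) (spontMag K.ε))
    (hk₀ : k₀ ≤ K.scales.vert) (hζ : K.zeta < spontMag K.ε)
    (hA : Isolated K σ₀ A) (hd : (d : ℤ) + 6 ≤ K.height)
    (hσ : ∀ p ∈ K.region A, K.eta σ p = K.eta σ₀ p) :
    ∑ q ∈ K.deep (K.region A) d \ K.deep (K.region A) (d + 1),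
        (K.profile σ q - (K.eta σ₀ q : ℝ) * spontMag K.ε) ^ 2 ≤
      (24 * 2 ^ k₀ / c + 4 / κ) * K.excess (spontMag K.ε)
        (K.deep (K.region A) d \ K.deep (K.region A) (d + 1)) (K.profile σ) := by
  have hnv := K.minus_add_vert
  have hw : 2 ^ (K.scales.n - k₀) ∣ K.tileLen := pow_dvd_pow 2 (by omega)
  have hw' : K.ellMinus ∣ 2 ^ (K.scales.n - k₀) := pow_dvd_pow 2 (by omega)
  have hw0 : 0 < 2 ^ (K.scales.n - k₀) := by positivity
  set Y := K.deep (K.region A) d \ K.deep (K.region A) (d + 1) with hY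
  have hYA : ∀ p ∈ Y, p ∈ K.region A := fun p hp => deep_subset d (Finset.mem_sdiff.1 hp).1
  have hYB : BlockClosed (2 ^ (K.scales.n - k₀)) Y :=
    (blockClosed_deep hw _).sdiff (blockClosed_deep hw _)
  have hYP : K.PairClosed Y := (pairClosed_deep _).sdiff (pairClosed_deep _)
  have hθ : ∀ p ∈ Y, ∃ r, K.Theta σ₀ r ≠ 0 ∧ ∀ q : Site,
      |q.1 / (K.tileLen : ℤ) - p.1 / (K.tileLen : ℤ)| ≤ 1 →
      |q.2 - p.2| ≤ 1 → K.eta σ₀ q = K.Theta σ₀ r := fun p hp =>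
    hA.exists_theta (by push_cast; linarith) (K.mem_region.1 (hYA p hp)) (by simp [RectNear])
      (Finset.mem_sdiff.1 hp).2
  have hsign : ∀ s : SignType, s ≠ 0 → s = 1 ∨ s = -1 := by decide
  refine hK.sum_sq_sub_well_le hκ (abs_profile_le σ) hwell hc (by omega) hYP hYB hζ
    (t := fun q => (K.eta σ₀ q : ℝ)) (fun p hp => ?_) (fun p hp => ?_) (fun p hp => ?_)
  · obtain ⟨r, hr, h⟩ := hθ p hp
    rw [h p (by simp) (by simp)]
    rcases hsign _ hr with h | h <;> simp [h]
  · obtain ⟨r, hr, h⟩ := hθ p (K.mem_lowSites.1 hp).1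
    rw [h p (by simp) (by simp), h (up p) (by simp [up]) (by simp [up])]
  · obtain ⟨r, hr, h⟩ := hθ p hp
    rw [h p (by simp) (by simp), ← blockAvg_blockAvg K.ellMinus_pos hw0 hw', abs_sub_comm]
    -- The average over the large block is an average of magnetizations of cells of length `ℓ₋`, all
    -- within `ζ` of the same well.
    refine abs_sub_blockAvg_le hw0 fun q hq => ?_
    have hq' := (mem_blockOf hw0).1 hq
    have hqY := hYB.blockOf_subset hw0 hp hq
    rw [profile, blockAvg_blockAvg K.blockLen_pos K.ellMinus_pos (K.blockLen_dvd_ellMinus hα),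
      ← empMag_eq, abs_sub_comm, ← eta_eq_iff hζ (hsign _ hr), hσ q (hYA q hqY)]
    refine h q ?_ (by simp [hq'.1])
    rw [ediv_eq_of_dvd hw hq'.2]
    simp

end KacModel


/-! ### The phases outside a contour -/

theorem IsStarComponent.eq_of_mem {S B B' : Set RectIdx} (hB : IsStarComponent S B)
    (hB' : IsStarComponent S B') {q : RectIdx} (hq : q ∈ B) (hq' : q ∈ B') : B = B' := by
  have hun : (starGraph.induce (B ∪ B')).Connected :=
    SimpleGraph.induce_union_connected hB.prop.2.preconnected hB'.prop.2.preconnected ⟨q, hq, hq'⟩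
  have hS := Set.union_subset hB.prop.1 hB'.prop.1
  exact subset_antisymm (Set.subset_union_left.trans (hB'.le_of_ge ⟨hS, hun⟩ Set.subset_union_right))
    (Set.subset_union_right.trans (hB.le_of_ge ⟨hS, hun⟩ Set.subset_union_left))

namespace KacModel

variable {K : KacModel} {Γ : Contour} {σ₀ : Config} {s : SignType}

theorem IsContourOf.isolated (h : K.IsContourOf σ₀ Γ) : Isolated K σ₀ Γ.sp where
  theta_eq_zero _ hr := h.2.1.prop.1 hr
  theta_ne_zero _ hr _ hr' hn :=
    (K.theta_eq_of_isContourOf h h hr hr' (hn.symm.adj fun he => hr (he ▸ hr'))).1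

/-- The phases of the components of the complement of `A`, for a contour of sign `s`. -/
structure OuterPhase (K : KacModel) (σ₀ : Config) (A : Finset RectIdx) (s : SignType)
    (τ : RectIdx → SignType) : Prop where
  ne_zero : ∀ r ∉ A, τ r ≠ 0
  near : ∀ r ∉ A, ∀ r' ∉ A, RectNear r r' → τ r = τ r'
  eq_theta : ∀ r ∉ A, ∀ r' ∈ A, RectNear r' r → τ r = K.Theta σ₀ r
  ext : ∀ r ∈ extRects (A : Set RectIdx), τ r = s

/-- `Θ` agrees on adjacent rectangles of an outer boundary, since each determines `η` on the other.
By `eq_on_outBoundary` it has one sign per component, which is assigned to the whole component even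
where `Θ` of `σ₀` itself varies. -/
theorem IsContourOf.exists_outerPhase (h : K.IsContourOf σ₀ Γ) (hs : s ≠ 0)
    (hext : ∀ q ∈ outBoundary Γ.sp (extRects Γ.sp), K.Theta σ₀ q = s) :
    ∃ τ, OuterPhase K σ₀ Γ.sp s τ := by
  classical
  have hiso := h.isolated
  set A : Set RectIdx := (Γ.sp : Set RectIdx) with hA
  have hne : ∀ B, ∀ q ∈ outBoundary A B, q ∉ Γ.sp → K.Theta σ₀ q ≠ 0 := by
    rintro B q ⟨_, q', hq', hadj⟩ hq
    exact hiso.theta_ne_zero q hq q' hq' ⟨hadj.symm.2.1, hadj.symm.2.2⟩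
  have hconst : ∀ B, IsStarComponent Aᶜ B → ∀ q ∈ outBoundary A B, ∀ q' ∈ outBoundary A B,
      K.Theta σ₀ q = K.Theta σ₀ q' := by
    intro B hB q hq q' hq'
    refine eq_on_outBoundary h.2.1.prop.2 hB (fun x hx y hy hadj => ?_) hq hq'
    obtain ⟨p, hp⟩ := K.Q_nonempty y
    rw [← K.eta_eq_of_theta (hne B x hx (hB.prop.1 hx.1)) hadj hp]
    exact eta_eq_of_theta_near (hne B y hy (hB.prop.1 hy.1))
      (by rw [K.mem_Q.1 hp]; simp [RectNear])
  set P : RectIdx → SignType → Prop := fun r t => ∃ B, IsStarComponent Aᶜ B ∧ r ∈ B ∧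
    ∃ q ∈ outBoundary A B, K.Theta σ₀ q = t with hP
  have huniq : ∀ r t t', P r t → P r t' → t = t' := by
    rintro r t t' ⟨B, hB, hr, q, hq, rfl⟩ ⟨B', hB', hr', q', hq', rfl⟩
    obtain rfl := hB.eq_of_mem hB' hr hr'
    exact hconst B hB q hq q' hq'
  -- The choice depends on `r` only through the predicate `P r`, which is shared by a whole
  -- component. The default `s` covers components without boundary, whose absence need not be shown.
  set F : (SignType → Prop) → SignType := fun R => if hR : ∃ t, R t then hR.choose else s with hF
  have hFP : ∀ r t, P r t → F (P r) = t := by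
    intro r t ht
    have hex : ∃ t, P r t := ⟨t, ht⟩
    simp only [hF, dif_pos hex]
    exact huniq r _ _ hex.choose_spec ht
  have hFn : ∀ r, (¬∃ t, P r t) → F (P r) = s := fun r hr => dif_neg hr
  refine ⟨fun r => F (P r), fun r hr => ?_, fun r hr r' hr' hn => ?_, fun r hr r' hr' hn => ?_,
    fun r hr => ?_⟩
  · by_cases hex : ∃ t, P r t
    · obtain ⟨t, ht⟩ := hex
      rw [hFP r t ht]
      obtain ⟨B, hB, _, q, hq, rfl⟩ := ht
      exact hne B q hq (hB.prop.1 hq.1)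
    · rw [hFn r hex]
      exact hs
  · by_cases heq : r = r'
    · rw [heq]
    have hadj := hn.adj heq
    have : P r = P r' := by
      funext t
      refine propext ⟨?_, ?_⟩
      · rintro ⟨B, hB, hrB, hq⟩
        exact ⟨B, hB, hB.mem_of_adj hrB hr' hadj, hq⟩
      · rintro ⟨B, hB, hrB, hq⟩
        exact ⟨B, hB, hB.mem_of_adj hrB hr hadj.symm, hq⟩
    rw [this]
  · obtain ⟨B, hB, hrB⟩ := exists_isStarComponent (S := Aᶜ) (q := r) hr
    exact hFP r _ ⟨B, hB, hrB, r, ⟨hrB, r', hr', hn.symm.adj fun he => hr (he ▸ hr')⟩, rfl⟩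
  · by_cases hex : ∃ t, P r t
    · obtain ⟨t, ht⟩ := hex
      rw [hFP r t ht]
      obtain ⟨B, hB, hrB, q, hq, rfl⟩ := ht
      obtain ⟨B', hB', hinf, hrB'⟩ := hr
      obtain rfl := hB.eq_of_mem hB' hrB hrB'
      exact hext q ⟨⟨B, hB, hinf, hq.1⟩, hq.2⟩
    · exact hFn r hex

/-- Every rectangle is in the support, in an interior, or in the exterior. -/
theorem mem_extRects_of_notMem {A : Finset RectIdx} {r : RectIdx}
    (h : r ∉ filledRects (A : Set RectIdx)) : r ∈ extRects (A : Set RectIdx) := by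
  have hr : r ∈ (A : Set RectIdx)ᶜ := fun hA => h (Or.inl hA)
  obtain ⟨B, hB, hrB⟩ := exists_isStarComponent hr
  exact ⟨B, hB, fun hfin => h (Or.inr ⟨B, ⟨hB, hfin⟩, hrB⟩), hrB⟩

theorem mem_filled {p : Site} : p ∈ K.filled Γ ↔ K.rectOf p ∈ filledRects (Γ.sp : Set RectIdx) := by
  rw [filled, mem_region, Set.Finite.mem_toFinset]

theorem region_subset_filled : K.region Γ.sp ⊆ K.filled Γ := fun p hp => by
  rw [mem_filled]
  exact Or.inl (K.mem_region.1 hp)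

open Classical in
/-- The phase at `p`: that of the contour in its support, that of the component outside. -/
noncomputable def phaseAt (K : KacModel) (σ₀ : Config) (A : Finset RectIdx)
    (τ : RectIdx → SignType) (p : Site) : SignType :=
  if K.rectOf p ∈ A then K.eta σ₀ p else τ (K.rectOf p)

variable {A : Finset RectIdx} {τ : RectIdx → SignType} {d : ℕ}

theorem phaseAt_of_mem {p : Site} (h : K.rectOf p ∈ A) : K.phaseAt σ₀ A τ p = K.eta σ₀ p := if_pos h

theorem phaseAt_of_notMem {p : Site} (h : K.rectOf p ∉ A) :
    K.phaseAt σ₀ A τ p = τ (K.rectOf p) := if_neg h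

/-- Outside the inner part of the contour, the phase is constant at short distances. -/
theorem OuterPhase.phaseAt_close (hτ : OuterPhase K σ₀ A s τ) (hA : Isolated K σ₀ A)
    (hd : (d : ℤ) + 5 ≤ K.height) {p : Site} (hp : p ∉ K.deep (K.region A) d) :
    K.phaseAt σ₀ A τ p ≠ 0 ∧ ∀ q : Site, |q.1 / (K.tileLen : ℤ) - p.1 / (K.tileLen : ℤ)| ≤ 1 →
      |q.2 - p.2| ≤ 1 → K.phaseAt σ₀ A τ q = K.phaseAt σ₀ A τ p := by
  suffices h : ∃ t : SignType, t ≠ 0 ∧ ∀ q : Site,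
      |q.1 / (K.tileLen : ℤ) - p.1 / (K.tileLen : ℤ)| ≤ 1 → |q.2 - p.2| ≤ 1 →
      K.phaseAt σ₀ A τ q = t by
    obtain ⟨t, ht, h⟩ := h
    have hp := h p (by simp) (by simp)
    exact ⟨hp ▸ ht, fun q h1 h2 => (h q h1 h2).trans hp.symm⟩
  by_cases hpA : K.rectOf p ∈ A
  · obtain ⟨r, hr, hnear⟩ := exists_close_of_notMem_deep hd hp
    have hpr := hnear p (by simp) (by simp)
    have h0 := hA.theta_ne_zero r hr _ hpA hpr
    refine ⟨_, h0, fun q h1 h2 => ?_⟩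
    by_cases hq : K.rectOf q ∈ A
    · rw [phaseAt_of_mem hq]
      exact eta_eq_of_theta_near h0 (hnear q h1 h2)
    · rw [phaseAt_of_notMem hq, hτ.near _ hq r hr (hnear q h1 h2)]
      exact hτ.eq_theta r hr _ hpA hpr
  · refine ⟨_, hτ.ne_zero _ hpA, fun q h1 h2 => ?_⟩
    have hn : RectNear (K.rectOf q) (K.rectOf p) :=
      K.rectNear_of_close (by linarith [Int.natCast_nonneg d]) (by linarith [Int.natCast_nonneg d])
    by_cases hq : K.rectOf q ∈ A
    · rw [phaseAt_of_mem hq, hτ.eq_theta _ hpA _ hq hn]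
      exact eta_eq_of_theta_near (hA.theta_ne_zero _ hpA _ hq hn) hn
    · rw [phaseAt_of_notMem hq]
      exact hτ.near _ hq _ hpA hn

/-- A configuration with the phases of the contour has the phase `phaseAt` near the contour,
outside the inner part. -/
theorem OuterPhase.eta_eq_phaseAt (hτ : OuterPhase K σ₀ Γ.sp s τ) (h : K.IsContourOf σ₀ Γ)
    {σbar σ : Config} (hbar : K.IsBoundarySpins s Γ σbar) (hσ : σ ∈ K.numConstraint Γ)
    (hσbar : ∀ p ∉ K.filled Γ, σ p = σbar p) {r : RectIdx}
    (hr : r ∈ Γ.sp ∨ ∃ B, IsInterior (Γ.sp : Set RectIdx) B ∧ r ∈ outBoundary Γ.sp B)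
    {p : Site} (hp : RectNear (K.rectOf p) r) : K.eta σ p = K.phaseAt σ₀ Γ.sp τ p := by
  -- The sign required of an interior in the numerator is witnessed by `σ₀`, whose `Θ` agrees with
  -- `τ` along the boundary.
  have hint : ∀ B, IsInterior (Γ.sp : Set RectIdx) B → ∀ q ∈ outBoundary Γ.sp B,
      K.Theta σ q = τ q := by
    intro B hB q hq
    refine hσ.2 B hB (τ q) ⟨σ₀, h, fun q' hq' => ?_⟩ q hq
    have hout : ∀ x ∈ outBoundary (Γ.sp : Set RectIdx) B, τ x = K.Theta σ₀ x := by
      rintro x ⟨hx, y, hy, hadj⟩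
      exact hτ.eq_theta x (hB.1.prop.1 hx) y hy ⟨hadj.symm.2.1, hadj.symm.2.2⟩
    rw [← hout q' hq']
    exact eq_of_induce_connected hB.1.prop.2 (fun x hx y hy hadj =>
      hτ.near x (hB.1.prop.1 hx) y (hB.1.prop.1 hy) ⟨hadj.2.1, hadj.2.2⟩) hq'.1 hq.1
  by_cases hpA : K.rectOf p ∈ Γ.sp
  · have hpr := K.mem_region.2 hpA
    rw [phaseAt_of_mem hpA, hσ.1 p hpr, h.2.2 p hpr]
  rw [phaseAt_of_notMem hpA]
  rcases hr with hr | ⟨B, hB, hr⟩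
  · have hadj : starGraph.Adj (K.rectOf p) r := hp.adj fun he => hpA (he ▸ hr)
    by_cases hf : K.rectOf p ∈ filledRects (Γ.sp : Set RectIdx)
    · rcases hf with hf | ⟨B, hB, hf⟩
      · exact absurd hf hpA
      · have h1 := hint B hB _ ⟨hf, r, hr, hadj⟩
        rw [← h1]
        exact eta_eq_of_theta_near (by rw [h1]; exact hτ.ne_zero _ hpA) (by simp [RectNear])
    · have hext := mem_extRects_of_notMem hf
      rw [hτ.ext _ hext, ← hbar _ ⟨hext, r, hr, hadj⟩ p (K.mem_Q.2 rfl)]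
      refine eta_congr ?_
      rw [empMag_eq, empMag_eq]
      refine blockAvg_congr fun q hq => ?_
      have hq' := (mem_blockOf K.ellMinus_pos).1 hq
      unfold spinVal
      rw [hσbar q ?_]
      rw [mem_filled, K.rectOf_congr hq'.1
        (ediv_eq_of_dvd (K.ellMinus_dvd_tileLen.trans K.tileLen_dvd_ellPlus) hq'.2)]
      exact hf
  · have hrA : r ∉ Γ.sp := hB.1.prop.1 hr.1
    have h1 := hint B hB r hr
    rw [hτ.near _ hpA r hrA hp, ← h1]
    exact eta_eq_of_theta_near (by rw [h1]; exact hτ.ne_zero _ hrA) hp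

end KacModel


/-! ### Flipping the phases -/

theorem spinSum_congr_boundary {Λ : Finset Site} {σ σ' : Config} (h : ∀ p ∉ Λ, σ p = σ' p)
    (F : Config → ℝ) : spinSum Λ σ F = spinSum Λ σ' F := by
  unfold spinSum
  refine Finset.sum_congr rfl fun τ _ => ?_
  congr 1
  funext p
  by_cases hp : p ∈ Λ
  · rw [glue_of_mem _ _ hp, glue_of_mem _ _ hp]
  · rw [glue_of_notMem _ _ hp, glue_of_notMem _ _ hp, h p hp]

theorem config_mul_self (θ : Config) : θ * θ = 1 := by
  funext p
  exact Int.units_mul_self _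

/-- The unit `±1` of a sign. -/
def signUnit (s : SignType) : ℤˣ := if s = -1 then -1 else 1

theorem coe_signUnit {s : SignType} (hs : s ≠ 0) : (((signUnit s : ℤˣ) : ℤ) : ℝ) = (s : ℝ) := by
  have h : s = 1 ∨ s = -1 := by revert hs; cases s <;> decide
  rcases h with rfl | rfl
  · have : signUnit 1 = 1 := by decide
    rw [this]; simp
  · have : signUnit (-1) = -1 := by decide
    rw [this]; simp

theorem sign_coe_mul_self {s : SignType} (hs : s ≠ 0) : (s : ℝ) * s = 1 := by
  have h : s = 1 ∨ s = -1 := by revert hs; cases s <;> decide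
  rcases h with rfl | rfl <;> simp

namespace KacModel

variable {K : KacModel} {C c : ℝ} {k₀ : ℕ} {M Λ U : Finset Site}

/-- The part of the energy in `Λ` which does not involve the spins in `M`. -/
theorem KernelBounds.energy_sub_eq (hK : K.KernelBounds C c k₀) (hM : K.PairClosed M)
    (hΛ : K.PairClosed Λ) (hMΛ : M ⊆ Λ) (hU : K.RangeIn Λ U) (σ : Config) :
    K.energy Λ σ - K.energy M σ = -(1 / 2) * K.bilin (Λ \ M) (Λ \ M) (spinVal σ)
      - K.bilin (Λ \ M) (U \ Λ) (spinVal σ)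
      + (1 / 2) * ((Λ.card - M.card) * K.kac 0 0)
      - K.ε * ∑ p ∈ K.lowSites (Λ \ M), spinVal σ p * spinVal σ (up p) := by
  rw [hK.energy_eq hΛ hU, hK.energy_eq hM (hU.mono hMΛ)]
  set s := spinVal σ
  have hadd1 : ∀ T, K.bilin Λ T s = K.bilin (Λ \ M) T s + K.bilin M T s := fun T => by
    unfold bilin
    rw [Finset.sum_sdiff hMΛ]
  have hadd2 : ∀ T, K.bilin T Λ s = K.bilin T (Λ \ M) s + K.bilin T M s := fun T => by
    unfold bilin
    rw [← Finset.sum_add_distrib]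
    exact Finset.sum_congr rfl fun p _ => (Finset.sum_sdiff hMΛ).symm
  have hUM : K.bilin M (U \ M) s = K.bilin M (U \ Λ) s + K.bilin M (Λ \ M) s := by
    unfold bilin
    rw [← Finset.sum_add_distrib]
    refine Finset.sum_congr rfl fun p _ => ?_
    have hsub : Λ \ M ⊆ U \ M := Finset.sdiff_subset_sdiff hU.subset subset_rfl
    have hsd : (U \ M) \ (Λ \ M) = U \ Λ := by
      ext q
      simp only [Finset.mem_sdiff]
      constructor
      · rintro ⟨⟨h1, h2⟩, h3⟩
        exact ⟨h1, fun h => h3 ⟨h, h2⟩⟩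
      · rintro ⟨h1, h2⟩
        exact ⟨⟨h1, fun h => h2 (hMΛ h)⟩, fun h => h2 h.1⟩
    rw [← Finset.sum_sdiff hsub, hsd]
  have hsymm : K.bilin (Λ \ M) M s = K.bilin M (Λ \ M) s := by
    unfold bilin
    rw [Finset.sum_comm]
    exact Finset.sum_congr rfl fun p _ => Finset.sum_congr rfl fun q _ => by
      rw [hK.siteKer_comm]; ring
  have hlow := Finset.sum_sdiff (lowSites_subset (K := K) hMΛ) (f := fun p => s p * s (up p))
  rw [lowSites_sdiff, hadd1 Λ, hadd2, hadd2 M, hadd1 (U \ Λ), hUM, hsymm, ← hlow]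
  ring

/-- The energy outside `M` is invariant under a flip which is constant along the bonds
outside `M`. -/
theorem KernelBounds.energy_sub_flip (hK : K.KernelBounds C c k₀) (hM : K.PairClosed M)
    (hΛ : K.PairClosed Λ) (hMΛ : M ⊆ Λ) (hU : K.RangeIn Λ U) {θ σ σ' : Config}
    (hθ : ∀ p ∉ M, ∀ q : Site, |q.1 / (K.tileLen : ℤ) - p.1 / (K.tileLen : ℤ)| ≤ 1 →
      |q.2 - p.2| ≤ 1 → θ q = θ p)
    (hσ : ∀ p ∉ M, σ' p = θ p * σ p) :
    K.energy Λ σ' - K.energy M σ' = K.energy Λ σ - K.energy M σ := by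
  have hval : ∀ p ∉ M, spinVal σ' p = spinVal θ p * spinVal σ p := fun p hp => by
    rw [← spinVal_mul]
    simp only [spinVal, hσ p hp, Pi.mul_apply]
  have hprod : ∀ p ∉ M, ∀ q ∉ M, |q.1 / (K.tileLen : ℤ) - p.1 / (K.tileLen : ℤ)| ≤ 1 →
      |q.2 - p.2| ≤ 1 → spinVal σ' p * spinVal σ' q = spinVal σ p * spinVal σ q := by
    intro p hp q hq h1 h2
    have h3 : spinVal θ q = spinVal θ p := by simp only [spinVal, hθ p hp q h1 h2]
    rw [hval p hp, hval q hq, h3]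
    linear_combination spinVal σ p * spinVal σ q * spinVal_mul_self θ p
  have hbil : ∀ T : Finset Site, (∀ q ∈ T, q ∉ M) →
      K.bilin (Λ \ M) T (spinVal σ') = K.bilin (Λ \ M) T (spinVal σ) := by
    intro T hT
    unfold bilin
    refine Finset.sum_congr rfl fun p hp => Finset.sum_congr rfl fun q hq => ?_
    by_cases h0 : K.siteKer p q = 0
    · rw [h0]; ring
    · have h := hK.close_of_siteKer_ne_zero h0
      rw [mul_assoc, mul_assoc, hprod p (Finset.mem_sdiff.1 hp).2 q (hT q hq) h.2 (by simp [h.1])]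
  rw [hK.energy_sub_eq hM hΛ hMΛ hU, hK.energy_sub_eq hM hΛ hMΛ hU,
    hbil _ fun q hq => (Finset.mem_sdiff.1 hq).2,
    hbil _ fun q hq hqM => (Finset.mem_sdiff.1 hq).2 (hMΛ hqM)]
  congr 2
  refine Finset.sum_congr rfl fun p hp => ?_
  have hp' := K.mem_lowSites.1 hp
  have hpM := (Finset.mem_sdiff.1 hp'.1).2
  exact hprod p hpM (up p) (fun h => hpM ((hM p hp'.2).2 h)) (by simp [up]) (by simp [up])

/-- The profile of a flipped configuration. -/
theorem blockAvg_flip {ℓ : ℕ} (hℓ : 0 < ℓ) (hd : ℓ ∣ K.tileLen) (hMB : BlockClosed ℓ M)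
    {θ σ σ' : Config}
    (hθ : ∀ p ∉ M, ∀ q : Site, |q.1 / (K.tileLen : ℤ) - p.1 / (K.tileLen : ℤ)| ≤ 1 →
      |q.2 - p.2| ≤ 1 → θ q = θ p)
    (hσ : ∀ p ∉ M, σ' p = θ p * σ p) {p : Site} (hp : p ∉ M) :
    blockAvg ℓ (spinVal σ') p = spinVal θ p * blockAvg ℓ (spinVal σ) p := by
  unfold blockAvg
  rw [mul_left_comm]
  congr 1
  rw [Finset.mul_sum]
  refine Finset.sum_congr rfl fun q hq => ?_
  have hq' := (mem_blockOf hℓ).1 hq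
  have hqM : q ∉ M := fun h => hp (hMB q p hq'.1.symm hq'.2.symm h)
  have h1 : θ q = θ p := hθ p hp q (by rw [ediv_eq_of_dvd hd hq'.2]; simp) (by simp [hq'.1])
  have h2 : spinVal θ p = spinVal θ q := by simp only [spinVal, h1]
  rw [h2, ← spinVal_mul]
  simp only [spinVal, hσ q hqM, Pi.mul_apply]

/-- A profile close to a well determines the phase. -/
theorem eta_eq_of_profile (hα : K.α ≤ 1 / 2) (hζ : K.zeta < spontMag K.ε) {δ : ℝ}
    (hδ : δ ≤ K.zeta) {s : SignType} (hs : s = 1 ∨ s = -1) (hM : BlockClosed K.ellMinus M)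
    {σ : Config} (hσ : ∀ p ∈ M, |K.profile σ p - s * spontMag K.ε| ≤ δ) {p : Site} (hp : p ∈ M) :
    K.eta σ p = s := by
  rw [eta_eq_iff hζ hs, empMag_eq, ← blockAvg_blockAvg K.blockLen_pos K.ellMinus_pos
    (K.blockLen_dvd_ellMinus hα), abs_sub_comm]
  refine abs_sub_blockAvg_le K.ellMinus_pos fun q hq => ?_
  rw [abs_sub_comm]
  exact (hσ q (hM.blockOf_subset K.ellMinus_pos hp hq)).trans hδ

theorem excess_neg (m : ℝ) (u : Site → ℝ) : K.excess (-m) M u = K.excess m M u := by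
  have h : dualEnergy K.ε (-m) (-m) = dualEnergy K.ε m m := by
    rw [dualEnergy, dualEnergy, pressure_eq, pressure_eq]
    have h1 : -m + -m = -(m + m) := by ring
    have h2 : -m - -m = -(m - m) := by ring
    rw [h1, h2, Real.cosh_neg, Real.cosh_neg]
    ring
  unfold excess
  rw [h]

theorem excess_sign_mul {s : SignType} (hs : s = 1 ∨ s = -1) (m : ℝ) (u : Site → ℝ) :
    K.excess (s * m) M u = K.excess m M u := by
  rcases hs with rfl | rfl
  · simp
  · simpa using excess_neg m u

end KacModel


/-! ### Comparison of the partition functions with and without contour -/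

namespace KacModel

/-- The gain in excess free energy for each defect. -/
noncomputable def defectCost (K : KacModel) (c : ℝ) : ℝ :=
  c * K.γ * K.ellMinus ^ 2 * K.zeta ^ 2 / 8

/-- The constant which bounds the distance to the wells in a boundary layer. -/
noncomputable def layerConst (c κ : ℝ) (k₀ : ℕ) : ℝ := 24 * 2 ^ k₀ / c + 4 / κ

/-- The conditions on the parameters: `γ` is small, depending on `ε`, `α` and `a`. -/
structure Admissible (K : KacModel) (C c κ δ : ℝ) (k₀ N : ℕ) : Prop where
  kernel : K.KernelBounds C c k₀
  C_pos : 0 < C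
  c_pos : 0 < c
  C_mul_le : C * K.γ ≤ 1
  alpha_le : K.α ≤ 1 / 2
  kappa_pos : 0 < κ
  well : ∀ x y : ℝ, |x| ≤ 1 → |y| ≤ 1 → κ * wellDist (spontMag K.ε) x y ≤
    dualEnergy K.ε x y - dualEnergy K.ε (spontMag K.ε) (spontMag K.ε)
  spontMag_pos : 0 < spontMag K.ε
  spontMag_lt : spontMag K.ε < 1
  slope : diagSlope (Real.exp (-2 * K.ε)) (2 * spontMag K.ε) = 0
  cell_le : 2 * K.ellMinus * 2 ^ k₀ ≤ 2 ^ K.scales.n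
  cell_kappa : c * K.γ * K.ellMinus ≤ 4 * κ
  zeta_lt : 2 * K.zeta < spontMag K.ε
  delta_pos : 0 < δ
  delta_le_one : δ ≤ 1
  delta_le : δ ≤ K.zeta
  delta_block : 16 ≤ δ ^ 2 * K.blockLen
  layers_le : N + 5 ≤ K.height
  -- Per rectangle, the a priori upper bound of the excess against its lower bound multiplied by the
  -- growth over `N` layers.
  layers : (|1 + |K.ε| - dualEnergy K.ε (spontMag K.ε) (spontMag K.ε)| + 2)
      * ((K.ellPlus : ℝ) * K.height) <
    (1 + 1 / (2 * layerConst c κ k₀)) ^ N * (K.defectCost c / 9)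

variable {K : KacModel} {C c κ δ : ℝ} {k₀ N : ℕ}

theorem zeta_pos : 0 < K.zeta := Real.rpow_pos_of_pos K.gamma_pos _

theorem diagSlope_sign_mul {q m : ℝ} {s : SignType} (hs : s = 1 ∨ s = -1)
    (h : diagSlope q (2 * m) = 0) : diagSlope q (2 * (s * m)) = 0 := by
  rcases hs with rfl | rfl
  · simpa using h
  · have e : (2 : ℝ) * (((-1 : SignType) : ℝ) * m) = -(2 * m) := by simp
    rw [e]
    unfold diagSlope at *
    rw [Real.sinh_neg, Real.cosh_neg]
    linear_combination -h

namespace Admissible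

variable (h : Admissible K C c κ δ k₀ N)
include h

theorem zeta_lt_spontMag : K.zeta < spontMag K.ε := by
  have := h.zeta_lt
  have := zeta_pos (K := K)
  linarith

theorem abs_sign_mul_le {s : SignType} (hs : s = 1 ∨ s = -1) :
    |(s : ℝ) * spontMag K.ε| ≤ 1 := by
  have h1 := h.spontMag_pos
  have h2 := h.spontMag_lt
  rcases hs with rfl | rfl <;> rw [abs_le] <;> simp <;> constructor <;> linarith

theorem layerConst_pos : 0 < layerConst c κ k₀ := by
  have := h.c_pos
  have := h.kappa_pos
  unfold layerConst
  positivity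

theorem vert_ge : k₀ ≤ K.scales.vert := by
  have h1 := h.cell_le
  have h2 := K.minus_add_vert
  unfold ellMinus at h1
  rw [← pow_succ', ← pow_add, Nat.pow_le_pow_iff_right (by norm_num)] at h1
  omega

/-- Configurations with good profile satisfy the constraint in the denominator, if so does the
outside. -/
theorem mem_denConstraint {Γ : Contour} {s : SignType} (hs : s = 1 ∨ s = -1) {M : Finset Site}
    (hM : BlockClosed K.ellMinus M) {σ : Config}
    (hgood : ∀ p ∈ M, |K.profile σ p - s * spontMag K.ε| ≤ δ)
    (hout : ∀ p ∉ M, ∀ r, (r ∈ Γ.sp ∨ ∃ B, IsInterior (Γ.sp : Set RectIdx) B ∧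
      r ∈ outBoundary Γ.sp B) → RectNear (K.rectOf p) r → K.eta σ p = s) :
    σ ∈ K.denConstraint s Γ := by
  have key : ∀ r, (r ∈ Γ.sp ∨ ∃ B, IsInterior (Γ.sp : Set RectIdx) B ∧
      r ∈ outBoundary Γ.sp B) → K.Theta σ r = s := by
    intro r hr
    refine theta_eq_of_etaOnBlock hs (etaOnBlock_iff.2 fun p hp => ?_)
    by_cases hpM : p ∈ M
    · exact eta_eq_of_profile h.alpha_le h.zeta_lt_spontMag h.delta_le hs hM hgood hpM
    · exact hout p hpM r hr hp
  exact ⟨fun r hr => key r (Or.inl hr), fun B hB r hr => key r (Or.inr ⟨B, hB, hr⟩)⟩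

/-- The law of large numbers in `c(Γ)` provides a configuration with all block averages within `δ ≤
ζ` of `s m`; together with the boundary spins it has the phase `s` wherever the constraint looks. -/
theorem weightDen_pos {Γ : Contour} {s : SignType} (hs : s = 1 ∨ s = -1) {σbar : Config}
    (hbar : K.IsBoundarySpins s Γ σbar) : 0 < K.weightDen s Γ σbar := by
  classical
  have hd : K.ellMinus ∣ K.ellPlus := K.ellMinus_dvd_tileLen.trans K.tileLen_dvd_ellPlus
  have hMP : K.PairClosed (K.filled Γ) := K.pairClosed_region _
  have hMB : BlockClosed K.blockLen (K.filled Γ) := K.blockClosed_region K.blockLen_dvd_ellPlus _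
  have hMB' : BlockClosed K.ellMinus (K.filled Γ) := K.blockClosed_region hd _
  have h1 := spinSum_gibbs_good_ge (K := K) (diagSlope_sign_mul hs h.slope) (h.abs_sign_mul_le hs)
    h.delta_pos h.delta_block hMP hMB σbar
  have h2 := lt_of_lt_of_le (by positivity) h1
  obtain ⟨τ, _, hτ⟩ := Finset.exists_ne_zero_of_sum_ne_zero h2.ne'
  have hgood : ∀ p ∈ K.filled Γ, |blockAvg K.blockLen (spinVal (glue (K.filled Γ) τ σbar)) p
      - s * spontMag K.ε| ≤ δ := by
    by_contra hcon
    exact hτ (if_neg hcon)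
  have hden : glue (K.filled Γ) τ σbar ∈ K.denConstraint s Γ := by
    refine h.mem_denConstraint hs hMB' hgood fun p hp r hr hn => ?_
    have hpf : K.rectOf p ∉ filledRects (Γ.sp : Set RectIdx) := fun hc => hp (mem_filled.2 hc)
    have hpA : K.rectOf p ∉ Γ.sp := fun hc => hpf (Or.inl hc)
    rcases hr with hr | ⟨B, hB, hr⟩
    · have hadj : starGraph.Adj (K.rectOf p) r := hn.adj fun he => hpA (he ▸ hr)
      rw [← hbar _ ⟨mem_extRects_of_notMem hpf, r, hr, hadj⟩ p (K.mem_Q.2 rfl)]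
      refine eta_congr ?_
      rw [empMag_eq, empMag_eq]
      refine blockAvg_congr fun q hq => ?_
      have hq' := (mem_blockOf K.ellMinus_pos).1 hq
      unfold spinVal
      rw [glue_of_notMem]
      exact fun hqf => hp (hMB' q p hq'.1.symm hq'.2.symm hqf)
    -- Impossible case: a rectangle near an interior and outside `sp(Γ)` belongs to that interior,
    -- hence to `c(Γ)`.
    · by_cases he : K.rectOf p = r
      · exact absurd (Or.inr ⟨B, hB, he ▸ hr.1⟩) hpf
      · exact absurd (Or.inr ⟨B, hB, hB.1.mem_of_adj hr.1 hpA (hn.adj he).symm⟩) hpf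
  unfold weightDen partitionFn
  refine Finset.sum_pos' (fun τ _ => ?_) ⟨τ, Finset.mem_univ _, ?_⟩
  · split_ifs <;> positivity
  · rw [if_pos hden]
    positivity

variable {σ₀ σ : Config} {A : Finset RectIdx} {d : ℕ}

theorem excess_anti {M T : Finset Site} (hT : T ⊆ M) (σ : Config) :
    K.excess (spontMag K.ε) T (K.profile σ) ≤ K.excess (spontMag K.ε) M (K.profile σ) := by
  have h1 := h.kernel.excess_add_le (m := spontMag K.ε) (u := K.profile σ) hT
  have h2 := h.kernel.excess_nonneg h.kappa_pos (abs_profile_le (K := K) σ) h.well (M \ T)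
  linarith

/-- The excess free energy of a contour, in any of its inner parts. -/
theorem gain_le_excess (hA : Isolated K σ₀ A)
    (hσ : ∀ p ∈ K.region A, K.eta σ p = K.eta σ₀ p) (hd : d ≤ N) :
    A.card * (K.defectCost c / 9) ≤
      K.excess (spontMag K.ε) (K.deep (K.region A) d) (K.profile σ) := by
  have h1 := h.kernel.mul_card_le_excess h.c_pos h.alpha_le h.kappa_pos h.well h.cell_le
    h.cell_kappa zeta_pos.le h.zeta_lt hA (d := N) (by exact_mod_cast h.layers_le) hσ
  have h2 := h.excess_anti (deep_anti (K := K) (Λ := K.region A) hd) σ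
  unfold defectCost
  linarith

/-- One of the layers has small excess free energy. -/
theorem exists_layer (hA : Isolated K σ₀ A) (hne : A.Nonempty)
    (hσ : ∀ p ∈ K.region A, K.eta σ p = K.eta σ₀ p) :
    ∃ d < N, layerConst c κ k₀ * K.excess (spontMag K.ε)
        (K.deep (K.region A) d \ K.deep (K.region A) (d + 1)) (K.profile σ) ≤
      (1 / 2) * K.excess (spontMag K.ε) (K.deep (K.region A) (d + 1)) (K.profile σ) := by
  refine exists_small_increment
    (E := fun d => K.excess (spontMag K.ε) (K.deep (K.region A) d) (K.profile σ))
    (y := fun d => K.excess (spontMag K.ε)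
        (K.deep (K.region A) d \ K.deep (K.region A) (d + 1)) (K.profile σ))
    h.layerConst_pos (fun d _ => h.kernel.excess_add_le (deep_succ_subset d)) ?_
  have h0 : 0 < A.card := hne.card_pos
  have h0' : (0 : ℝ) < A.card := by exact_mod_cast h0
  have hlc := h.layerConst_pos
  calc K.excess (spontMag K.ε) (K.deep (K.region A) 0) (K.profile σ)
      ≤ K.excess (spontMag K.ε) (K.region A) (K.profile σ) := h.excess_anti (deep_subset 0) σ
    _ ≤ (|1 + |K.ε| - dualEnergy K.ε (spontMag K.ε) (spontMag K.ε)| + 2) * (K.region A).card :=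
        h.kernel.excess_le h.C_mul_le (abs_profile_le σ)
    _ = A.card * ((|1 + |K.ε| - dualEnergy K.ε (spontMag K.ε) (spontMag K.ε)| + 2)
        * ((K.ellPlus : ℝ) * K.height)) := by
        rw [card_region]
        push_cast
        ring
    _ < A.card * ((1 + 1 / (2 * layerConst c κ k₀)) ^ N * (K.defectCost c / 9)) :=
        mul_lt_mul_of_pos_left h.layers h0'
    _ = (1 + 1 / (2 * layerConst c κ k₀)) ^ N * (A.card * (K.defectCost c / 9)) := by ring
    _ ≤ _ := by
        gcongr
        exact h.gain_le_excess hA hσ le_rfl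

end Admissible

end KacModel


/-! ### Flip, cut and sum over the layers -/

namespace KacModel

variable {K : KacModel} {C c κ δ : ℝ} {k₀ N : ℕ}

/-- The flip which turns the phases of a contour into the phase `s`. -/
noncomputable def phaseFlip (K : KacModel) (σ₀ : Config) (A : Finset RectIdx)
    (τ : RectIdx → SignType) (s : SignType) : Config :=
  fun p => signUnit s * signUnit (K.phaseAt σ₀ A τ p)

theorem spinVal_phaseFlip {σ₀ : Config} {A : Finset RectIdx} {τ : RectIdx → SignType}
    {s : SignType} (hs : s ≠ 0) {p : Site} (hp : K.phaseAt σ₀ A τ p ≠ 0) :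
    spinVal (K.phaseFlip σ₀ A τ s) p = s * K.phaseAt σ₀ A τ p := by
  unfold spinVal phaseFlip
  push_cast
  rw [coe_signUnit hs, coe_signUnit hp]

theorem errRate_nonneg (hC : 0 ≤ C) (hδ : 0 ≤ δ) : 0 ≤ K.errRate C δ := by
  have hγ := K.gamma_pos
  have hL : (0 : ℝ) ≤ K.blockLen := by positivity
  have hlog : 0 ≤ Real.log (2 * ((K.blockLen : ℝ) + 1) ^ 2) := Real.log_nonneg (by nlinarith)
  unfold errRate
  positivity

namespace Admissible

variable (h : Admissible K C c κ δ k₀ N) {Γ : Contour} {σ₀ σbar : Config} {s : SignType}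
  {τ : RectIdx → SignType} {d : ℕ}
include h

/-- The cut between the inner part and a layer with small excess free energy. -/
theorem half_cut_le (hA : Isolated K σ₀ Γ.sp) (hτ : OuterPhase K σ₀ Γ.sp s τ)
    (hs : s = 1 ∨ s = -1) (hd : d < N) {σ ρ : Config}
    (hσ : ∀ p ∈ K.region Γ.sp, K.eta σ p = K.eta σ₀ p)
    (hlayer : layerConst c κ k₀ * K.excess (spontMag K.ε)
        (K.deep (K.region Γ.sp) d \ K.deep (K.region Γ.sp) (d + 1)) (K.profile σ) ≤
      (1 / 2) * K.excess (spontMag K.ε) (K.deep (K.region Γ.sp) (d + 1)) (K.profile σ))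
    (hρ : ∀ p ∉ K.deep (K.region Γ.sp) (d + 1), σ p = ρ p) (U : Finset Site) :
    (1 / 2) * ∑ p ∈ K.deep (K.region Γ.sp) (d + 1), ∑ q ∈ U \ K.deep (K.region Γ.sp) (d + 1),
        K.siteKer p q * (s * spontMag K.ε -
          K.profile (K.phaseFlip σ₀ Γ.sp τ s * ρ) q) ^ 2 ≤
      (1 / 2) * K.excess (spontMag K.ε) (K.deep (K.region Γ.sp) (d + 1)) (K.profile σ) := by
  set M := K.deep (K.region Γ.sp) (d + 1) with hM
  set θ := K.phaseFlip σ₀ Γ.sp τ s with hθ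
  have hs0 : s ≠ 0 := by rcases hs with rfl | rfl <;> decide
  have hheight := h.layers_le
  have hclose := fun p (hp : p ∉ M) => hτ.phaseAt_close hA (d := d + 1) (by
    push_cast; have : ((N + 5 : ℕ) : ℤ) ≤ K.height := by exact_mod_cast hheight
    push_cast at this; omega) hp
  have hθc : ∀ p ∉ M, ∀ q : Site, |q.1 / (K.tileLen : ℤ) - p.1 / (K.tileLen : ℤ)| ≤ 1 →
      |q.2 - p.2| ≤ 1 → θ q = θ p := fun p hp q h1 h2 => by
    rw [hθ, phaseFlip, phaseFlip, (hclose p hp).2 q h1 h2]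
  have h1 := h.kernel.sum_siteKer_layer_le h.C_mul_le (d := d) (K.region Γ.sp) U
    (f := fun q => (s * spontMag K.ε - K.profile (θ * ρ) q) ^ 2) fun q => sq_nonneg _
  have h2 := h.kernel.sum_sq_layer_le h.c_pos h.alpha_le h.kappa_pos h.well h.vert_ge
    h.zeta_lt_spontMag hA (d := d) (by
      have : ((N + 5 : ℕ) : ℤ) ≤ K.height := by exact_mod_cast hheight
      push_cast at this; omega) hσ
  -- In the layer the phase is `η`, and the flip multiplies by `s η`: the distance of the flipped
  -- profile to `s m` is the distance of the original one to its own well `η m`.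
  have h3 : ∑ q ∈ K.deep (K.region Γ.sp) d \ M,
      ((s : ℝ) * spontMag K.ε - K.profile (θ * ρ) q) ^ 2 =
      ∑ q ∈ K.deep (K.region Γ.sp) d \ M,
        (K.profile σ q - (K.eta σ₀ q : ℝ) * spontMag K.ε) ^ 2 := by
    refine Finset.sum_congr rfl fun q hq => ?_
    obtain ⟨hq1, hq2⟩ := Finset.mem_sdiff.1 hq
    have hqA : K.rectOf q ∈ Γ.sp := K.mem_region.1 (deep_subset d hq1)
    have h4 : K.profile (θ * ρ) q = spinVal θ q * K.profile σ q :=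
      blockAvg_flip (σ := σ) (σ' := θ * ρ) K.blockLen_pos K.blockLen_dvd_tileLen
        (blockClosed_deep K.blockLen_dvd_tileLen _) hθc (fun p hp => by
          rw [Pi.mul_apply, hρ p hp]) hq2
    have h0 := (hclose q hq2).1
    rw [h4, hθ, spinVal_phaseFlip hs0 h0, phaseAt_of_mem hqA]
    rw [phaseAt_of_mem hqA] at h0
    have e1 := sign_coe_mul_self hs0
    have e2 := sign_coe_mul_self h0
    generalize (s : ℝ) = x at *
    generalize ((K.eta σ₀ q : SignType) : ℝ) = y at *
    generalize K.profile σ q = w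
    generalize spontMag K.ε = m
    linear_combination (m ^ 2 + y * y * w ^ 2 - 2 * m * y * w) * e1 + (w ^ 2 - m ^ 2) * e2
  rw [h3] at h1
  unfold layerConst at hlayer
  linarith

open Classical in
/-- The comparison of the partition functions in the inner part of the contour. -/
theorem spinSum_deep_le (hΓ : K.IsContourOf σ₀ Γ) (hτ : OuterPhase K σ₀ Γ.sp s τ)
    (hs : s = 1 ∨ s = -1) (hbar : K.IsBoundarySpins s Γ σbar) (hd : d < N) {ρ : Config}
    (hρ : ∀ p ∉ K.filled Γ, ρ p = σbar p) :
    spinSum (K.deep (K.region Γ.sp) (d + 1)) ρ (fun σ =>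
      if σ ∈ K.numConstraint Γ ∧ layerConst c κ k₀ * K.excess (spontMag K.ε)
          (K.deep (K.region Γ.sp) d \ K.deep (K.region Γ.sp) (d + 1)) (K.profile σ) ≤
        (1 / 2) * K.excess (spontMag K.ε) (K.deep (K.region Γ.sp) (d + 1)) (K.profile σ)
      then Real.exp (-K.energy (K.filled Γ) σ) else 0) ≤
    Real.exp (-(Γ.sp.card * (K.defectCost c / 18)) + K.errRate C δ * (K.region Γ.sp).card) *
      spinSum (K.deep (K.region Γ.sp) (d + 1)) (K.phaseFlip σ₀ Γ.sp τ s * ρ) (fun σ =>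
        if σ ∈ K.denConstraint s Γ then Real.exp (-K.energy (K.filled Γ) σ) else 0) := by
  set M := K.deep (K.region Γ.sp) (d + 1) with hM
  set θ := K.phaseFlip σ₀ Γ.sp τ s with hθ
  set valid : Config → Prop := fun σ => σ ∈ K.numConstraint Γ ∧
    layerConst c κ k₀ * K.excess (spontMag K.ε)
      (K.deep (K.region Γ.sp) d \ M) (K.profile σ) ≤
    (1 / 2) * K.excess (spontMag K.ε) M (K.profile σ) with hvalid
  have hA := hΓ.isolated
  have hs0 : s ≠ 0 := by rcases hs with rfl | rfl <;> decide
  have hheight := h.layers_le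
  have hclose := fun p (hp : p ∉ M) => hτ.phaseAt_close hA (d := d + 1) (by
    push_cast; have : ((N + 5 : ℕ) : ℤ) ≤ K.height := by exact_mod_cast hheight
    push_cast at this; omega) hp
  have hθc : ∀ p ∉ M, ∀ q : Site, |q.1 / (K.tileLen : ℤ) - p.1 / (K.tileLen : ℤ)| ≤ 1 →
      |q.2 - p.2| ≤ 1 → θ q = θ p := fun p hp q h1 h2 => by
    rw [hθ, phaseFlip, phaseFlip, (hclose p hp).2 q h1 h2]
  have hMΛ : M ⊆ K.filled Γ := (deep_subset _).trans region_subset_filled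
  have hMP : K.PairClosed M := pairClosed_deep _
  have hMB : BlockClosed K.blockLen M := blockClosed_deep K.blockLen_dvd_tileLen _
  have hMB' : BlockClosed K.ellMinus M := blockClosed_deep K.ellMinus_dvd_tileLen _
  have hΛP : K.PairClosed (K.filled Γ) := K.pairClosed_region _
  obtain ⟨U, hUB, hU⟩ := exists_rangeIn (K := K) (K.filled Γ)
  have hnum : ∀ σ, valid σ → ∀ p ∈ K.region Γ.sp, K.eta σ p = K.eta σ₀ p := fun σ hσ p hp => by
    rw [hσ.1.1 p hp, hΓ.2.2 p hp]
  have hrhs : 0 ≤ spinSum M (θ * ρ) (fun σ =>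
      if σ ∈ K.denConstraint s Γ then Real.exp (-K.energy (K.filled Γ) σ) else 0) :=
    spinSum_nonneg fun σ _ => by split_ifs <;> positivity
  -- Without a valid extension of `ρ` the left side is zero. Otherwise one valid `σ₁` certifies that
  -- `ρ` has the prescribed phases outside `M`, which is needed to check the constraint of the
  -- denominator after the flip.
  by_cases hex : ∃ σ, (∀ p ∉ M, σ p = ρ p) ∧ valid σ
  swap
  · refine le_trans (le_of_eq ?_) (mul_nonneg (Real.exp_pos _).le hrhs)
    unfold spinSum
    refine Finset.sum_eq_zero fun τ' _ => if_neg fun hv => hex ⟨_, fun p hp => ?_, hv⟩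
    exact glue_of_notMem _ _ hp
  obtain ⟨σ₁, hσ₁, hv₁⟩ := hex
  -- the energy outside `M` is the same before and after the flip
  set R := K.energy (K.filled Γ) ρ - K.energy M ρ with hR
  have hRσ : ∀ σ, (∀ p ∉ M, σ p = ρ p) → K.energy (K.filled Γ) σ = R + K.energy M σ := by
    intro σ hσ
    have := h.kernel.energy_sub_flip hMP hΛP hMΛ hU (θ := 1) (σ := ρ) (σ' := σ)
      (fun _ _ _ _ _ => rfl) (fun p hp => by simpa using hσ p hp)
    linarith
  have hRσ' : ∀ σ, (∀ p ∉ M, σ p = (θ * ρ) p) → K.energy (K.filled Γ) σ = R + K.energy M σ := by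
    intro σ hσ
    have := h.kernel.energy_sub_flip hMP hΛP hMΛ hU (σ := ρ) (σ' := σ) hθc
      (fun p hp => by rw [hσ p hp, Pi.mul_apply])
    linarith
  have hlhs : spinSum M ρ (fun σ => if valid σ then Real.exp (-K.energy (K.filled Γ) σ) else 0) =
      Real.exp (-R) * spinSum M ρ (fun σ => if valid σ then Real.exp (-K.energy M σ) else 0) := by
    rw [← spinSum_const_mul]
    refine spinSum_congr fun σ hσ => ?_
    rw [hRσ σ hσ, neg_add, Real.exp_add, mul_ite, mul_zero]
  have hprofile : ∀ q ∉ M, K.profile (θ * ρ) q ^ 2 = K.profile ρ q ^ 2 := fun q hq => by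
    have : K.profile (θ * ρ) q = spinVal θ q * K.profile ρ q :=
      blockAvg_flip (σ := ρ) (σ' := θ * ρ) K.blockLen_pos K.blockLen_dvd_tileLen hMB hθc
        (fun p _ => Pi.mul_apply _ _ _) hq
    rw [this]
    linear_combination K.profile ρ q ^ 2 * spinVal_mul_self θ q
  -- Half of the excess in `M` pays for the cut; the other half is at least half of `defectCost / 9`
  -- per rectangle, whence the `18`.
  have hmain := h.kernel.spinSum_le_of_excess h.C_pos.le h.C_mul_le hMP hMB hUB (hU.mono hMΛ)
    (m := s * spontMag K.ε) (diagSlope_sign_mul hs h.slope) (h.abs_sign_mul_le hs) h.delta_pos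
    h.delta_le_one h.delta_block (ρ := ρ) (ρ' := θ * ρ)
    (Finset.sum_congr rfl fun p _ => Finset.sum_congr rfl fun q hq => by
      rw [hprofile q (Finset.mem_sdiff.1 hq).2]) valid
    (g := Γ.sp.card * (K.defectCost c / 18)) (fun σ hσ hv => by
      have h1 := h.half_cut_le hA hτ hs hd (hnum σ hv) hv.2 hσ U
      have h2 := h.gain_le_excess (d := d + 1) hA (hnum σ hv) hd
      rw [excess_sign_mul hs]
      linarith)
  rw [hlhs]
  calc _ ≤ Real.exp (-R) * (Real.exp (-(Γ.sp.card * (K.defectCost c / 18))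
          + K.errRate C δ * M.card) * spinSum M (θ * ρ) (fun σ =>
            if ∀ p ∈ M, |K.profile σ p - s * spontMag K.ε| ≤ δ
            then Real.exp (-K.energy M σ) else 0)) := by
        refine mul_le_mul_of_nonneg_left ?_ (Real.exp_pos _).le
        refine (le_of_eq (spinSum_congr fun σ _ => ?_)).trans hmain
        congr
    _ ≤ Real.exp (-R) * (Real.exp (-(Γ.sp.card * (K.defectCost c / 18))
          + K.errRate C δ * (K.region Γ.sp).card) * spinSum M (θ * ρ) (fun σ =>
            if ∀ p ∈ M, |K.profile σ p - s * spontMag K.ε| ≤ δ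
            then Real.exp (-K.energy M σ) else 0)) := by
        have herr := errRate_nonneg (K := K) h.C_pos.le h.delta_pos.le
        have hcard : (M.card : ℝ) ≤ (K.region Γ.sp).card := by
          exact_mod_cast Finset.card_le_card (deep_subset _)
        have : 0 ≤ spinSum M (θ * ρ) (fun σ =>
            if ∀ p ∈ M, |K.profile σ p - s * spontMag K.ε| ≤ δ
            then Real.exp (-K.energy M σ) else 0) :=
          spinSum_nonneg fun σ _ => by split_ifs <;> positivity
        gcongr
    _ = Real.exp (-(Γ.sp.card * (K.defectCost c / 18))
          + K.errRate C δ * (K.region Γ.sp).card) * (Real.exp (-R) * spinSum M (θ * ρ) (fun σ =>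
            if ∀ p ∈ M, |K.profile σ p - s * spontMag K.ε| ≤ δ
            then Real.exp (-K.energy M σ) else 0)) := by ring
    _ ≤ _ := by
        gcongr
        rw [← spinSum_const_mul]
        refine spinSum_le fun σ hσ => ?_
        by_cases hgood : ∀ p ∈ M, |K.profile σ p - s * spontMag K.ε| ≤ δ
        -- Outside `M` the magnetization of a cell is `s` times the phase times that of `σ₁`, so it
        -- is within `ζ` of `s m`; inside `M` the good profile decides.
        · have hden : σ ∈ K.denConstraint s Γ := by
            refine h.mem_denConstraint hs hMB' hgood fun p hp r hr hn => ?_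
            have h1 : K.eta σ₁ p = K.phaseAt σ₀ Γ.sp τ p :=
              hτ.eta_eq_phaseAt hΓ hbar hv₁.1
                (fun q hq => (hσ₁ q fun hqM => hq (hMΛ hqM)).trans (hρ q hq)) hr hn
            have h0 := (hclose p hp).1
            have hv : K.phaseAt σ₀ Γ.sp τ p = 1 ∨ K.phaseAt σ₀ Γ.sp τ p = -1 := by
              revert h0
              generalize K.phaseAt σ₀ Γ.sp τ p = t
              cases t <;> decide
            have h2 : K.empMag σ p = spinVal θ p * K.empMag σ₁ p := by
              rw [empMag_eq, empMag_eq]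
              exact blockAvg_flip K.ellMinus_pos K.ellMinus_dvd_tileLen hMB' hθc
                (fun q hq => by rw [hσ q hq, Pi.mul_apply, hσ₁ q hq]) hp
            rw [eta_eq_iff h.zeta_lt_spontMag hv] at h1
            rw [eta_eq_iff h.zeta_lt_spontMag hs, h2, hθ, spinVal_phaseFlip hs0 h0]
            have e2 := sign_coe_mul_self h0
            generalize ((K.phaseAt σ₀ Γ.sp τ p : SignType) : ℝ) = y at *
            have e3 : (s : ℝ) * y * K.empMag σ₁ p - s * spontMag K.ε =
                s * y * (K.empMag σ₁ p - y * spontMag K.ε) := by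
              linear_combination s * spontMag K.ε * e2
            have e4 : |(s : ℝ) * y| = 1 := by
              rw [← sq_eq_sq₀ (abs_nonneg _) zero_le_one, sq_abs]
              linear_combination y * y * sign_coe_mul_self hs0 + e2
            rw [e3, abs_mul, e4, one_mul]
            exact h1
          rw [if_pos hgood, if_pos hden, hRσ' σ hσ, neg_add, Real.exp_add]
        · rw [if_neg hgood, mul_zero]
          split_ifs <;> positivity

/-- The bound on the numerator of the weight of a contour. -/
theorem weightNum_le (hΓ : K.IsContourOf σ₀ Γ) (hτ : OuterPhase K σ₀ Γ.sp s τ)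
    (hs : s = 1 ∨ s = -1) (hbar : K.IsBoundarySpins s Γ σbar) :
    K.weightNum Γ σbar ≤ N * (Real.exp (-(Γ.sp.card * (K.defectCost c / 18))
      + K.errRate C δ * (K.region Γ.sp).card) * K.weightDen s Γ σbar) := by
  classical
  set θ := K.phaseFlip σ₀ Γ.sp τ s with hθ
  set e := Real.exp (-(Γ.sp.card * (K.defectCost c / 18))
      + K.errRate C δ * (K.region Γ.sp).card) with he
  set F : ℕ → Config → ℝ := fun d σ =>
    if σ ∈ K.numConstraint Γ ∧ layerConst c κ k₀ * K.excess (spontMag K.ε)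
        (K.deep (K.region Γ.sp) d \ K.deep (K.region Γ.sp) (d + 1)) (K.profile σ) ≤
      (1 / 2) * K.excess (spontMag K.ε) (K.deep (K.region Γ.sp) (d + 1)) (K.profile σ)
    then Real.exp (-K.energy (K.filled Γ) σ) else 0 with hF
  set G : Config → ℝ := fun σ =>
    if σ ∈ K.denConstraint s Γ then Real.exp (-K.energy (K.filled Γ) σ) else 0 with hG
  have hne : Γ.sp.Nonempty := by
    obtain ⟨x⟩ := hΓ.2.1.prop.2.nonempty
    exact ⟨x.1, x.2⟩
  have hF0 : ∀ d σ, 0 ≤ F d σ := fun d σ => by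
    simp only [hF]
    split_ifs <;> positivity
  have hlayer : ∀ d < N, spinSum (K.filled Γ) σbar (F d) ≤ e * K.weightDen s Γ σbar := by
    intro d hd
    set M := K.deep (K.region Γ.sp) (d + 1) with hM
    have hMΛ : M ⊆ K.filled Γ := (deep_subset _).trans region_subset_filled
    -- The exterior has the phase `s` already, so the flip is trivial there. It can then be undone
    -- by a change of variables in `c(Γ) \ M` without altering the boundary condition.
    have hθout : ∀ p ∉ K.filled Γ, (θ * σbar) p = σbar p := by
      intro p hp
      rw [mem_filled] at hp
      have h1 : K.rectOf p ∉ Γ.sp := fun hc => hp (Or.inl hc)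
      rw [Pi.mul_apply, hθ, phaseFlip, phaseAt_of_notMem h1,
        hτ.ext _ (mem_extRects_of_notMem hp), Int.units_mul_self, one_mul]
    calc spinSum (K.filled Γ) σbar (F d)
        = spinSum (K.filled Γ \ M) σbar fun ρ => spinSum M ρ (F d) := spinSum_split hMΛ _ _
      _ ≤ spinSum (K.filled Γ \ M) σbar fun ρ => e * spinSum M (θ * ρ) G :=
          spinSum_le fun ρ hρ => h.spinSum_deep_le hΓ hτ hs hbar hd fun p hp =>
            hρ p fun hc => hp (Finset.mem_sdiff.1 hc).1
      _ = e * spinSum (K.filled Γ \ M) σbar fun ρ => spinSum M (θ * ρ) G :=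
          spinSum_const_mul _ _ _ _
      _ = e * spinSum (K.filled Γ \ M) (θ * σbar) fun ρ => spinSum M ρ G := by
          rw [spinSum_flip (K.filled Γ \ M) θ σbar]
          simp only [← mul_assoc, config_mul_self, one_mul]
      _ = e * spinSum (K.filled Γ) σbar G := by
          rw [← spinSum_split hMΛ, spinSum_congr_boundary hθout]
      _ = _ := rfl
  calc K.weightNum Γ σbar
      = spinSum (K.filled Γ) σbar fun σ =>
        if σ ∈ K.numConstraint Γ then Real.exp (-K.energy (K.filled Γ) σ) else 0 := rfl
    -- The depth of the cheap layer depends on the configuration; a union bound over the `N` depths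
    -- is affordable.
    _ ≤ spinSum (K.filled Γ) σbar fun σ => ∑ d ∈ Finset.range N, F d σ := by
        refine spinSum_le fun σ _ => ?_
        split_ifs with hσ
        · obtain ⟨d, hd, hl⟩ := h.exists_layer hΓ.isolated hne (σ := σ) fun p hp => by
            rw [hσ.1 p hp, hΓ.2.2 p hp]
          refine le_trans (le_of_eq ?_)
            (Finset.single_le_sum (fun d _ => hF0 d σ) (Finset.mem_range.2 hd))
          exact (if_pos ⟨hσ, hl⟩).symm
        · exact Finset.sum_nonneg fun d _ => hF0 d σ
    _ = ∑ d ∈ Finset.range N, spinSum (K.filled Γ) σbar (F d) := spinSum_sum _ _ _ _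
    _ ≤ ∑ d ∈ Finset.range N, e * K.weightDen s Γ σbar :=
        Finset.sum_le_sum fun d hd => hlayer d (Finset.mem_range.1 hd)
    _ = _ := by rw [Finset.sum_const, Finset.card_range, nsmul_eq_mul]

end Admissible

end KacModel


/-! ### The choice of the parameters -/

open Filter Topology in
theorem eventually_rpow_le {p b : ℝ} (hp : 0 < p) (hb : 0 < b) :
    ∀ᶠ γ in 𝓝[>] (0 : ℝ), γ ^ p ≤ b := by
  have h : Tendsto (fun γ : ℝ => γ ^ p) (𝓝 0) (𝓝 0) := by
    have := (Real.continuousAt_rpow_const 0 p (Or.inr hp.le)).tendsto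
    rwa [Real.zero_rpow hp.ne'] at this
  exact (h.mono_left nhdsWithin_le_nhds).eventually (ge_mem_nhds hb)

open Filter Topology in
/-- An exponential of a negative power dominates any negative power. -/
theorem eventually_mul_rpow_lt_exp {α q D b : ℝ} (hα : 0 < α) (hD : 0 < D) (hb : 0 < b) :
    ∀ᶠ γ in 𝓝[>] (0 : ℝ), D * γ ^ (-q) < Real.exp (b * γ ^ (-α)) := by
  have h1 : Tendsto (fun γ : ℝ => γ ^ (-α)) (𝓝[>] 0) atTop := by
    refine ((tendsto_rpow_atTop hα).comp tendsto_inv_nhdsGT_zero).congr' ?_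
    filter_upwards [self_mem_nhdsWithin] with γ (hγ : 0 < γ)
    rw [Function.comp_apply, Real.inv_rpow hγ.le, Real.rpow_neg hγ.le]
  have h2 := h1.eventually ((isLittleO_rpow_exp_pos_mul_atTop (q / α) hb).def
    (c := 1 / (2 * D)) (by positivity))
  filter_upwards [h2, self_mem_nhdsWithin] with γ h (hγ : 0 < γ)
  have e : (γ ^ (-α)) ^ (q / α) = γ ^ (-q) := by
    rw [← Real.rpow_mul hγ.le]
    congr 1
    field_simp
  rw [e, Real.norm_of_nonneg (by positivity), Real.norm_of_nonneg (by positivity),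
    div_mul_eq_mul_div, le_div_iff₀ (by positivity)] at h
  have := Real.exp_pos (b * γ ^ (-α))
  nlinarith

namespace KacModel

variable {K : KacModel}

theorem height_cast : (K.height : ℝ) = K.γ ^ (-K.α) := by
  rw [K.scales.vert_eq, height]; push_cast; rfl

theorem ellMinus_cast : (K.ellMinus : ℝ) = K.γ ^ (-(1 - K.α)) := by
  rw [K.scales.minus_eq, ellMinus]; push_cast; rfl

theorem ellPlus_cast : (K.ellPlus : ℝ) = K.γ ^ (-(1 + K.α)) := by
  rw [K.scales.plus_eq, ellPlus]; push_cast; rfl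

theorem blockLen_cast : (K.blockLen : ℝ) = K.γ ^ (-(1 / 2) : ℝ) := by
  rw [K.scales.half_eq, blockLen]; push_cast; rfl

theorem ellPlus_mul_height : (K.ellPlus : ℝ) * K.height = K.γ ^ (-(1 + 2 * K.α)) := by
  rw [ellPlus_cast, height_cast, ← Real.rpow_add K.gamma_pos]
  congr 1; ring

/-- The exponent is `1 - 2 (1 - α) + 2 a`, written so as to exhibit the inverse volume exponent of a
rectangle: `γ^(-(1+2α))` is its number of sites. -/
theorem defectCost_eq (c : ℝ) :
    K.defectCost c = c / 8 * (K.γ ^ (-(1 + 2 * K.α)) * K.γ ^ (2 * K.a + 4 * K.α)) := by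
  have hγ := K.gamma_pos
  have e : K.γ * (K.ellMinus : ℝ) ^ 2 * K.zeta ^ 2 =
      K.γ ^ (-(1 + 2 * K.α)) * K.γ ^ (2 * K.a + 4 * K.α) := by
    rw [ellMinus_cast, zeta, ← Real.rpow_natCast, ← Real.rpow_natCast, ← Real.rpow_mul hγ.le,
      ← Real.rpow_mul hγ.le, ← Real.rpow_add hγ]
    nth_rewrite 1 [← Real.rpow_one K.γ]
    rw [← Real.rpow_add hγ, ← Real.rpow_add hγ]
    congr 1
    push_cast
    ring
  rw [← e, defectCost]
  ring

/-- With blocks of length `γ^(-1/2)`, `δ = 4 γ^(1/4)` is the smallest tolerance allowed by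
Chebyshev's inequality. It dominates: the other terms are of order `γ^(1/2)`, up to a logarithm. -/
theorem errRate_le {C : ℝ} (hC : 0 ≤ C) (hγ1 : K.γ ≤ 1) :
    K.errRate C (4 * K.γ ^ (1 / 4 : ℝ)) ≤ (43 * C + 40) * K.γ ^ (1 / 4 : ℝ) := by
  have hγ := K.gamma_pos
  have hL1 : (1 : ℝ) ≤ K.blockLen := by exact_mod_cast K.blockLen_pos
  set L : ℝ := (K.blockLen : ℝ) with hL
  have h1 : K.γ * L ≤ K.γ ^ (1 / 4 : ℝ) := by
    rw [hL, blockLen_cast]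
    nth_rewrite 1 [← Real.rpow_one K.γ]
    rw [← Real.rpow_add hγ]
    exact Real.rpow_le_rpow_of_exponent_ge hγ hγ1 (by norm_num)
  have h2 : K.γ ≤ K.γ ^ (1 / 4 : ℝ) := by
    nth_rewrite 1 [← Real.rpow_one K.γ]
    exact Real.rpow_le_rpow_of_exponent_ge hγ hγ1 (by norm_num)
  have h3 : Real.log (2 * (L + 1) ^ 2) / (2 * L) ≤ 4 * K.γ ^ (1 / 4 : ℝ) := by
    have e : K.γ ^ (1 / 4 : ℝ) * L = L ^ (1 / 2 : ℝ) := by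
      rw [hL, blockLen_cast, ← Real.rpow_add hγ, ← Real.rpow_mul hγ.le]
      norm_num
    rw [div_le_iff₀ (by positivity)]
    calc Real.log (2 * (L + 1) ^ 2) ≤ Real.log (16 * L ^ 2) :=
          Real.log_le_log (by positivity) (by nlinarith)
      _ ≤ (16 * L ^ 2) ^ (1 / 4 : ℝ) / (1 / 4) := Real.log_le_rpow_div (by positivity) (by norm_num)
      _ = 4 * (2 * L ^ (1 / 2 : ℝ)) := by
          have e16 : (16 : ℝ) = 2 ^ (4 : ℝ) := by norm_num
          rw [Real.mul_rpow (by norm_num) (by positivity), ← Real.rpow_natCast L,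
            ← Real.rpow_mul (by positivity), e16, ← Real.rpow_mul (by norm_num)]
          norm_num
          ring
      _ = 4 * K.γ ^ (1 / 4 : ℝ) * (2 * L) := by rw [← e]; ring
  unfold errRate
  rw [← hL]
  have h4 : 42 * C * K.γ * L ≤ 42 * C * K.γ ^ (1 / 4 : ℝ) := by
    rw [mul_assoc]; gcongr
  have h5 : C * K.γ ≤ C * K.γ ^ (1 / 4 : ℝ) := by gcongr
  linarith

open Filter Topology in
/-- For small `γ` the conditions on the parameters are satisfied. -/
theorem exists_admissible {C c γ₁ α a ε : ℝ} (k₀ : ℕ) (hC : 0 < C) (hc : 0 < c) (hγ₁ : 0 < γ₁)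
    (hα : 0 < α) (hα' : α < 1 / 32) (ha : 0 < a) (ha' : a < 1 / 32) (hε : 0 < ε) :
    ∃ γ₀ : ℝ, 0 < γ₀ ∧ γ₀ ≤ γ₁ ∧ ∀ K : KacModel, K.α = α → K.a = a → K.ε = ε → K.γ ≤ γ₀ →
      K.KernelBounds C c k₀ → ∃ κ δ : ℝ, ∃ N : ℕ, K.Admissible C c κ δ k₀ N ∧
        K.errRate C δ ≤ c / 576 * K.γ ^ (2 * a + 4 * α) ∧
        (N : ℝ) ≤ c / 576 * (K.γ ^ (-(1 + 2 * α)) * K.γ ^ (2 * a + 4 * α)) := by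
  obtain ⟨hm0, hm1, hz, κ, hκ, hwell⟩ := spontMag_spec hε
  set m := spontMag ε with hm
  set B := |1 + |ε| - dualEnergy ε m m| + 2 with hB
  have hB0 : 0 < B := by positivity
  have hlc : 0 < layerConst c κ k₀ := by unfold layerConst; positivity
  set b := 1 / (2 * layerConst c κ k₀) with hb
  have hb0 : 0 < b := by positivity
  have hlog : 0 < Real.log (1 + b) := Real.log_pos (by linarith)
  -- The exponents `1 / 4 - a`, `1 - 3 α - 2 a` and `1 / 4 - 4 α - 2 a` are positive for `α, a < 1 /
  -- 32`. The last condition is the growth over the layers, exponential in `γ^(-α)` against a power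
  -- of `γ`.
  have hev : ∀ᶠ γ in 𝓝[>] (0 : ℝ), γ ≤ γ₁ ∧ γ ≤ 1 ∧ C * γ ≤ 1 ∧ γ ^ α ≤ 1 / (2 * 2 ^ k₀) ∧
      γ ^ α ≤ 1 / 5 ∧ γ ^ α ≤ 4 * κ / c ∧ γ ^ a ≤ m / 3 ∧ γ ^ (1 / 4 : ℝ) ≤ 1 / 4 ∧
      γ ^ (1 / 4 - a) ≤ 1 / 4 ∧ γ ^ (1 - 3 * α - 2 * a) ≤ c / 576 ∧
      γ ^ (1 / 4 - 4 * α - 2 * a) ≤ c / 576 / (43 * C + 40) ∧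
      B * (1 + b) ^ 5 * 72 / c * γ ^ (-(2 * a + 4 * α)) <
        Real.exp (Real.log (1 + b) * γ ^ (-α)) := by
    have hle : ∀ x : ℝ, 0 < x → ∀ᶠ γ in 𝓝[>] (0 : ℝ), γ ≤ x := fun x hx =>
      mem_nhdsWithin_of_mem_nhds (ge_mem_nhds hx)
    refine (hle γ₁ hγ₁).and ((hle 1 one_pos).and (Eventually.and ?_ ?_))
    · filter_upwards [hle (1 / C) (by positivity)] with γ hγ
      rw [le_div_iff₀ hC] at hγ
      linarith
    exact (eventually_rpow_le hα (by positivity)).and <|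
      (eventually_rpow_le hα (by norm_num)).and <|
      (eventually_rpow_le hα (by positivity)).and <|
      (eventually_rpow_le ha (by positivity)).and <|
      (eventually_rpow_le (by norm_num) (by norm_num)).and <|
      (eventually_rpow_le (by linarith) (by norm_num)).and <|
      (eventually_rpow_le (by linarith) (by positivity)).and <|
      (eventually_rpow_le (by linarith) (by positivity)).and
      (eventually_mul_rpow_lt_exp hα (by positivity) hlog)
  obtain ⟨g, hg : 0 < g, hsub⟩ := mem_nhdsGT_iff_exists_Ioc_subset.1 hev
  refine ⟨min g γ₁, lt_min hg hγ₁, min_le_right _ _, fun K hKα hKa hKε hKγ hK => ?_⟩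
  subst hKα hKa hKε
  have hγ := K.gamma_pos
  obtain ⟨-, hγ1, hCγ, h1, h2, h3, h4, h5, h6, h7, h8, h9⟩ :=
    hsub ⟨hγ, hKγ.trans (min_le_left _ _)⟩
  have hpow : ∀ p : ℝ, 0 < K.γ ^ p := fun p => Real.rpow_pos_of_pos hγ p
  have hH : (K.height : ℝ) * K.γ ^ K.α = 1 := by
    rw [height_cast, ← Real.rpow_add hγ]; simp
  have hH5 : 5 ≤ K.height := by
    have : (5 : ℝ) ≤ K.height := by nlinarith [hpow K.α]
    exact_mod_cast this
  have hHk : 2 * 2 ^ k₀ ≤ K.height := by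
    have : (2 : ℝ) * 2 ^ k₀ ≤ K.height := by
      rw [le_div_iff₀ (by positivity)] at h1
      have hp := hpow K.α
      nlinarith
    exact_mod_cast this
  obtain ⟨N, hN⟩ : ∃ N, K.height = N + 5 := ⟨K.height - 5, by omega⟩
  have hNR : (K.height : ℝ) = N + 5 := by rw [hN]; push_cast; ring
  refine ⟨κ, 4 * K.γ ^ (1 / 4 : ℝ), N, ?_, ?_, ?_⟩
  · refine ⟨hK, hC, hc, hCγ, by linarith, hκ, hwell, hm0, hm1, hz, ?_, ?_, ?_, by positivity,
      by linarith, ?_, ?_, hN.ge, ?_⟩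
    · have e : 2 ^ K.scales.n = K.ellMinus * K.height := by
        rw [ellMinus, height, ← pow_add, K.minus_add_vert]
      rw [e]
      calc 2 * K.ellMinus * 2 ^ k₀ = K.ellMinus * (2 * 2 ^ k₀) := by ring
        _ ≤ _ := by gcongr
    · have e : K.γ * (K.ellMinus : ℝ) = K.γ ^ K.α := by
        rw [ellMinus_cast]
        nth_rewrite 1 [← Real.rpow_one K.γ]
        rw [← Real.rpow_add hγ]
        congr 1; ring
      rw [mul_assoc, e]
      rw [le_div_iff₀ hc] at h3
      linarith
    · unfold zeta
      rw [← hm]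
      linarith
    · unfold zeta
      have e : K.γ ^ (1 / 4 : ℝ) = K.γ ^ (1 / 4 - K.a) * K.γ ^ K.a := by
        rw [← Real.rpow_add hγ]; congr 1; ring
      rw [e]
      nlinarith [hpow K.a]
    · have e : (K.γ ^ (1 / 4 : ℝ)) ^ 2 * K.blockLen = 1 := by
        rw [blockLen_cast, ← Real.rpow_natCast, ← Real.rpow_mul hγ.le, ← Real.rpow_add hγ]
        norm_num
      rw [mul_pow, mul_assoc, e]
      norm_num
    · rw [← hm, ← hB, ellPlus_mul_height, defectCost_eq]
      -- Here `γ^(-α) = N + 5`: the five rows not used as layers are the room required near the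
      -- boundary.
      have e1 : Real.exp (Real.log (1 + b) * K.γ ^ (-K.α)) = (1 + b) ^ N * (1 + b) ^ 5 := by
        rw [← height_cast, ← pow_add, ← hN, mul_comm, Real.exp_nat_mul,
          Real.exp_log (by positivity)]
      rw [e1] at h9
      have e2 : K.γ ^ (-(2 * K.a + 4 * K.α)) * K.γ ^ (2 * K.a + 4 * K.α) = 1 := by
        rw [← Real.rpow_add hγ]; simp
      set G := K.γ ^ (2 * K.a + 4 * K.α) with hG
      have hG0 : 0 < G := hpow _
      set V := K.γ ^ (-(1 + 2 * K.α))
      have hV0 : 0 < V := hpow _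
      have h5b : (0 : ℝ) < (1 + b) ^ 5 := by positivity
      have h10 : B * 72 / c < (1 + b) ^ N * G := by
        have h11 : B * 72 / c * K.γ ^ (-(2 * K.a + 4 * K.α)) < (1 + b) ^ N := by
          refine lt_of_mul_lt_mul_right (lt_of_eq_of_lt ?_ h9) h5b.le
          ring
        calc B * 72 / c = B * 72 / c * K.γ ^ (-(2 * K.a + 4 * K.α)) * G := by
              rw [mul_assoc, e2, mul_one]
          _ < _ := by gcongr
      rw [div_lt_iff₀ hc] at h10
      calc B * V = B * 72 * (V / 72) := by ring
        _ < (1 + b) ^ N * G * c * (V / 72) := by gcongr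
        _ = _ := by ring
  · refine (errRate_le hC.le hγ1).trans ?_
    rw [le_div_iff₀ (by positivity)] at h8
    have e : K.γ ^ (1 / 4 : ℝ) =
        K.γ ^ (1 / 4 - 4 * K.α - 2 * K.a) * K.γ ^ (2 * K.a + 4 * K.α) := by
      rw [← Real.rpow_add hγ]; congr 1; ring
    rw [e]
    calc _ = K.γ ^ (1 / 4 - 4 * K.α - 2 * K.a) * (43 * C + 40) * K.γ ^ (2 * K.a + 4 * K.α) := by ring
      _ ≤ _ := by
        have := hpow (2 * K.a + 4 * K.α)
        gcongr
  · have e : K.γ ^ (-(1 + 2 * K.α)) * K.γ ^ (2 * K.a + 4 * K.α) * K.γ ^ (1 - 3 * K.α - 2 * K.a) =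
        K.γ ^ (-K.α) := by
      rw [← Real.rpow_add hγ, ← Real.rpow_add hγ]; congr 1; ring
    have hN' : (N : ℝ) ≤ K.γ ^ (-K.α) := by rw [← height_cast, hNR]; linarith
    refine hN'.trans ?_
    rw [← e, mul_comm]
    have hp1 := hpow (-(1 + 2 * K.α))
    have hp2 := hpow (2 * K.a + 4 * K.α)
    gcongr

end KacModel


/-! ### The Peierls bound -/

theorem theorem2p1 (J : ℝ → ℝ) (hJ : IsKacDensity J) :
    ∃ α₀ : ℝ, 0 < α₀ ∧ ∀ α : ℝ, 0 < α → α < α₀ →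
    ∃ a₀ : ℝ, 0 < a₀ ∧ ∀ a : ℝ, 0 < a → a < a₀ →
    ∃ c : ℝ, 0 < c ∧ ∃ ε₀ : ℝ, 0 < ε₀ ∧ ∃ γ₀ : ℝ → ℝ, (∀ ε, 0 < ε → 0 < γ₀ ε) ∧
      ∀ ε : ℝ, 0 < ε → ε ≤ ε₀ → ∀ γ : ℝ, 0 < γ → γ ≤ γ₀ ε →
      ∀ (S : DyadicScales α γ) (M : KacModel),
        M = { J := J, ε := ε, γ := γ, α := α, a := a, scales := S } →
      ∀ (s : SignType) (Γ : Contour), M.IsContour s Γ →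
      ∀ σbar : Config, M.IsBoundarySpins s Γ σbar →
        0 < M.weightDen s Γ σbar ∧
        M.weight s Γ σbar ≤
          Real.exp (-c * ((M.region Γ.sp).card : ℝ) * γ ^ (2 * a + 4 * α)) := by
  obtain ⟨C, c, γ₁, k₀, hC, hc, hγ₁, hker⟩ := KacModel.exists_kernelBounds hJ
  -- The gain per site is `c / (8 · 18) = 4 c / 576` times `γ^(2a+4α)`; the error rate and the
  -- factor `N` take `c / 576` each, and `c / 288` remains. The bound `ε₀ = 1` is arbitrary, as
  -- `spontMag_spec` holds for every `ε > 0`.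
  refine ⟨1 / 32, by norm_num, fun α hα hα' => ⟨1 / 32, by norm_num, fun a ha ha' =>
    ⟨c / 288, by positivity, 1, one_pos, ?_⟩⟩⟩
  have key : ∀ ε : ℝ, ∃ γ₀ : ℝ, 0 < γ₀ ∧ (0 < ε → γ₀ ≤ γ₁ ∧
      ∀ K : KacModel, K.α = α → K.a = a → K.ε = ε → K.γ ≤ γ₀ →
      K.KernelBounds C c k₀ → ∃ κ δ : ℝ, ∃ N : ℕ, K.Admissible C c κ δ k₀ N ∧
        K.errRate C δ ≤ c / 576 * K.γ ^ (2 * a + 4 * α) ∧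
        (N : ℝ) ≤ c / 576 * (K.γ ^ (-(1 + 2 * α)) * K.γ ^ (2 * a + 4 * α))) := by
    intro ε
    by_cases hε : 0 < ε
    · obtain ⟨γ₀, h0, h⟩ := KacModel.exists_admissible k₀ hC hc hγ₁ hα hα' ha ha' hε
      exact ⟨γ₀, h0, fun _ => h⟩
    -- An arbitrary positive value: nothing is claimed for `ε ≤ 0`.
    · exact ⟨1, one_pos, fun h => absurd h hε⟩
  choose γ₀ hpos hγ₀ using key
  refine ⟨γ₀, fun ε _ => hpos ε, ?_⟩
  intro ε hε _ γ hγ hγle S M hM s Γ hΓ σbar hbar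
  obtain ⟨hle, hadm⟩ := hγ₀ ε hε
  have hMα : M.α = α := by rw [hM]
  have hMa : M.a = a := by rw [hM]
  have hMε : M.ε = ε := by rw [hM]
  have hMγ : M.γ = γ := by rw [hM]
  have hMJ : M.J = J := by rw [hM]
  obtain ⟨κ, δ, N, h, herr, hN⟩ := hadm M hMα hMa hMε (by rw [hMγ]; exact hγle)
    (hker M hMJ (by rw [hMγ]; exact hγle.trans hle))
  obtain ⟨hs, σ₀, hσ₀, hext⟩ := hΓ
  have hs0 : s ≠ 0 := by rcases hs with rfl | rfl <;> decide
  obtain ⟨τ, hτ⟩ := hσ₀.exists_outerPhase hs0 hext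
  have hden := h.weightDen_pos hs hbar
  refine ⟨hden, ?_⟩
  unfold KacModel.weight
  rw [div_le_iff₀ hden]
  refine (h.weightNum_le hσ₀ hτ hs hbar).trans ?_
  rw [← mul_assoc]
  refine mul_le_mul_of_nonneg_right ?_ hden.le
  have hcard : 1 ≤ (Γ.sp.card : ℝ) := by
    obtain ⟨x⟩ := hσ₀.2.1.prop.2.nonempty
    exact_mod_cast Finset.card_pos.2 ⟨x.1, x.2⟩
  have hvol : ((M.region Γ.sp).card : ℝ) = Γ.sp.card * γ ^ (-(1 + 2 * α)) := by
    rw [M.card_region]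
    push_cast
    rw [KacModel.ellPlus_mul_height, hMγ, hMα]
  have hcost := KacModel.defectCost_eq (K := M) c
  rw [hMγ, hMα, hMa] at hcost
  rw [hMγ] at herr hN
  have hG : 0 < γ ^ (2 * a + 4 * α) := Real.rpow_pos_of_pos hγ _
  have hV : 0 < γ ^ (-(1 + 2 * α)) := Real.rpow_pos_of_pos hγ _
  rw [hcost, hvol]
  set G := γ ^ (2 * a + 4 * α)
  set V := γ ^ (-(1 + 2 * α))
  set n : ℝ := (Γ.sp.card : ℝ)
  -- A contour contains at least one rectangle, and `N` is at most the exponent of a single one;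
  -- then `z ≤ exp z`.
  have hN' : (N : ℝ) ≤ Real.exp (c / 576 * (n * V) * G) := by
    have h1 : c / 576 * (V * G) ≤ c / 576 * (n * V) * G := by
      have : 0 ≤ c / 576 * (V * G) := by positivity
      nlinarith
    have h2 := Real.add_one_le_exp (c / 576 * (n * V) * G)
    linarith
  calc _ ≤ Real.exp (c / 576 * (n * V) * G) *
        Real.exp (-(n * (c / 8 * (V * G) / 18)) + c / 576 * G * (n * V)) := by gcongr
    _ = Real.exp (-(c / 288) * (n * V) * G) := by
        rw [← Real.exp_add]
        congr 1
        ring
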